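/- **Setting.** Let $d\ge 1$, $\Theta=[\theta_{inf},\theta_{sup}]^p$ and $\theta_0$ an interior point of $\Theta$. Let $\{K_\theta,\theta\in\Theta\}$ be real functions on $\mathbb R^d$ such that: - each $K_\theta$ is a stationary covariance function; - $K_\theta(t)$ is three times differentiable in $\theta$, and for all $q\in\{0,\dots,3\}$ and $i_1,\dots,i_q\in\{1,\dots,p\}$ there is a finite constant $C_{i_1,\dots,i_q}$ with $\left|\frac{\partial}{\partial\theta_{i_1}}\cdots\frac{\partial}{\partial\theta_{i_q}}K_\theta(t)\right|\le \frac{C_{i_1,\dots,i_q}}{1+|t|^{d+1}}$ for all $\theta\in\Theta$, $t\in\mathbb R^d$ (Euclidean norm); - with $\hat K_\theta(f)=(2\pi)^{-d}\int_{\mathbb R^d}K_\theta(t)e^{-\mathrm i f\cdot t}dt$, one has $K_\theta(t)=\int_{\mathbb R^d}\hat K_\theta(f)e^{\mathrm i f\cdot t}df$ (an absolutely convergent integral), and $(f,\theta)\mapsto\hat K_\theta(f)$ is continuous and positive on $\mathbb R^d\times\Theta$. Let $\mathcal L_X$ be a symmetric probability distribution on $\mathbb R^d$ with support $S_X\subset[-1,1]^d$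 and with a probability density that is positive on $S_X$. Let $(v_i)_{i\ge1}$ be points of $\{1,2,\dots\}^d$ with $\{v_i,1\le i\le N^d\}=\{1,\dots,N\}^d$ for all $N\ge1$, and let $\epsilon\in[0,\frac12)$. Let $(X_i)_{i\ge1}$ be i.i.d. with law $\mathcal L_X$ on a probability space $(\Omega_X,P_X)$ and let $Y$ be a (jointly measurable) centered Gaussian process on $\mathbb R^d$ with covariance function $K_{\theta_0}$, on a probability space $(\Omega_Y,P_Y)$; all variables live on the product space. For $n\ge1$ put $X=(X_1,\dots,X_n)$, $y=(Y(v_i+\epsilon X_i))_{1\le i\le n}$, $(R_\theta)_{k,l}=K_\theta(v_k-v_l+\epsilon(X_k-X_l))$, let $\mathrm{diag}(A)$ be the matrix $A$ with its off-diagonal entries set to $0$, and $$CV_\theta=\frac1n\,y^tR_\theta^{-1}\,\mathrm{diag}(R_\theta^{-1})^{-2}R_\theta^{-1}y .$$ **Proposition.** For $1\le i\le p$ let $$M^i_\theta=R_\theta^{-1}\mathrm{diag}(R_\theta^{-1})^{-2}\left\{\mathrm{diag}\Big(R_\theta^{-1}\frac{\partial R_\theta}{\partial\theta_i}R_\theta^{-1}\Big)\mathrm{diag}(R_\theta^{-1})^{-1}-R_\theta^{-1}\frac{\partial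 R_\theta}{\partial\theta_i}\right\}R_\theta^{-1}.$$ 1. For all $n\ge 1$, $\theta\in\Theta$, all values of $X$ in $S_X^n$ and all values of $y$ in $\mathbb R^n$, the matrices $R_\theta$ and $\mathrm{diag}(R_\theta^{-1})$ are invertible, $CV_\theta$ has all first and second order partial derivatives in $\theta$ (one-sided at the boundary of $\Theta$), and for all $1\le i\le p$ $$\frac{\partial}{\partial\theta_i}CV_\theta=\frac2n\,y^tM^i_\theta y .$$ 2. Let $M_{CV,1}^{i,j}=2\{M^i_{\theta_0}+(M^i_{\theta_0})^t\}R_{\theta_0}\{M^j_{\theta_0}+(M^j_{\theta_0})^t\}R_{\theta_0}$. For all $n\ge1$ and $1\le i,j\le p$, the variables $\sqrt n\frac{\partial}{\partial\theta_i}CV_{\theta_0}$ are square integrable and almost surely $$\mathrm{cov}\Big(\sqrt n\frac{\partial}{\partial\theta_i}CV_{\theta_0},\sqrt n\frac{\partial}{\partial\theta_j}CV_{\theta_0}\,\Big|\,X\Big)=\frac1n\mathrm{Tr}\big(M_{CV,1}^{i,j}\big).$$ 3. Let $$\begin{aligned}M_{CV,2}^{i,j}={}&-8\,\mathrm{diag}(R_{\theta_0}^{-1})^{-3}\mathrm{diag}\Big(R_{\theta_0}^{-1}\frac{\partial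 R_{\theta_0}}{\partial\theta_i}R_{\theta_0}^{-1}\Big)R_{\theta_0}^{-1}\frac{\partial R_{\theta_0}}{\partial\theta_j}R_{\theta_0}^{-1}\\&+2\,\mathrm{diag}(R_{\theta_0}^{-1})^{-2}R_{\theta_0}^{-1}\frac{\partial R_{\theta_0}}{\partial\theta_i}R_{\theta_0}^{-1}\frac{\partial R_{\theta_0}}{\partial\theta_j}R_{\theta_0}^{-1}\\&+6\,\mathrm{diag}(R_{\theta_0}^{-1})^{-4}\mathrm{diag}\Big(R_{\theta_0}^{-1}\frac{\partial R_{\theta_0}}{\partial\theta_i}R_{\theta_0}^{-1}\Big)\mathrm{diag}\Big(R_{\theta_0}^{-1}\frac{\partial R_{\theta_0}}{\partial\theta_j}R_{\theta_0}^{-1}\Big)R_{\theta_0}^{-1}.\end{aligned}$$ For all $n\ge1$ and $1\le i,j\le p$, $\frac{\partial^2}{\partial\theta_i\partial\theta_j}CV_{\theta_0}$ is integrable and almost surely $$\mathbb E\Big(\frac{\partial^2}{\partial\theta_i\partial\theta_j}CV_{\theta_0}\,\Big|\,X\Big)=\frac1n\mathrm{Tr}\big(M_{CV,2}^{i,j}\big).$$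 4. There are deterministic $p\times p$ matrices $\Sigma_{CV,1}$ and $\Sigma_{CV,2}$ such that for all $1\le i,j\le p$, $P_X$-almost surely as $n\to+\infty$, $$\frac1n\mathrm{Tr}\big(M_{CV,1}^{i,j}\big)\to(\Sigma_{CV,1})_{i,j},\qquad \frac1n\mathrm{Tr}\big(M_{CV,2}^{i,j}\big)\to(\Sigma_{CV,2})_{i,j}.$$ For a given model $(d,p,\Theta,\{K_\theta\},\theta_0,\mathcal L_X)$ they depend only on $\epsilon$ (and not on the choice of the enumeration $(v_i)$, of the probability spaces or of the variables). -/

import Mathlib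

open MeasureTheory ProbabilityTheory Filter Topology

noncomputable section

namespace KrigingCV

/-- The parameter set `Θ = [a, b]^p`. -/
def paramSet {p : ℕ} (a b : ℝ) : Set (Fin p → ℝ) := {θ | ∀ i, θ i ∈ Set.Icc a b}

/-- The partial derivative `∂F/∂θ_i` on the cube `[a, b]^p` (one-sided at the faces). -/
def partialDeriv {p : ℕ} (a b : ℝ) (i : Fin p) (F : (Fin p → ℝ) → ℝ) (θ : Fin p → ℝ) : ℝ :=
  derivWithin (fun s => F (Function.update θ i s)) (Set.Icc a b) (θ i)

/-- The iterated partial derivative `∂/∂θ_{i₁} … ∂/∂θ_{i_q} F` for the list `[i₁, …, i_q]`. -/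
def iterPartialDeriv {p : ℕ} (a b : ℝ) : List (Fin p) → ((Fin p → ℝ) → ℝ) → (Fin p → ℝ) → ℝ
  | [], F => F
  | i :: I, F => partialDeriv a b i (iterPartialDeriv a b I F)

/-- `k` is a stationary covariance function on `ℝ^d`: all the matrices `(k (s_i - s_j))` are
symmetric and nonnegative. -/
def IsStationaryCovariance {d : ℕ} (k : EuclideanSpace ℝ (Fin d) → ℝ) : Prop :=
  ∀ (m : ℕ) (s : Fin m → EuclideanSpace ℝ (Fin d)),
    (Matrix.of fun i j => k (s i - s j)).PosSemidef

/-- The Fourier transform `(2π)^{-d} ∫ h(t) e^{-i f·t} dt`. -/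
def fourierHat {d : ℕ} (h : EuclideanSpace ℝ (Fin d) → ℝ) (f : EuclideanSpace ℝ (Fin d)) : ℂ :=
  ((2 * Real.pi : ℝ) : ℂ)⁻¹ ^ d *
    ∫ t, (h t : ℂ) * Complex.exp (-(Complex.I * ((inner ℝ f t : ℝ) : ℂ)))

/-- The regularity condition on the parametric family `{K_θ : θ ∈ [a, b]^p}` of covariance
functions. Since `K_θ` is even, its Fourier transform is real valued; it is represented by the
real part of `fourierHat`. -/
structure IsRegularFamily {d p : ℕ} (a b : ℝ)
    (K : (Fin p → ℝ) → EuclideanSpace ℝ (Fin d) → ℝ) : Prop where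
  stationary : ∀ θ ∈ paramSet a b, IsStationaryCovariance (K θ)
  /-- `K_θ(t)` is three times differentiable in `θ`. -/
  differentiable : ∀ I : List (Fin p), I.length < 3 → ∀ (i : Fin p), ∀ θ ∈ paramSet a b,
    ∀ t : EuclideanSpace ℝ (Fin d),
      DifferentiableWithinAt ℝ
        (fun s => iterPartialDeriv a b I (fun ϑ => K ϑ t) (Function.update θ i s))
        (Set.Icc a b) (θ i)
  decay : ∀ I : List (Fin p), I.length ≤ 3 → ∃ C : ℝ, ∀ θ ∈ paramSet a b,
    ∀ t : EuclideanSpace ℝ (Fin d),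
      |iterPartialDeriv a b I (fun ϑ => K ϑ t) θ| ≤ C / (1 + ‖t‖ ^ (d + 1))
  fourier_integrable : ∀ θ ∈ paramSet a b, Integrable (fourierHat (K θ))
  fourier_inversion : ∀ θ ∈ paramSet a b, ∀ t : EuclideanSpace ℝ (Fin d),
    (K θ t : ℂ) = ∫ f, fourierHat (K θ) f * Complex.exp (Complex.I * ((inner ℝ f t : ℝ) : ℂ))
  fourier_continuous :
    ContinuousOn (fun q : (Fin p → ℝ) × EuclideanSpace ℝ (Fin d) => (fourierHat (K q.1) q.2).re)
      (paramSet a b ×ˢ Set.univ)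
  fourier_pos : ∀ θ ∈ paramSet a b, ∀ f : EuclideanSpace ℝ (Fin d), 0 < (fourierHat (K θ) f).re

/-- The law of the perturbations: a probability distribution on `ℝ^d`, symmetric, with support
contained in `[-1, 1]^d`, and with a density that is positive on the support. -/
structure IsPerturbationLaw {d : ℕ} (L : Measure (EuclideanSpace ℝ (Fin d))) : Prop where
  prob : IsProbabilityMeasure L
  symm : L.map (fun t => -t) = L
  support_subset : ∀ t ∈ L.support, ∀ k, t k ∈ Set.Icc (-1 : ℝ) 1
  density : ∃ g : EuclideanSpace ℝ (Fin d) → ENNReal, Measurable g ∧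
    L = volume.withDensity g ∧ ∀ t ∈ L.support, 0 < g t

/-- `v` enumerates `{1, 2, …}^d` (with indices starting from `0`) so that, for all `N ≥ 1`, its
first `N^d` values are the points of `{1, …, N}^d`. -/
def IsGridEnumeration {d : ℕ} (v : ℕ → Fin d → ℕ) : Prop :=
  ∀ N : ℕ, 1 ≤ N → v '' {i | i < N ^ d} = {u | ∀ k, 1 ≤ u k ∧ u k ≤ N}

/-- A point of `ℕ^d` as a point of `ℝ^d`. -/
def gridPoint {d : ℕ} (u : Fin d → ℕ) : EuclideanSpace ℝ (Fin d) :=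
  WithLp.toLp 2 fun k => (u k : ℝ)

/-- `diag(A)`: the matrix `A` with its off-diagonal entries set to `0`. -/
def diagPart {n : ℕ} (A : Matrix (Fin n) (Fin n) ℝ) : Matrix (Fin n) (Fin n) ℝ :=
  Matrix.diagonal A.diag

section Model

variable {d p n : ℕ} (a b : ℝ) (K : (Fin p → ℝ) → EuclideanSpace ℝ (Fin d) → ℝ)
  (v : ℕ → Fin d → ℕ) (ε : ℝ) (x : Fin n → EuclideanSpace ℝ (Fin d))

/-- `R_θ = (K_θ(v_k - v_l + ε (x_k - x_l)))_{k,l}`. -/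
def covMat (θ : Fin p → ℝ) : Matrix (Fin n) (Fin n) ℝ :=
  Matrix.of fun k l => K θ (gridPoint (v k) - gridPoint (v l) + ε • (x k - x l))

/-- `∂R_θ/∂θ_i`, entry by entry. -/
def dCovMat (i : Fin p) (θ : Fin p → ℝ) : Matrix (Fin n) (Fin n) ℝ :=
  Matrix.of fun k l => partialDeriv a b i (fun ϑ => covMat K v ε x ϑ k l) θ

/-- The cross validation criterion
`CV_θ = (1/n) yᵗ R_θ⁻¹ diag(R_θ⁻¹)⁻² R_θ⁻¹ y`. -/
def cv (y : Fin n → ℝ) (θ : Fin p → ℝ) : ℝ :=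
  let A := (covMat K v ε x θ)⁻¹
  (1 / (n : ℝ)) * (y ⬝ᵥ (A * (diagPart A)⁻¹ ^ 2 * A).mulVec y)

/-- `M^i_θ`. -/
def gradMat (i : Fin p) (θ : Fin p → ℝ) : Matrix (Fin n) (Fin n) ℝ :=
  let A := (covMat K v ε x θ)⁻¹
  let D := dCovMat a b K v ε x i θ
  A * (diagPart A)⁻¹ ^ 2 * (diagPart (A * D * A) * (diagPart A)⁻¹ - A * D) * A

/-- `M_{CV,1}^{i,j}` at the parameter `θ`. -/
def mCV1 (θ : Fin p → ℝ) (i j : Fin p) : Matrix (Fin n) (Fin n) ℝ :=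
  let R := covMat K v ε x θ
  let Mi := gradMat a b K v ε x i θ
  let Mj := gradMat a b K v ε x j θ
  (2 : ℝ) • ((Mi + Mi.transpose) * R * (Mj + Mj.transpose) * R)

/-- `M_{CV,2}^{i,j}` at the parameter `θ`. -/
def mCV2 (θ : Fin p → ℝ) (i j : Fin p) : Matrix (Fin n) (Fin n) ℝ :=
  let A := (covMat K v ε x θ)⁻¹
  let Di := dCovMat a b K v ε x i θ
  let Dj := dCovMat a b K v ε x j θ
  (-8 : ℝ) • ((diagPart A)⁻¹ ^ 3 * diagPart (A * Di * A) * A * Dj * A)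
    + (2 : ℝ) • ((diagPart A)⁻¹ ^ 2 * A * Di * A * Dj * A)
    + (6 : ℝ) • ((diagPart A)⁻¹ ^ 4 * diagPart (A * Di * A) * diagPart (A * Dj * A) * A)

end Model

/-- The conditional covariance `E[(U - E[U|m]) (V - E[V|m]) | m]`. -/
def condCov {Ω : Type*} (m : MeasurableSpace Ω) {m₀ : MeasurableSpace Ω} (U V : Ω → ℝ)
    (μ : Measure Ω) : Ω → ℝ :=
  μ[(U - μ[U | m]) * (V - μ[V | m]) | m]

/-- The first `n` perturbations. -/
def firstPerturbations {d : ℕ} {ΩX : Type*} (X : ℕ → ΩX → EuclideanSpace ℝ (Fin d)) (n : ℕ)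
    (ω : ΩX) : Fin n → EuclideanSpace ℝ (Fin d) :=
  fun k => X k ω

/-- The `σ`-algebra on the product space that is generated by the first `n` perturbations. -/
@[reducible]
def perturbationSigma {d : ℕ} {ΩX : Type*} (ΩY : Type*)
    (X : ℕ → ΩX → EuclideanSpace ℝ (Fin d)) (n : ℕ) : MeasurableSpace (ΩX × ΩY) :=
  MeasurableSpace.comap (fun ω => firstPerturbations X n ω.1) inferInstance

/-- The observation vector `y_k = Y(v_k + ε X_k)`, `k < n`, on the product space. -/
def observations {d : ℕ} {ΩX ΩY : Type*} (v : ℕ → Fin d → ℕ) (ε : ℝ)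
    (X : ℕ → ΩX → EuclideanSpace ℝ (Fin d)) (Y : EuclideanSpace ℝ (Fin d) → ΩY → ℝ) (n : ℕ)
    (ω : ΩX × ΩY) : Fin n → ℝ :=
  fun k => Y (gridPoint (v k) + ε • X k ω.1) ω.2

/-- The random function `θ ↦ CV_θ`. -/
def randomCV {d p : ℕ} {ΩX ΩY : Type*} (K : (Fin p → ℝ) → EuclideanSpace ℝ (Fin d) → ℝ)
    (v : ℕ → Fin d → ℕ) (ε : ℝ) (X : ℕ → ΩX → EuclideanSpace ℝ (Fin d))
    (Y : EuclideanSpace ℝ (Fin d) → ΩY → ℝ) (n : ℕ) (ω : ΩX × ΩY) : (Fin p → ℝ) → ℝ :=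
  cv K v ε (firstPerturbations X n ω.1) (observations v ε X Y n ω)

end KrigingCV

end

/-!
The spectral density of `K θ₀` is continuous and positive, hence bounded below by a positive
constant on the support of a compactly supported density whose covariance matrices are coercive by
diagonal dominance. So the covariance matrices are coercive uniformly in the number of sites, and
the decay of `K` makes them *local*: up to a small error in norm, a column depends only on the
sites close to its index. Bounded local families of matrices form an algebra, which contains the
inverses of its coercive members by a Neumann series.

Both matrices whose traces are taken are therefore local. The diagonal coefficient at a site far
from the boundary of the domain is close to that of a finite window around the site, a bounded
function of finitely many of the perturbations whose law does not depend on the site. Windows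
around distant sites are independent, which gives a strong law of large numbers along the squares,
then along all integers; the boundary sites are negligible. The limit is that of the expected
central coefficient of a growing window.

Given `X`, the derivatives of the criterion are quadratic forms in the Gaussian vector `y`, so their
conditional moments follow from the second and fourth moments of `y`.
-/

noncomputable section

namespace KrigingCV

section L2OperatorNorm

open Matrix
open scoped Matrix.Norms.L2Operator

variable {ι κ ν : Type*}

/-- The matrix of the linear map sending the `k`-th basis vector to the `e k`-th one; for an
injection `e` this is extension by zero along `e`. -/
def extensionMatrix [DecidableEq ι] (e : κ → ι) : Matrix ι κ ℝ :=
  (1 : Matrix ι ι ℝ).submatrix id e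

lemma mul_extensionMatrix [Fintype ι] [DecidableEq ι] (A : Matrix ν ι ℝ) (e : κ → ι) :
    A * extensionMatrix e = A.submatrix id e :=
  mul_submatrix_one (Equiv.refl ι) e A

lemma transpose_extensionMatrix_mul_self [Fintype ι] [DecidableEq ι] [DecidableEq κ] {e : κ → ι}
    (he : Function.Injective e) : (extensionMatrix e)ᵀ * extensionMatrix e = 1 := by
  rw [mul_extensionMatrix, extensionMatrix, transpose_submatrix, transpose_one,
    submatrix_submatrix, Function.id_comp, Function.comp_id, submatrix_one e he]

/-- The Euclidean norm of the column `u` of a matrix. -/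
def colNorm [Fintype ι] (A : Matrix ι κ ℝ) (u : κ) : ℝ := ‖A.submatrix id fun _ : Unit => u‖

lemma sq_mulVec_apply_le [Fintype κ] (A : Matrix ι κ ℝ) (φ : κ → ℝ) (k : ι) :
    (A *ᵥ φ) k ^ 2 ≤ (∑ l, |A k l|) * ∑ l, |A k l| * φ l ^ 2 := by
  have hcauchy := Finset.sum_mul_sq_le_sq_mul_sq Finset.univ (fun l => √|A k l|)
    fun l => √|A k l| * |φ l|
  have hprod : ∀ l, √|A k l| * (√|A k l| * |φ l|) = |A k l * φ l| := fun l => by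
    rw [← mul_assoc, Real.mul_self_sqrt (abs_nonneg _), abs_mul]
  simp only [hprod, mul_pow, Real.sq_sqrt (abs_nonneg _), sq_abs] at hcauchy
  refine le_trans ?_ hcauchy
  rw [← sq_abs ((A *ᵥ φ) k)]
  gcongr
  exact Finset.abs_sum_le_sum_abs _ _

variable [Fintype ι]

lemma colNorm_nonneg (A : Matrix ι κ ℝ) (u : κ) : 0 ≤ colNorm A u := norm_nonneg _

lemma colNorm_add_le (A B : Matrix ι κ ℝ) (u : κ) :
    colNorm (A + B) u ≤ colNorm A u + colNorm B u :=
  norm_add_le (A.submatrix id fun _ : Unit => u) (B.submatrix id fun _ : Unit => u)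

lemma colNorm_mul_le [DecidableEq ι] [Fintype ν] (A : Matrix ν ι ℝ) (B : Matrix ι κ ℝ) (u : κ) :
    colNorm (A * B) u ≤ ‖A‖ * colNorm B u :=
  l2_opNorm_mul A (B.submatrix id fun _ : Unit => u)

variable [Fintype κ]

lemma norm_le_of_forall_norm_mulVec_le [DecidableEq κ] {A : Matrix ι κ ℝ} {C : ℝ} (hC : 0 ≤ C)
    (h : ∀ φ : κ → ℝ, (A *ᵥ φ) ⬝ᵥ (A *ᵥ φ) ≤ C ^ 2 * (φ ⬝ᵥ φ)) : ‖A‖ ≤ C := by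
  rw [l2_opNorm_def]
  refine ContinuousLinearMap.opNorm_le_bound _ hC fun φ => ?_
  refine (sq_le_sq₀ (norm_nonneg _) (by positivity)).1 ?_
  rw [mul_pow, EuclideanSpace.real_norm_sq_eq, EuclideanSpace.real_norm_sq_eq]
  simpa [dotProduct, sq] using h φ.ofLp

lemma mulVec_dotProduct_mulVec_le [DecidableEq κ] (A : Matrix ι κ ℝ) (φ : κ → ℝ) :
    (A *ᵥ φ) ⬝ᵥ (A *ᵥ φ) ≤ ‖A‖ ^ 2 * (φ ⬝ᵥ φ) := by
  have h := pow_le_pow_left₀ (norm_nonneg _) (l2_opNorm_mulVec A (WithLp.toLp 2 φ)) 2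
  rw [mul_pow, EuclideanSpace.real_norm_sq_eq, EuclideanSpace.real_norm_sq_eq] at h
  simpa [dotProduct, sq] using h

lemma norm_one_le_one [DecidableEq κ] : ‖(1 : Matrix κ κ ℝ)‖ ≤ 1 := by
  rw [← diagonal_one, l2_opNorm_diagonal]
  exact (pi_norm_le_iff_of_nonneg zero_le_one).2 fun k => by simp

lemma norm_transpose [DecidableEq ι] [DecidableEq κ] (A : Matrix ι κ ℝ) : ‖Aᵀ‖ = ‖A‖ := by
  rw [← conjTranspose_eq_transpose_of_trivial, l2_opNorm_conjTranspose]

lemma norm_extensionMatrix_le_one [DecidableEq ι] [DecidableEq κ] {e : κ → ι}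
    (he : Function.Injective e) : ‖extensionMatrix e‖ ≤ 1 := by
  have h : ‖extensionMatrix e‖ * ‖extensionMatrix e‖ ≤ 1 := by
    rw [← l2_opNorm_conjTranspose_mul_self, conjTranspose_eq_transpose_of_trivial,
      transpose_extensionMatrix_mul_self he]
    exact norm_one_le_one
  nlinarith [norm_nonneg (extensionMatrix e)]

lemma colNorm_le_norm [DecidableEq κ] (A : Matrix ι κ ℝ) (u : κ) : colNorm A u ≤ ‖A‖ := by
  rw [colNorm, ← mul_extensionMatrix]
  refine (l2_opNorm_mul _ _).trans (mul_le_of_le_one_right (norm_nonneg A) ?_)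
  exact norm_extensionMatrix_le_one (Function.injective_of_subsingleton _)

lemma abs_apply_le_colNorm {κ : Type*} (A : Matrix ι κ ℝ) (k : ι) (u : κ) :
    |A k u| ≤ colNorm A u := by
  classical
  set B : Matrix Unit Unit ℝ := diagonal fun _ => A k u with hB
  have hentry : B = (extensionMatrix fun _ : Unit => k)ᵀ * A.submatrix id fun _ : Unit => u := by
    rw [← transpose_transpose (A.submatrix id _), ← transpose_mul, mul_extensionMatrix]
    ext
    simp [hB]
  calc |A k u| = ‖B‖ := by simp [hB, Pi.norm_def]
    _ ≤ ‖(extensionMatrix fun _ : Unit => k)ᵀ‖ * colNorm A u := hentry ▸ l2_opNorm_mul _ _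
    _ ≤ colNorm A u := by
      refine mul_le_of_le_one_left (colNorm_nonneg A u) ?_
      rw [norm_transpose]
      exact norm_extensionMatrix_le_one (Function.injective_of_subsingleton _)

lemma abs_apply_le_norm [DecidableEq κ] (A : Matrix ι κ ℝ) (k : ι) (u : κ) : |A k u| ≤ ‖A‖ :=
  (abs_apply_le_colNorm A k u).trans (colNorm_le_norm A u)

lemma norm_single_le [DecidableEq ι] [DecidableEq κ] (k : ι) (l : κ) (r : ℝ) :
    ‖single k l r‖ ≤ |r| := by
  have hsingle : single k l r
      = r • (extensionMatrix (fun _ : Unit => k) * (extensionMatrix fun _ : Unit => l)ᵀ) := by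
    ext i j
    simp only [single_apply, extensionMatrix, mul_apply, one_apply, Matrix.smul_apply,
      submatrix_apply, transpose_apply, id_eq, Finset.univ_unique, Finset.sum_const,
      Finset.card_singleton, one_smul, smul_eq_mul, eq_comm (a := i), eq_comm (a := j)]
    split_ifs <;> simp_all
  rw [hsingle, norm_smul, Real.norm_eq_abs]
  refine mul_le_of_le_one_right (abs_nonneg r) ((l2_opNorm_mul _ _).trans ?_)
  rw [norm_transpose]
  exact mul_le_one₀ (norm_extensionMatrix_le_one (Function.injective_of_subsingleton _))
    (norm_nonneg _) (norm_extensionMatrix_le_one (Function.injective_of_subsingleton _))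

lemma norm_le_sum_abs [DecidableEq κ] (A : Matrix ι κ ℝ) : ‖A‖ ≤ ∑ k, ∑ l, |A k l| := by
  classical
  conv_lhs => rw [matrix_eq_sum_single A]
  exact (norm_sum_le _ _).trans (Finset.sum_le_sum fun k _ =>
    (norm_sum_le _ _).trans (Finset.sum_le_sum fun l _ => norm_single_le k l _))

lemma colNorm_le_sum_abs {κ : Type*} (A : Matrix ι κ ℝ) (u : κ) :
    colNorm A u ≤ ∑ k, |A k u| := by
  simpa [colNorm] using norm_le_sum_abs (A.submatrix id fun _ : Unit => u)

lemma norm_le_sum_colNorm [DecidableEq κ] (A : Matrix ι κ ℝ) : ‖A‖ ≤ ∑ u, colNorm A u := by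
  have hsum : A = ∑ u, (A.submatrix id fun _ : Unit => u) *
      (extensionMatrix fun _ : Unit => u)ᵀ := by
    ext i j
    simp [extensionMatrix, mul_apply, Matrix.sum_apply, one_apply]
  calc ‖A‖ = ‖∑ u, (A.submatrix id fun _ : Unit => u) *
        (extensionMatrix fun _ : Unit => u)ᵀ‖ := by rw [← hsum]
    _ ≤ ∑ u, colNorm A u := norm_sum_le_of_le _ fun u _ => by
      refine (l2_opNorm_mul _ _).trans (mul_le_of_le_one_right (norm_nonneg _) ?_)
      rw [norm_transpose]
      exact norm_extensionMatrix_le_one (Function.injective_of_subsingleton _)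

lemma norm_le_of_sum_abs_le [DecidableEq κ] {A : Matrix ι κ ℝ} {C : ℝ} (hC : 0 ≤ C)
    (hrow : ∀ k, ∑ l, |A k l| ≤ C) (hcol : ∀ l, ∑ k, |A k l| ≤ C) : ‖A‖ ≤ C := by
  refine norm_le_of_forall_norm_mulVec_le hC fun φ => ?_
  calc (A *ᵥ φ) ⬝ᵥ (A *ᵥ φ) = ∑ k, (A *ᵥ φ) k ^ 2 := by simp only [dotProduct, sq]
    _ ≤ ∑ k, C * ∑ l, |A k l| * φ l ^ 2 := Finset.sum_le_sum fun k _ =>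
      (sq_mulVec_apply_le A φ k).trans (by gcongr; exact hrow k)
    _ = C * ∑ l, (∑ k, |A k l|) * φ l ^ 2 := by
      rw [← Finset.mul_sum, Finset.sum_comm]
      simp only [Finset.sum_mul]
    _ ≤ C * ∑ l, C * φ l ^ 2 := by
      gcongr with l
      exact hcol l
    _ = C ^ 2 * (φ ⬝ᵥ φ) := by
      rw [← Finset.mul_sum]
      simp only [dotProduct, sq, mul_assoc]

end L2OperatorNorm

section Coercivity

open Matrix
open scoped Matrix.Norms.L2Operator

variable {ι : Type*} [Fintype ι] {A : Matrix ι ι ℝ} {m : ℝ}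

/-- `A ≥ m` in the sense of quadratic forms; the matrix `A` need not be symmetric. -/
def IsCoerciveWith (m : ℝ) (A : Matrix ι ι ℝ) : Prop :=
  ∀ φ : ι → ℝ, m * (φ ⬝ᵥ φ) ≤ φ ⬝ᵥ (A *ᵥ φ)

lemma isCoerciveWith_diagonal [DecidableEq ι] {w : ι → ℝ} (hw : ∀ k, m ≤ w k) :
    IsCoerciveWith m (diagonal w) := fun φ => by
  simp only [dotProduct, mulVec_diagonal, Finset.mul_sum]
  refine Finset.sum_le_sum fun k _ => ?_
  nlinarith [mul_le_mul_of_nonneg_right (hw k) (mul_self_nonneg (φ k))]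

lemma isCoerciveWith_of_norm_sub_smul_one_le [DecidableEq ι] {a b : ℝ} (hb : 0 < b)
    (h : ‖A - a • 1‖ ≤ b) : IsCoerciveWith (a - b) A := fun φ => by
  set O := A - a • 1 with hO
  have hself : 0 ≤ φ ⬝ᵥ φ := Finset.sum_nonneg fun k _ => mul_self_nonneg _
  have hbound : (O *ᵥ φ) ⬝ᵥ (O *ᵥ φ) ≤ b ^ 2 * (φ ⬝ᵥ φ) :=
    (mulVec_dotProduct_mulVec_le O φ).trans (by gcongr)
  have hsq : 0 ≤ (O *ᵥ φ + b • φ) ⬝ᵥ (O *ᵥ φ + b • φ) :=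
    Finset.sum_nonneg fun k _ => mul_self_nonneg _
  simp only [dotProduct_add, add_dotProduct, smul_dotProduct, dotProduct_smul, smul_eq_mul,
    dotProduct_comm (O *ᵥ φ) φ] at hsq
  have hA : φ ⬝ᵥ (A *ᵥ φ) = a * (φ ⬝ᵥ φ) + φ ⬝ᵥ (O *ᵥ φ) := by
    rw [← add_sub_cancel (a • (1 : Matrix ι ι ℝ)) A, ← hO, add_mulVec, smul_mulVec, one_mulVec,
      dotProduct_add, dotProduct_smul, smul_eq_mul]
  nlinarith

namespace IsCoerciveWith

lemma transpose (h : IsCoerciveWith m A) : IsCoerciveWith m Aᵀ := fun φ => by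
  rw [mulVec_transpose, dotProduct_comm φ (φ ᵥ* A), ← dotProduct_mulVec]
  exact h φ

lemma sq_mul_dotProduct_self_le (h : IsCoerciveWith m A) (hm : 0 < m) (φ : ι → ℝ) :
    m ^ 2 * (φ ⬝ᵥ φ) ≤ (A *ᵥ φ) ⬝ᵥ (A *ᵥ φ) := by
  have hsq : 0 ≤ (A *ᵥ φ - m • φ) ⬝ᵥ (A *ᵥ φ - m • φ) :=
    Finset.sum_nonneg fun k _ => mul_self_nonneg _
  simp only [dotProduct_sub, sub_dotProduct, smul_dotProduct, dotProduct_smul, smul_eq_mul,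
    dotProduct_comm (A *ᵥ φ) φ] at hsq
  nlinarith [h φ]

lemma le_apply_self (h : IsCoerciveWith m A) (k : ι) : m ≤ A k k := by
  classical
  simpa using h (Pi.single k 1)

variable [DecidableEq ι]

lemma isUnit (h : IsCoerciveWith m A) (hm : 0 < m) : IsUnit A := by
  refine mulVec_injective_iff_isUnit.1 fun φ ψ hφψ => sub_eq_zero.1 (dotProduct_self_eq_zero.1 ?_)
  have hle := h.sq_mul_dotProduct_self_le hm (φ - ψ)
  have hzero : A *ᵥ (φ - ψ) = 0 := by rw [mulVec_sub, sub_eq_zero]; exact hφψ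
  rw [hzero, dotProduct_zero] at hle
  exact le_antisymm (nonpos_of_mul_nonpos_right hle (by positivity))
    (Finset.sum_nonneg fun k _ => mul_self_nonneg _)

lemma mulVec_inv_mulVec (h : IsCoerciveWith m A) (hm : 0 < m) (φ : ι → ℝ) :
    A *ᵥ (A⁻¹ *ᵥ φ) = φ := by
  rw [mulVec_mulVec, mul_nonsing_inv A ((isUnit_iff_isUnit_det A).1 (h.isUnit hm)), one_mulVec]

lemma norm_inv_le (h : IsCoerciveWith m A) (hm : 0 < m) : ‖A⁻¹‖ ≤ m⁻¹ := by
  refine norm_le_of_forall_norm_mulVec_le (by positivity) fun φ => ?_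
  have hle := h.sq_mul_dotProduct_self_le hm (A⁻¹ *ᵥ φ)
  rw [h.mulVec_inv_mulVec hm] at hle
  rw [inv_pow]
  exact (le_inv_mul_iff₀ (by positivity)).2 hle

lemma inv (h : IsCoerciveWith m A) (hm : 0 < m) {M : ℝ} (hM : 0 < M) (hA : ‖A‖ ≤ M) :
    IsCoerciveWith (m / M ^ 2) A⁻¹ := fun φ => by
  have hcoer := h (A⁻¹ *ᵥ φ)
  have hbound := mulVec_dotProduct_mulVec_le A (A⁻¹ *ᵥ φ)
  rw [h.mulVec_inv_mulVec hm] at hcoer hbound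
  have hself : 0 ≤ (A⁻¹ *ᵥ φ) ⬝ᵥ (A⁻¹ *ᵥ φ) := Finset.sum_nonneg fun k _ => mul_self_nonneg _
  calc m / M ^ 2 * (φ ⬝ᵥ φ)
      ≤ m / M ^ 2 * (M ^ 2 * ((A⁻¹ *ᵥ φ) ⬝ᵥ (A⁻¹ *ᵥ φ))) := by
        refine mul_le_mul_of_nonneg_left (hbound.trans ?_) (by positivity)
        gcongr
    _ = m * ((A⁻¹ *ᵥ φ) ⬝ᵥ (A⁻¹ *ᵥ φ)) := by field_simp
    _ ≤ φ ⬝ᵥ (A⁻¹ *ᵥ φ) := by rwa [dotProduct_comm φ]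

/-- With the step `m / M ^ 2`, `‖φ - cAφ‖² ≤ (1 - 2cm + c²M²) ‖φ‖²` is optimal. -/
lemma norm_one_sub_smul_le (h : IsCoerciveWith m A) (hm : 0 < m) {M : ℝ} (hmM : m ≤ M)
    (hA : ‖A‖ ≤ M) : ‖1 - (m / M ^ 2) • A‖ ≤ √(1 - m ^ 2 / M ^ 2) := by
  have hM : 0 < M := hm.trans_le hmM
  refine norm_le_of_forall_norm_mulVec_le (Real.sqrt_nonneg _) fun φ => ?_
  have hself : 0 ≤ φ ⬝ᵥ φ := Finset.sum_nonneg fun k _ => mul_self_nonneg _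
  have hbound : (A *ᵥ φ) ⬝ᵥ (A *ᵥ φ) ≤ M ^ 2 * (φ ⬝ᵥ φ) :=
    (mulVec_dotProduct_mulVec_le A φ).trans (by gcongr)
  have hnonneg : 0 ≤ 1 - m ^ 2 / M ^ 2 :=
    sub_nonneg.2 ((div_le_one (by positivity)).2 (by gcongr))
  rw [Real.sq_sqrt hnonneg, sub_mulVec, one_mulVec, smul_mulVec]
  simp only [dotProduct_sub, sub_dotProduct, smul_dotProduct, dotProduct_smul, smul_eq_mul,
    dotProduct_comm (A *ᵥ φ) φ]
  set c := m / M ^ 2 with hc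
  have hc0 : 0 ≤ c := by positivity
  have hquad : 1 - m ^ 2 / M ^ 2 = 1 - 2 * c * m + c ^ 2 * M ^ 2 := by
    rw [hc]; field_simp; ring
  rw [hquad]
  nlinarith [mul_le_mul_of_nonneg_left (h φ) hc0, mul_le_mul_of_nonneg_left hbound (sq_nonneg c)]

end IsCoerciveWith

lemma inv_sub_smul_geom_sum [DecidableEq ι] (hA : IsUnit A) (c : ℝ) (J : ℕ) :
    A⁻¹ - c • ∑ j ∈ Finset.range J, (1 - c • A) ^ j = A⁻¹ * (1 - c • A) ^ J := by
  have hgeom : (c • A) * ∑ j ∈ Finset.range J, (1 - c • A) ^ j = 1 - (1 - c • A) ^ J := by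
    simpa using mul_neg_geom_sum (1 - c • A) J
  have hinv : A⁻¹ * A = 1 := nonsing_inv_mul A ((isUnit_iff_isUnit_det A).1 hA)
  calc A⁻¹ - c • ∑ j ∈ Finset.range J, (1 - c • A) ^ j
      = A⁻¹ - A⁻¹ * ((c • A) * ∑ j ∈ Finset.range J, (1 - c • A) ^ j) := by
        rw [← mul_assoc, mul_smul_comm, hinv, smul_mul_assoc, one_mul]
    _ = A⁻¹ * (1 - c • A) ^ J := by rw [hgeom, mul_sub, mul_one, sub_sub_cancel]

end Coercivity

section Locality

open Matrix
open scoped Matrix.Norms.L2Operator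

/-- A finite family of lattice sites, each carrying a perturbation. -/
structure Config (d : ℕ) where
  ι : Type
  [fin : Fintype ι]
  [dec : DecidableEq ι]
  site : ι → Fin d → ℤ
  pt : ι → EuclideanSpace ℝ (Fin d)

attribute [instance] Config.fin Config.dec

variable {d : ℕ}

namespace Config

variable {c c' : Config d}

/-- The configurations that occur in the model: distinct sites, perturbations in `[-1, 1]^d`. -/
structure Valid (c : Config d) : Prop where
  injective_site : Function.Injective c.site
  pt_mem : ∀ k j, c.pt k j ∈ Set.Icc (-1 : ℝ) 1

/-- An embedding of configurations, up to a translation of the sites. -/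
structure IsEmb (e : c.ι → c'.ι) : Prop where
  injective : Function.Injective e
  site_sub : ∀ k l, c'.site (e k) - c'.site (e l) = c.site k - c.site l
  pt_apply : ∀ k, c'.pt (e k) = c.pt k

/-- The image of `e` contains all the sites of `c'` at distance at most `r` of that of `e u`. -/
def CoversBall (e : c.ι → c'.ι) (u : c.ι) (r : ℕ) : Prop :=
  ∀ k : c'.ι, ‖c'.site k - c'.site (e u)‖ ≤ r → k ∈ Set.range e

lemma CoversBall.mono {e : c.ι → c'.ι} {u : c.ι} {r r' : ℕ} (h : CoversBall e u r')
    (hr : r ≤ r') : CoversBall e u r := fun k hk => h k (hk.trans (by exact_mod_cast hr))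

lemma CoversBall.of_norm_sub_le {e : c.ι → c'.ι} (he : IsEmb e) {u l : c.ι} {r r' : ℕ}
    (h : CoversBall e u (r + r')) (hl : ‖c.site l - c.site u‖ ≤ r') : CoversBall e l r :=
  fun k hk => h k <| by
    rw [← sub_add_sub_cancel _ (c'.site (e l)), he.site_sub, Nat.cast_add]
    exact (norm_add_le _ _).trans (add_le_add hk hl)

/-- The sub-configuration of the sites at distance at most `r` of a given one. -/
def near (c : Config d) (u : c.ι) (r : ℕ) : Config d where
  ι := {k : c.ι // ‖c.site k - c.site u‖ ≤ r}
  fin := Fintype.ofFinite _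
  dec := inferInstance
  site := fun k => c.site k
  pt := fun k => c.pt k

/-- The inclusion of the sub-configuration `near`. -/
def nearIncl (c : Config d) (u : c.ι) (r : ℕ) : (c.near u r).ι → c.ι := Subtype.val

lemma isEmb_nearIncl (c : Config d) (u : c.ι) (r : ℕ) : IsEmb (c.nearIncl u r) :=
  ⟨Subtype.val_injective, fun _ _ => rfl, fun _ => rfl⟩

lemma exists_nearIncl_eq (c : Config d) (u : c.ι) (r : ℕ) : ∃ w, c.nearIncl u r w = u :=
  ⟨⟨u, by simp⟩, rfl⟩

lemma coversBall_nearIncl (c : Config d) {u : c.ι} {r : ℕ} {w : (c.near u r).ι}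
    (hw : c.nearIncl u r w = u) : CoversBall (c.nearIncl u r) w r :=
  fun k hk => ⟨⟨k, by rwa [hw] at hk⟩, rfl⟩

lemma norm_site_nearIncl_sub_le (c : Config d) {u : c.ι} {r : ℕ} (k : (c.near u r).ι) :
    ‖c.site (c.nearIncl u r k) - c.site u‖ ≤ r := k.2

lemma Valid.near (h : c.Valid) (u : c.ι) (r : ℕ) : (c.near u r).Valid :=
  ⟨fun _ _ hk => Subtype.ext (h.injective_site hk), fun k => h.pt_mem (c.nearIncl u r k)⟩

end Config

/-- The cube of the lattice points of sup norm at most `r`. -/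
def box (d r : ℕ) : Finset (Fin d → ℤ) := Fintype.piFinset fun _ => Finset.Icc (-(r : ℤ)) r

lemma mem_box {r : ℕ} {s : Fin d → ℤ} : s ∈ box d r ↔ ‖s‖ ≤ r := by
  simp only [box, Fintype.mem_piFinset, Finset.mem_Icc, ← abs_le,
    pi_norm_le_iff_of_nonneg (Nat.cast_nonneg r), Int.norm_eq_abs]
  norm_cast

lemma card_box (d r : ℕ) : (box d r).card = (2 * r + 1) ^ d := by
  rw [box, Fintype.card_piFinset_const, Int.card_Icc]
  congr 1
  lia

lemma Config.Valid.card_near_le {c : Config d} (h : c.Valid) (u : c.ι) (r : ℕ) :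
    Fintype.card (c.near u r).ι ≤ (2 * r + 1) ^ d := by
  rw [← card_box]
  exact Finset.card_le_card_of_injOn (fun k => c.site (c.nearIncl u r k) - c.site u)
    (fun k _ => mem_box.2 (c.norm_site_nearIncl_sub_le k))
    fun k _ l _ hkl => Subtype.ext (h.injective_site (sub_left_injective hkl))

lemma Config.Valid.norm_mul_extensionMatrix_nearIncl_le {c : Config d} (hc : c.Valid) {ν : Type*}
    [Fintype ν] {A : Matrix ν c.ι ℝ} {u : c.ι} {r : ℕ} {η : ℝ} (hη : 0 ≤ η)
    (hA : ∀ k, ‖c.site k - c.site u‖ ≤ r → colNorm A k ≤ η) :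
    ‖A * extensionMatrix (c.nearIncl u r)‖ ≤ (2 * r + 1) ^ d * η := by
  rw [mul_extensionMatrix]
  refine (norm_le_sum_colNorm _).trans ((Finset.sum_le_card_nsmul _ _ _ fun k _ =>
    hA (c.nearIncl u r k) (c.norm_site_nearIncl_sub_le k)).trans ?_)
  rw [nsmul_eq_mul, Finset.card_univ]
  gcongr
  exact_mod_cast hc.card_near_le u r

/-- A square matrix attached to each configuration. Sums, products and inverses of such families
are taken configuration by configuration. -/
abbrev MatFun (d : ℕ) := ∀ c : Config d, Matrix c.ι c.ι ℝ

namespace MatFun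

/-- The transposes of the matrices of a family. -/
def transpose (F : MatFun d) : MatFun d := fun c => (F c)ᵀ

/-- The diagonal parts of the matrices of a family. -/
def diagPart (F : MatFun d) : MatFun d := fun c => diagonal (F c).diag

/-- The defect of naturality of a family of matrices, seen as linear maps, with respect to the
extension by zero along `e`. -/
def defect (F : MatFun d) {c c' : Config d} (e : c.ι → c'.ι) : Matrix c'.ι c.ι ℝ :=
  F c' * extensionMatrix e - extensionMatrix e * F c

/-- A common bound of the operator norms of the matrices of the valid configurations. -/
def IsBoundedBy (F : MatFun d) (C : ℝ) : Prop := ∀ c : Config d, c.Valid → ‖F c‖ ≤ C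

/-- The columns of the matrices are stable when sites are added far from the column index. -/
def IsColumnLocal (F : MatFun d) : Prop :=
  ∀ δ > (0 : ℝ), ∃ r : ℕ, ∀ (c c' : Config d) (e : c.ι → c'.ι), c.Valid → c'.Valid →
    Config.IsEmb e → ∀ u : c.ι, Config.CoversBall e u r → colNorm (F.defect e) u ≤ δ

variable {F G : MatFun d} {C C' : ℝ}

section Defect

variable {c c' : Config d} (e : c.ι → c'.ι)

lemma defect_add (F G : MatFun d) : (F + G).defect e = F.defect e + G.defect e := by
  simp only [defect, Pi.add_apply, Matrix.add_mul, Matrix.mul_add]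
  abel

lemma defect_mul (F G : MatFun d) :
    (F * G).defect e = F c' * G.defect e + F.defect e * G c := by
  simp only [defect, Pi.mul_apply, Matrix.mul_sub, Matrix.sub_mul, Matrix.mul_assoc]
  abel

lemma defect_algebraMap (a : ℝ) : (algebraMap ℝ (MatFun d) a).defect e = 0 := by
  simp [defect, Algebra.algebraMap_eq_smul_one]

lemma norm_defect_le {e : c.ι → c'.ι} (he : Config.IsEmb e) :
    ‖F.defect e‖ ≤ ‖F c'‖ + ‖F c‖ := by
  refine (norm_sub_le _ _).trans (add_le_add ?_ ?_)
  · exact (l2_opNorm_mul _ _).trans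
      (mul_le_of_le_one_right (norm_nonneg _) (norm_extensionMatrix_le_one he.injective))
  · exact (l2_opNorm_mul _ _).trans
      (mul_le_of_le_one_left (norm_nonneg _) (norm_extensionMatrix_le_one he.injective))

lemma defect_apply_of_mem_range {e : c.ι → c'.ι} (he : Config.IsEmb e) (k u : c.ι) :
    F.defect e (e k) u = F c' (e k) (e u) - F c k u := by
  simp [defect, extensionMatrix, mul_apply, one_apply, he.injective.eq_iff]

lemma defect_apply_of_notMem_range {k : c'.ι} (hk : k ∉ Set.range e) (u : c.ι) :
    F.defect e k u = F c' k (e u) := by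
  have hne : ∀ l, k ≠ e l := fun l h => hk ⟨l, h.symm⟩
  simp [defect, extensionMatrix, mul_apply, one_apply, hne]

end Defect

lemma IsColumnLocal.add (hF : F.IsColumnLocal) (hG : G.IsColumnLocal) :
    (F + G).IsColumnLocal := fun δ hδ => by
  obtain ⟨r, hr⟩ := hF (δ / 2) (by positivity)
  obtain ⟨r', hr'⟩ := hG (δ / 2) (by positivity)
  refine ⟨max r r', fun c c' e hc hc' he u hu => ?_⟩
  rw [defect_add]
  linarith [colNorm_add_le (F.defect e) (G.defect e) u,
    hr c c' e hc hc' he u (hu.mono (le_max_left _ _)),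
    hr' c c' e hc hc' he u (hu.mono (le_max_right _ _))]

lemma isColumnLocal_algebraMap (a : ℝ) : (algebraMap ℝ (MatFun d) a).IsColumnLocal :=
  fun δ hδ => ⟨0, fun c c' e _ _ _ u _ => by
    rw [defect_algebraMap, colNorm, submatrix_zero, Pi.zero_def, Pi.zero_def]
    exact norm_zero.trans_le hδ.le⟩

/-- Only the columns of `F.defect e` with index close to `u` are known to be small; the entries
of the column `u` of `G c` with a far index are removed by comparing `G c` with its restriction to
a large ball around `u`. -/
lemma exists_colNorm_defect_mul_le (hF : F.IsColumnLocal) (hFC : F.IsBoundedBy C)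
    (hG : G.IsColumnLocal) (hGC : G.IsBoundedBy C') (hC : 0 < C) (hC' : 0 < C') {δ : ℝ}
    (hδ : 0 < δ) : ∃ r : ℕ, ∀ (c c' : Config d) (e : c.ι → c'.ι), c.Valid → c'.Valid →
      Config.IsEmb e → ∀ u : c.ι, Config.CoversBall e u r →
        colNorm (F.defect e * G c) u ≤ δ := by
  obtain ⟨r, hr⟩ := hG (δ / (4 * C)) (by positivity)
  obtain ⟨r', hr'⟩ := hF (δ / (2 * C' * (2 * r + 1) ^ d)) (by positivity)
  refine ⟨r' + r, fun c c' e hc hc' he u hu => ?_⟩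
  obtain ⟨w, hw⟩ := c.exists_nearIncl_eq u r
  set j := c.nearIncl u r
  have hj := c.isEmb_nearIncl u r
  have hfar : colNorm (F.defect e * G.defect j) w ≤ 2 * C * (δ / (4 * C)) := by
    refine (colNorm_mul_le _ _ w).trans (mul_le_mul ?_
      (hr _ _ j (hc.near u r) hc hj w (c.coversBall_nearIncl hw)) (colNorm_nonneg _ _)
      (by positivity))
    linarith [norm_defect_le (F := F) he, hFC c hc, hFC c' hc']
  have hsmall : ‖F.defect e * extensionMatrix j‖ ≤
      (2 * r + 1) ^ d * (δ / (2 * C' * (2 * r + 1) ^ d)) :=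
    hc.norm_mul_extensionMatrix_nearIncl_le (by positivity) fun k hk =>
      hr' c c' e hc hc' he k (hu.of_norm_sub_le he hk)
  have hnear : colNorm ((F.defect e * extensionMatrix j) * G (c.near u r)) w ≤
      (2 * r + 1) ^ d * (δ / (2 * C' * (2 * r + 1) ^ d)) * C' :=
    (colNorm_mul_le _ _ w).trans (mul_le_mul hsmall
      ((colNorm_le_norm _ w).trans (hGC _ (hc.near u r))) (colNorm_nonneg _ _) (by positivity))
  have hsplit : (F.defect e * G c).submatrix id j
      = F.defect e * G.defect j + (F.defect e * extensionMatrix j) * G (c.near u r) := by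
    rw [← mul_extensionMatrix, defect, defect]
    simp only [Matrix.mul_sub, Matrix.mul_assoc]
    abel
  calc colNorm (F.defect e * G c) u = colNorm ((F.defect e * G c).submatrix id j) w := by
        simp only [← hw]; rfl
    _ ≤ 2 * C * (δ / (4 * C)) + (2 * r + 1) ^ d * (δ / (2 * C' * (2 * r + 1) ^ d)) * C' := by
        rw [hsplit]
        exact (colNorm_add_le _ _ w).trans (add_le_add hfar hnear)
    _ = δ := by field_simp; ring

lemma IsColumnLocal.mul (hF : F.IsColumnLocal) (hFC : F.IsBoundedBy C)
    (hG : G.IsColumnLocal) (hGC : G.IsBoundedBy C') (hC : 0 < C) (hC' : 0 < C') :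
    (F * G).IsColumnLocal := fun δ hδ => by
  obtain ⟨r, hr⟩ := hG (δ / (2 * C)) (by positivity)
  obtain ⟨r', hr'⟩ := exists_colNorm_defect_mul_le hF hFC hG hGC hC hC' (half_pos hδ)
  refine ⟨max r r', fun c c' e hc hc' he u hu => ?_⟩
  have hfirst : colNorm (F c' * G.defect e) u ≤ C * (δ / (2 * C)) :=
    (colNorm_mul_le _ _ u).trans (mul_le_mul (hFC c' hc')
      (hr c c' e hc hc' he u (hu.mono (le_max_left _ _))) (colNorm_nonneg _ _) hC.le)
  calc colNorm ((F * G).defect e) u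
      ≤ colNorm (F c' * G.defect e) u + colNorm (F.defect e * G c) u := by
        rw [defect_mul]
        exact colNorm_add_le _ _ u
    _ ≤ C * (δ / (2 * C)) + δ / 2 :=
        add_le_add hfirst (hr' c c' e hc hc' he u (hu.mono (le_max_right _ _)))
    _ = δ := by field_simp; ring

lemma IsColumnLocal.of_approx
    (h : ∀ δ > (0 : ℝ), ∃ G : MatFun d, G.IsColumnLocal ∧ (F - G).IsBoundedBy δ) :
    F.IsColumnLocal := fun δ hδ => by
  obtain ⟨G, hG, hFG⟩ := h (δ / 3) (by positivity)
  obtain ⟨r, hr⟩ := hG (δ / 3) (by positivity)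
  refine ⟨r, fun c c' e hc hc' he u hu => ?_⟩
  rw [← sub_add_cancel F G, defect_add]
  linarith [colNorm_add_le ((F - G).defect e) (G.defect e) u, hr c c' e hc hc' he u hu,
    colNorm_le_norm ((F - G).defect e) u, norm_defect_le (F := F - G) he, hFG c hc, hFG c' hc']

lemma IsColumnLocal.diagPart (hF : F.IsColumnLocal) : F.diagPart.IsColumnLocal := fun δ hδ => by
  obtain ⟨r, hr⟩ := hF δ hδ
  refine ⟨r, fun c c' e hc hc' he u hu => ?_⟩
  have hsum : ∑ k, |F.diagPart.defect e k u| = |F.defect e (e u) u| := by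
    rw [Finset.sum_eq_single_of_mem (e u) (Finset.mem_univ _)]
    · rw [defect_apply_of_mem_range he, defect_apply_of_mem_range he]
      simp [MatFun.diagPart]
    · intro k _ hk
      by_cases hke : k ∈ Set.range e
      · obtain ⟨l, rfl⟩ := hke
        have hlu : l ≠ u := fun h => hk (congrArg e h)
        simp [defect_apply_of_mem_range he, MatFun.diagPart, hk, hlu]
      · simp [defect_apply_of_notMem_range e hke, MatFun.diagPart, hk]
  calc colNorm (F.diagPart.defect e) u ≤ |F.defect e (e u) u| :=
        (colNorm_le_sum_abs _ u).trans_eq hsum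
    _ ≤ δ := (abs_apply_le_colNorm _ _ u).trans (hr c c' e hc hc' he u hu)

/-- Families of matrices that are bounded, that depend measurably on the perturbations, and whose
rows and columns essentially depend only on the sites close to the row and column indices. -/
structure IsLocal (F : MatFun d) : Prop where
  exists_isBoundedBy : ∃ C > 0, F.IsBoundedBy C
  column : F.IsColumnLocal
  row : F.transpose.IsColumnLocal
  measurable : ∀ (ι : Type) [Fintype ι] [DecidableEq ι] (s : ι → Fin d → ℤ) (k l : ι),
    Measurable fun x : ι → EuclideanSpace ℝ (Fin d) => F ⟨ι, s, x⟩ k l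

lemma measurable_det {ι β : Type*} [Fintype ι] [DecidableEq ι] [MeasurableSpace β]
    {B : β → Matrix ι ι ℝ} (hB : ∀ k l, Measurable fun x => B x k l) :
    Measurable fun x => (B x).det := by
  simp only [det_apply]
  exact Finset.measurable_fun_sum _ fun σ _ =>
    (Finset.measurable_fun_prod _ fun i _ => hB _ _).const_smul _

lemma measurable_inv_apply {ι β : Type*} [Fintype ι] [DecidableEq ι] [MeasurableSpace β]
    {B : β → Matrix ι ι ℝ} (hB : ∀ k l, Measurable fun x => B x k l) (k l : ι) :
    Measurable fun x => (B x)⁻¹ k l := by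
  have hcramer : ∀ x, (B x)⁻¹ k l = (B x).det⁻¹ * ((B x).updateRow l (Pi.single k 1)).det :=
    fun x => by rw [inv_def, Ring.inverse_eq_inv', Matrix.smul_apply, adjugate_apply, smul_eq_mul]
  simp only [hcramer]
  refine (measurable_det hB).inv.mul (measurable_det fun i j => ?_)
  by_cases h : i = l
  · subst h; simp
  · simpa [updateRow_apply, h] using hB i j

namespace IsLocal

lemma transpose (hF : F.IsLocal) : F.transpose.IsLocal where
  exists_isBoundedBy := by
    obtain ⟨C, hC, hFC⟩ := hF.exists_isBoundedBy
    exact ⟨C, hC, fun c hc => (norm_transpose (F c)).trans_le (hFC c hc)⟩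
  column := hF.row
  row := hF.column
  measurable := fun ι _ _ s k l => hF.measurable ι s l k

lemma add (hF : F.IsLocal) (hG : G.IsLocal) : (F + G).IsLocal where
  exists_isBoundedBy := by
    obtain ⟨C, hC, hFC⟩ := hF.exists_isBoundedBy
    obtain ⟨C', hC', hGC⟩ := hG.exists_isBoundedBy
    exact ⟨C + C', by positivity, fun c hc => norm_add_le_of_le (hFC c hc) (hGC c hc)⟩
  column := hF.column.add hG.column
  row := hF.row.add hG.row
  measurable := fun ι _ _ s k l => (hF.measurable ι s k l).add (hG.measurable ι s k l)

lemma mul (hF : F.IsLocal) (hG : G.IsLocal) : (F * G).IsLocal := by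
  obtain ⟨C, hC, hFC⟩ := hF.exists_isBoundedBy
  obtain ⟨C', hC', hGC⟩ := hG.exists_isBoundedBy
  have htranspose : (F * G).transpose = G.transpose * F.transpose :=
    funext fun c => transpose_mul _ _
  refine ⟨⟨C * C', by positivity, fun c hc => norm_mul_le_of_le (hFC c hc) (hGC c hc)⟩,
    hF.column.mul hFC hG.column hGC hC hC', ?_, fun ι _ _ s k l => ?_⟩
  · rw [htranspose]
    exact hG.row.mul (fun c hc => (norm_transpose (G c)).trans_le (hGC c hc)) hF.row
      (fun c hc => (norm_transpose (F c)).trans_le (hFC c hc)) hC' hC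
  · simp only [Pi.mul_apply, mul_apply]
    exact Finset.measurable_fun_sum (Finset.univ : Finset ι) fun j _ =>
      (hF.measurable ι s k j).fun_mul (hG.measurable ι s j l)

end IsLocal

lemma isLocal_algebraMap (a : ℝ) : (algebraMap ℝ (MatFun d) a).IsLocal where
  exists_isBoundedBy := by
    refine ⟨|a| + 1, by positivity, fun c _ => ?_⟩
    rw [Algebra.algebraMap_eq_smul_one, Pi.smul_apply, Pi.one_apply, norm_smul, Real.norm_eq_abs]
    nlinarith [norm_one_le_one (κ := c.ι), abs_nonneg a]
  column := isColumnLocal_algebraMap a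
  row := by
    have htranspose : (algebraMap ℝ (MatFun d) a).transpose = algebraMap ℝ _ a :=
      funext fun c => by simp [MatFun.transpose, Algebra.algebraMap_eq_smul_one]
    rw [htranspose]
    exact isColumnLocal_algebraMap a
  measurable := fun ι _ _ _ k l => measurable_const (a := algebraMap ℝ (Matrix ι ι ℝ) a k l)

/-- The algebra of the local families. -/
def localSubalgebra (d : ℕ) : Subalgebra ℝ (MatFun d) where
  carrier := {F | F.IsLocal}
  mul_mem' := IsLocal.mul
  add_mem' := IsLocal.add
  algebraMap_mem' := isLocal_algebraMap

namespace IsLocal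

lemma sub (hF : F.IsLocal) (hG : G.IsLocal) : (F - G).IsLocal := (localSubalgebra d).sub_mem hF hG

lemma pow (hF : F.IsLocal) (q : ℕ) : (F ^ q).IsLocal := (localSubalgebra d).pow_mem hF q

lemma const_smul (hF : F.IsLocal) (r : ℝ) : (r • F).IsLocal := (localSubalgebra d).smul_mem hF r

lemma diagPart (hF : F.IsLocal) : F.diagPart.IsLocal where
  exists_isBoundedBy := by
    obtain ⟨C, hC, hFC⟩ := hF.exists_isBoundedBy
    refine ⟨C, hC, fun c hc => ?_⟩
    rw [MatFun.diagPart, l2_opNorm_diagonal]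
    exact (pi_norm_le_iff_of_nonneg hC.le).2 fun k => (abs_apply_le_norm _ k k).trans (hFC c hc)
  column := hF.column.diagPart
  row := by
    have htranspose : F.diagPart.transpose = F.diagPart := funext fun c => diagonal_transpose _
    exact htranspose ▸ hF.column.diagPart
  measurable := fun ι _ _ s k l => by
    by_cases h : k = l
    · subst h; simpa [MatFun.diagPart] using hF.measurable ι s k k
    · simp [MatFun.diagPart, h]

/-- The inverse is a uniform limit of partial sums of a Neumann series, which are local. -/
lemma isColumnLocal_inv {m : ℝ} (hm : 0 < m) (hF : F.IsLocal)
    (hcoer : ∀ c : Config d, c.Valid → IsCoerciveWith m (F c)) : F⁻¹.IsColumnLocal := by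
  obtain ⟨C, hC, hFC⟩ := hF.exists_isBoundedBy
  set M := max C m
  set q := √(1 - m ^ 2 / M ^ 2)
  have hq : q < 1 := by
    rw [Real.sqrt_lt' one_pos]
    have : 0 < m ^ 2 / M ^ 2 := by positivity
    linarith
  refine IsColumnLocal.of_approx fun δ hδ => ?_
  obtain ⟨J, hJ⟩ := exists_pow_lt_of_lt_one (show 0 < δ * m by positivity) hq
  set A := localSubalgebra d
  have hgeom : ((m / M ^ 2) • ∑ j ∈ Finset.range J, (1 - (m / M ^ 2) • F) ^ j) ∈ A :=
    A.smul_mem (sum_mem fun j _ => pow_mem (sub_mem A.one_mem (A.smul_mem hF _)) j) _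
  refine ⟨_, hgeom.column, fun c hc => ?_⟩
  have hdiff := inv_sub_smul_geom_sum ((hcoer c hc).isUnit hm) (m / M ^ 2) J
  simp only [Pi.sub_apply, Pi.inv_apply, Pi.smul_apply, Finset.sum_apply, Pi.pow_apply,
    Pi.one_apply, hdiff]
  calc ‖(F c)⁻¹ * (1 - (m / M ^ 2) • F c) ^ J‖
      ≤ m⁻¹ * q ^ J := by
        refine norm_mul_le_of_le ((hcoer c hc).norm_inv_le hm) ?_
        rcases J.eq_zero_or_pos with rfl | hJ0
        · simpa using norm_one_le_one
        · exact (norm_pow_le' _ hJ0).trans (pow_le_pow_left₀ (norm_nonneg _)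
            ((hcoer c hc).norm_one_sub_smul_le hm (le_max_right _ _)
              ((hFC c hc).trans (le_max_left _ _))) J)
    _ ≤ δ := by
        rw [inv_mul_le_iff₀ hm, mul_comm m]
        exact hJ.le

lemma inv {m : ℝ} (hm : 0 < m) (hF : F.IsLocal)
    (hcoer : ∀ c : Config d, c.Valid → IsCoerciveWith m (F c)) : F⁻¹.IsLocal where
  exists_isBoundedBy := ⟨m⁻¹, inv_pos.2 hm, fun c hc => (hcoer c hc).norm_inv_le hm⟩
  column := hF.isColumnLocal_inv hm hcoer
  row := by
    have htranspose : F⁻¹.transpose = F.transpose⁻¹ := funext fun c => transpose_nonsing_inv _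
    rw [htranspose]
    exact hF.transpose.isColumnLocal_inv hm fun c hc => (hcoer c hc).transpose
  measurable := fun ι _ _ s k l => measurable_inv_apply (hF.measurable ι s) k l

end IsLocal

end MatFun

end Locality

section Decay

open Matrix
open scoped Matrix.Norms.L2Operator

lemma summable_inv_one_add_norm_pow (d : ℕ) :
    Summable fun s : Fin d → ℤ => (1 + ‖s‖ ^ (d + 1))⁻¹ := by
  let Λ : Submodule ℤ (Fin d → ℝ) := Submodule.span ℤ (Set.range (Pi.basisFun ℝ (Fin d)))
  have hmem : ∀ s : Fin d → ℤ, (fun j => (s j : ℝ)) ∈ Λ := fun s => by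
    have hbasis : (fun j => (s j : ℝ)) = ∑ j, s j • Pi.basisFun ℝ (Fin d) j := by
      ext i
      simp [Finset.sum_apply, Pi.single_apply]
    rw [hbasis]
    exact Submodule.sum_mem _ fun j _ => Submodule.smul_mem _ _ (Submodule.subset_span ⟨j, rfl⟩)
  have hnorm : ∀ s : Fin d → ℤ, ‖(⟨fun j => (s j : ℝ), hmem s⟩ : Λ)‖ = ‖s‖ := fun s => by
    change ‖(fun j => (s j : ℝ))‖ = ‖s‖
    simp [Pi.norm_def, nnnorm, Int.norm_eq_abs, Real.norm_eq_abs]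
  have hrank : Module.finrank ℤ Λ < d + 1 := by
    simp [ZLattice.rank ℝ Λ]
  have hsum : Summable fun s : Fin d → ℤ => ‖s‖⁻¹ ^ (d + 1) := by
    have hinj : Function.Injective fun s : Fin d → ℤ => (⟨fun j => (s j : ℝ), hmem s⟩ : Λ) :=
      fun s t hst => funext fun j =>
        Int.cast_injective (α := ℝ) (congrFun (congrArg Subtype.val hst) j)
    simpa only [Function.comp_def, hnorm] using
      (ZLattice.summable_norm_pow_inv Λ (d + 1) hrank).comp_injective hinj
  refine Summable.of_norm_bounded_eventually hsum (Filter.eventually_cofinite.2 ?_)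
  refine (Set.finite_singleton (0 : Fin d → ℤ)).subset fun s hs => ?_
  by_contra h
  have : 0 < ‖s‖ := norm_pos_iff.2 h
  refine hs ?_
  rw [Real.norm_of_nonneg (by positivity), inv_pow]
  gcongr
  linarith

variable {d : ℕ}

/-- A lattice site as a point of the Euclidean space. -/
def intPoint (s : Fin d → ℤ) : EuclideanSpace ℝ (Fin d) := WithLp.toLp 2 fun j => (s j : ℝ)

/-- The perturbed position of a site. -/
def Config.pos (c : Config d) (ε : ℝ) (k : c.ι) : EuclideanSpace ℝ (Fin d) :=
  intPoint (c.site k) + ε • c.pt k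

namespace Config

variable {c c' : Config d}

lemma pos_sub_pos_apply (c : Config d) (ε : ℝ) (k l : c.ι) (j : Fin d) :
    (c.pos ε k - c.pos ε l) j = ((c.site k - c.site l) j : ℤ) + ε * (c.pt k j - c.pt l j) := by
  simp only [pos, intPoint, PiLp.sub_apply, PiLp.add_apply, PiLp.smul_apply, smul_eq_mul,
    Pi.sub_apply, Int.cast_sub]
  ring

lemma IsEmb.pos_sub_pos {e : c.ι → c'.ι} (he : IsEmb e) (ε : ℝ) (k l : c.ι) :
    c'.pos ε (e k) - c'.pos ε (e l) = c.pos ε k - c.pos ε l := by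
  ext j
  simp only [pos_sub_pos_apply, he.site_sub, he.pt_apply]

lemma Valid.norm_pos_sub_pos_ge (hc : c.Valid) {ε : ℝ} (hε : ε ∈ Set.Ico (0 : ℝ) (1 / 2))
    (k l : c.ι) : (1 - 2 * ε) * ‖c.site k - c.site l‖ ≤ ‖c.pos ε k - c.pos ε l‖ := by
  have hε' : 0 < 1 - 2 * ε := by linarith [hε.2]
  rw [mul_comm, ← le_div_iff₀ hε', pi_norm_le_iff_of_nonneg (by positivity)]
  intro j
  rw [le_div_iff₀ hε']
  refine le_trans ?_ (PiLp.norm_apply_le (c.pos ε k - c.pos ε l) j)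
  rw [pos_sub_pos_apply, Int.norm_eq_abs, Real.norm_eq_abs]
  set z : ℤ := (c.site k - c.site l) j
  set x : ℝ := c.pt k j - c.pt l j
  have hx : |ε * x| ≤ 2 * ε := by
    rw [abs_mul, abs_of_nonneg hε.1, mul_comm]
    have hk := hc.pt_mem k j
    have hl := hc.pt_mem l j
    exact mul_le_mul_of_nonneg_right (abs_le.2 ⟨by linarith [hk.1, hl.2], by linarith [hk.2, hl.1]⟩)
      hε.1
  have htri : |(z : ℝ)| - |ε * x| ≤ |(z : ℝ) + ε * x| := by
    simpa using abs_sub_abs_le_abs_sub (z : ℝ) (-(ε * x))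
  rcases eq_or_ne z 0 with hz | hz
  · simp only [hz, Int.cast_zero, abs_zero, zero_mul]
    positivity
  · have hone : (1 : ℝ) ≤ |(z : ℝ)| := by exact_mod_cast Int.one_le_abs hz
    nlinarith [hε.1]

lemma Valid.sum_le_tsum (hc : c.Valid) (u : c.ι) {w : (Fin d → ℤ) → ℝ} (hw : Summable w)
    (hw0 : ∀ s, 0 ≤ w s) : ∑ k, w (c.site k - c.site u) ≤ ∑' s, w s := by
  have hinj : Function.Injective fun k : c.ι => c.site k - c.site u :=
    fun k l hkl => hc.injective_site (sub_left_injective hkl)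
  simpa [Finset.sum_map] using hw.sum_le_tsum (Finset.univ.map ⟨_, hinj⟩) fun s _ => hw0 s

lemma exists_sum_lt_of_summable {w : (Fin d → ℤ) → ℝ} (hw : Summable w) {δ : ℝ} (hδ : 0 < δ) :
    ∃ r : ℕ, ∀ c : Config d, c.Valid → ∀ (u : c.ι) (S : Finset c.ι),
      (∀ k ∈ S, (r : ℝ) < ‖c.site k - c.site u‖) → ∑ k ∈ S, w (c.site k - c.site u) < δ := by
  obtain ⟨T, hT⟩ := summable_iff_vanishing_norm.1 hw δ hδ
  obtain ⟨R, hR⟩ := (T.finite_toSet.image fun s => ‖s‖).bddAbove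
  obtain ⟨r, hr⟩ := exists_nat_ge R
  refine ⟨r, fun c hc u S hS => ?_⟩
  have hinj : Function.Injective fun k : c.ι => c.site k - c.site u :=
    fun k l hkl => hc.injective_site (sub_left_injective hkl)
  have hdisj : Disjoint (S.map ⟨_, hinj⟩) T := by
    refine Finset.disjoint_left.2 fun s hs hsT => ?_
    obtain ⟨k, hk, rfl⟩ := Finset.mem_map.1 hs
    exact (hS k hk).not_ge ((hR ⟨_, hsT, rfl⟩).trans hr)
  simpa [Finset.sum_map] using (le_abs_self _).trans_lt (hT _ hdisj)

lemma Valid.norm_le_mul_tsum (hc : c.Valid) {A : Matrix c.ι c.ι ℝ} {B : ℝ} (hB : 0 ≤ B)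
    (hA : ∀ k l, |A k l| ≤ B * (1 + ‖c.site k - c.site l‖ ^ (d + 1))⁻¹) :
    ‖A‖ ≤ B * ∑' s : Fin d → ℤ, (1 + ‖s‖ ^ (d + 1))⁻¹ := by
  have hsum := summable_inv_one_add_norm_pow d
  have hpos : ∀ s : Fin d → ℤ, 0 ≤ (1 + ‖s‖ ^ (d + 1))⁻¹ := fun s => by positivity
  refine norm_le_of_sum_abs_le (mul_nonneg hB (tsum_nonneg hpos)) (fun k => ?_) fun l => ?_
  · refine (Finset.sum_le_sum fun l _ => hA k l).trans ?_
    simp only [← Finset.mul_sum, norm_sub_rev (c.site k)]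
    exact mul_le_mul_of_nonneg_left (hc.sum_le_tsum k hsum hpos) hB
  · refine (Finset.sum_le_sum fun k _ => hA k l).trans ?_
    rw [← Finset.mul_sum]
    exact mul_le_mul_of_nonneg_left (hc.sum_le_tsum l hsum hpos) hB

end Config

/-- The matrices `(h (z_k - z_l))`, where the `z_k` are the perturbed positions. -/
def kernelMatFun (h : EuclideanSpace ℝ (Fin d) → ℝ) (ε : ℝ) : MatFun d :=
  fun c => Matrix.of fun k l => h (c.pos ε k - c.pos ε l)

lemma transpose_kernelMatFun (h : EuclideanSpace ℝ (Fin d) → ℝ) (ε : ℝ) :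
    (kernelMatFun h ε).transpose = kernelMatFun (fun t => h (-t)) ε := by
  ext c k l
  simp [MatFun.transpose, kernelMatFun]

/-- The decay condition satisfied by the covariance functions and by their derivatives. -/
def HasDecay (h : EuclideanSpace ℝ (Fin d) → ℝ) : Prop :=
  ∃ C : ℝ, ∀ t, |h t| ≤ C / (1 + ‖t‖ ^ (d + 1))

namespace HasDecay

variable {h : EuclideanSpace ℝ (Fin d) → ℝ} {ε : ℝ}

lemma comp_neg (hh : HasDecay h) : HasDecay fun t => h (-t) := by
  obtain ⟨C, hC⟩ := hh
  exact ⟨C, fun t => by simpa using hC (-t)⟩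

lemma exists_abs_pos_sub_pos_le (hh : HasDecay h) (hε : ε ∈ Set.Ico (0 : ℝ) (1 / 2)) :
    ∃ C > 0, ∀ c : Config d, c.Valid → ∀ k l : c.ι,
      |h (c.pos ε k - c.pos ε l)| ≤ C * (1 + ‖c.site k - c.site l‖ ^ (d + 1))⁻¹ := by
  obtain ⟨C, hC⟩ := hh
  have hε' : 0 < 1 - 2 * ε := by linarith [hε.2]
  refine ⟨(|C| + 1) / (1 - 2 * ε) ^ (d + 1), by positivity, fun c hc k l => (hC _).trans ?_⟩
  have hpow : ((1 - 2 * ε) * ‖c.site k - c.site l‖) ^ (d + 1)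
      ≤ ‖c.pos ε k - c.pos ε l‖ ^ (d + 1) := by
    gcongr
    exact hc.norm_pos_sub_pos_ge hε k l
  have hone : (1 - 2 * ε) ^ (d + 1) ≤ 1 := pow_le_one₀ hε'.le (by linarith [hε.1])
  rw [← div_eq_mul_inv, div_div]
  refine div_le_div₀ (by positivity) (by linarith [le_abs_self C]) (by positivity) ?_
  rw [mul_add, mul_one, ← mul_pow]
  exact add_le_add hone hpow

lemma isColumnLocal (hh : HasDecay h) (hε : ε ∈ Set.Ico (0 : ℝ) (1 / 2)) :
    (kernelMatFun h ε).IsColumnLocal := fun δ hδ => by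
  obtain ⟨C, hC0, hC⟩ := hh.exists_abs_pos_sub_pos_le hε
  obtain ⟨r, hr⟩ := Config.exists_sum_lt_of_summable (summable_inv_one_add_norm_pow d)
    (div_pos hδ hC0)
  refine ⟨r, fun c c' e _ hc' he u hu => ?_⟩
  classical
  set S : Finset c'.ι := Finset.univ.filter fun k => k ∉ Set.range e
  have hentry : ∀ k, |(kernelMatFun h ε).defect e k u| ≤
      if k ∈ S then C * (1 + ‖c'.site k - c'.site (e u)‖ ^ (d + 1))⁻¹ else 0 := fun k => by
    by_cases hk : k ∈ Set.range e
    · rw [if_neg (by simpa [S] using hk)]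
      obtain ⟨k, rfl⟩ := hk
      simp [MatFun.defect_apply_of_mem_range he, kernelMatFun, he.pos_sub_pos]
    · rw [if_pos (by simpa [S] using hk), MatFun.defect_apply_of_notMem_range e hk]
      exact hC c' hc' k (e u)
  have hfar : ∀ k ∈ S, (r : ℝ) < ‖c'.site k - c'.site (e u)‖ := fun k hk =>
    not_le.1 fun hkr => (Finset.mem_filter.1 hk).2 (hu k hkr)
  calc colNorm ((kernelMatFun h ε).defect e) u
      ≤ ∑ k, if k ∈ S then C * (1 + ‖c'.site k - c'.site (e u)‖ ^ (d + 1))⁻¹ else 0 :=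
        (colNorm_le_sum_abs _ u).trans (Finset.sum_le_sum fun k _ => hentry k)
    _ = C * ∑ k ∈ S, (1 + ‖c'.site k - c'.site (e u)‖ ^ (d + 1))⁻¹ := by
        rw [Finset.sum_ite_mem, Finset.univ_inter, ← Finset.mul_sum]
    _ ≤ C * (δ / C) := mul_le_mul_of_nonneg_left (hr c' hc' (e u) S hfar).le hC0.le
    _ = δ := mul_div_cancel₀ δ hC0.ne'

lemma exists_isBoundedBy (hh : HasDecay h) (hε : ε ∈ Set.Ico (0 : ℝ) (1 / 2)) :
    ∃ C > 0, (kernelMatFun h ε).IsBoundedBy C := by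
  obtain ⟨C, hC0, hC⟩ := hh.exists_abs_pos_sub_pos_le hε
  refine ⟨C * ∑' s : Fin d → ℤ, (1 + ‖s‖ ^ (d + 1))⁻¹, mul_pos hC0 ?_,
    fun c hc => hc.norm_le_mul_tsum hC0.le (hC c hc)⟩
  exact (summable_inv_one_add_norm_pow d).tsum_pos (fun s => by positivity) 0 (by positivity)

lemma isLocal (hh : HasDecay h) (hm : Measurable h) (hε : ε ∈ Set.Ico (0 : ℝ) (1 / 2)) :
    (kernelMatFun h ε).IsLocal where
  exists_isBoundedBy := hh.exists_isBoundedBy hε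
  column := hh.isColumnLocal hε
  row := by
    rw [transpose_kernelMatFun]
    exact hh.comp_neg.isColumnLocal hε
  measurable := fun ι _ _ s k l => by
    simp only [kernelMatFun, Matrix.of_apply, Config.pos]
    exact hm.comp (by fun_prop)

end HasDecay

end Decay

section SpectralDensity

open Matrix
open scoped Matrix.Norms.L2Operator

section QuadraticForm

variable {E ι : Type*} [NormedAddCommGroup E] [InnerProductSpace ℝ E] [Fintype ι]

/-- The trigonometric polynomial with coefficients `α` and frequencies `z`. -/
def trigSum (α : ι → ℝ) (z : ι → E) (f : E) : ℂ :=
  ∑ k, (α k : ℂ) * Complex.exp (Complex.I * ((inner ℝ f (z k) : ℝ) : ℂ))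

lemma normSq_trigSum (α : ι → ℝ) (z : ι → E) (f : E) :
    (Complex.normSq (trigSum α z f) : ℂ) = ∑ k, ∑ l, ((α k * α l : ℝ) : ℂ)
      * Complex.exp (Complex.I * ((inner ℝ f (z k - z l) : ℝ) : ℂ)) := by
  rw [← Complex.mul_conj, trigSum, map_sum, Finset.sum_mul_sum]
  refine Finset.sum_congr rfl fun k _ => Finset.sum_congr rfl fun l _ => ?_
  rw [map_mul, Complex.conj_ofReal, ← Complex.exp_conj, map_mul, Complex.conj_I,
    Complex.conj_ofReal, inner_sub_right, Complex.ofReal_sub, mul_sub, sub_eq_add_neg,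
    Complex.exp_add, neg_mul]
  push_cast
  ring

variable [FiniteDimensional ℝ E] [MeasurableSpace E] [BorelSpace E]

/-- The inverse Fourier transform, in the normalization of `fourierHat`. -/
def invFourier (H : E → ℂ) (t : E) : ℂ :=
  ∫ f, H f * Complex.exp (Complex.I * ((inner ℝ f t : ℝ) : ℂ))

lemma integrable_mul_exp_inner {H : E → ℂ} (hH : Integrable H) (t : E) :
    Integrable fun f => H f * Complex.exp (Complex.I * ((inner ℝ f t : ℝ) : ℂ)) := by
  refine hH.mul_bdd (c := 1) (Continuous.aestronglyMeasurable (by fun_prop)) ?_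
  exact Eventually.of_forall fun f => (Complex.norm_exp_I_mul_ofReal _).le

lemma continuous_invFourier {H : E → ℂ} (hH : Integrable H) : Continuous (invFourier H) := by
  refine continuous_of_dominated (bound := fun f => ‖H f‖)
    (fun t => (integrable_mul_exp_inner hH t).aestronglyMeasurable)
    (fun t => Eventually.of_forall fun f => ?_) hH.norm (Eventually.of_forall fun f => ?_)
  · rw [norm_mul, Complex.norm_exp_I_mul_ofReal, mul_one]
  · fun_prop

lemma exists_norm_pow_mul_norm_invFourier_le {g : E → ℂ} (hg : HasCompactSupport g)
    (hs : ContDiff ℝ (⊤ : ℕ∞) g) (j : ℕ) : ∃ C > 0, ∀ t, ‖t‖ ^ j * ‖invFourier g t‖ ≤ C := by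
  obtain ⟨C, hC0, hC⟩ := (FourierTransform.fourier (hg.toSchwartzMap hs)).decay j 0
  have hpi : 0 < 2 * Real.pi := by positivity
  refine ⟨(2 * Real.pi) ^ j * C, by positivity, fun t => ?_⟩
  have hrescale : (∫ v, Complex.exp (((-2 * Real.pi * inner ℝ v (-(2 * Real.pi)⁻¹ • t) : ℝ) : ℂ)
      * Complex.I) • (hg.toSchwartzMap hs) v) = invFourier g t := by
    refine integral_congr_ae (Eventually.of_forall fun v => ?_)
    have hcancel : -2 * Real.pi * (-(2 * Real.pi)⁻¹ * inner ℝ v t) = inner ℝ v t := by field_simp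
    simp only [inner_smul_right, smul_eq_mul, hcancel, mul_comm Complex.I]
    exact mul_comm _ _
  have hdecay := hC (-(2 * Real.pi)⁻¹ • t)
  rw [norm_iteratedFDeriv_zero, SchwartzMap.fourier_coe, Real.fourier_eq', norm_smul, norm_neg,
    norm_inv, Real.norm_of_nonneg hpi.le, mul_pow, inv_pow, hrescale, mul_assoc,
    inv_mul_le_iff₀ (by positivity)] at hdecay
  exact hdecay

lemma invFourier_comp_inv_smul (g : E → ℂ) {r : ℝ} (hr : 0 < r) (t : E) :
    invFourier (fun f => g (r⁻¹ • f)) t = (r ^ Module.finrank ℝ E : ℝ) • invFourier g (r • t) := by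
  rw [invFourier, invFourier, ← Measure.integral_comp_inv_smul_of_nonneg volume _ hr.le]
  congr 1 with f
  rw [real_inner_smul_left, inner_smul_right, ← mul_assoc, inv_mul_cancel₀ hr.ne', one_mul]

lemma integrable_mul_normSq_trigSum {H : E → ℂ} (hH : Integrable H) (α : ι → ℝ) (z : ι → E) :
    Integrable fun f => H f * (Complex.normSq (trigSum α z f) : ℂ) := by
  simp only [normSq_trigSum, Finset.mul_sum, mul_left_comm (H _)]
  exact integrable_finsetSum _ fun k _ => integrable_finsetSum _ fun l _ =>
    (integrable_mul_exp_inner hH (z k - z l)).const_mul _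

lemma sum_mul_invFourier_sub {H : E → ℂ} (hH : Integrable H) (α : ι → ℝ) (z : ι → E) :
    ∑ k, ∑ l, ((α k * α l : ℝ) : ℂ) * invFourier H (z k - z l)
      = ∫ f, H f * (Complex.normSq (trigSum α z f) : ℂ) := by
  have hterm : ∀ k l, Integrable fun f => ((α k * α l : ℝ) : ℂ)
      * (H f * Complex.exp (Complex.I * ((inner ℝ f (z k - z l) : ℝ) : ℂ))) := fun k l =>
    (integrable_mul_exp_inner hH (z k - z l)).const_mul _
  simp only [normSq_trigSum, Finset.mul_sum, mul_left_comm (H _)]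
  rw [integral_finsetSum _ fun k _ => integrable_finsetSum _ fun l _ => hterm k l]
  refine Finset.sum_congr rfl fun k _ => ?_
  rw [integral_finsetSum _ fun l _ => hterm k l]
  exact Finset.sum_congr rfl fun l _ => (integral_const_mul _ _).symm

lemma sum_mul_re_invFourier_sub {H : E → ℂ} (hH : Integrable H) (α : ι → ℝ) (z : ι → E) :
    ∑ k, ∑ l, α k * α l * (invFourier H (z k - z l)).re
      = ∫ f, (H f).re * Complex.normSq (trigSum α z f) := by
  have hre : (∫ f, H f * (Complex.normSq (trigSum α z f) : ℂ)).re
      = ∫ f, (H f * (Complex.normSq (trigSum α z f) : ℂ)).re :=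
    (integral_re (integrable_mul_normSq_trigSum hH α z)).symm
  simpa only [Complex.re_sum, Complex.re_ofReal_mul, Complex.re_mul_ofReal, hre] using
    congrArg Complex.re (sum_mul_invFourier_sub hH α z)

lemma sum_mul_re_invFourier_sub_mono {G H : E → ℂ} (hG : Integrable G) (hH : Integrable H)
    (hGH : ∀ f, (G f).re ≤ (H f).re) (α : ι → ℝ) (z : ι → E) :
    ∑ k, ∑ l, α k * α l * (invFourier G (z k - z l)).re
      ≤ ∑ k, ∑ l, α k * α l * (invFourier H (z k - z l)).re := by
  have hre : ∀ H : E → ℂ, Integrable H →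
      Integrable fun f => (H f).re * Complex.normSq (trigSum α z f) := fun H hH => by
    simpa using (integrable_mul_normSq_trigSum hH α z).re
  rw [sum_mul_re_invFourier_sub hG, sum_mul_re_invFourier_sub hH]
  exact integral_mono (hre G hG) (hre H hH) fun f =>
    mul_le_mul_of_nonneg_right (hGH f) (Complex.normSq_nonneg _)

end QuadraticForm

variable {d : ℕ}

lemma dotProduct_kernelMatFun_mulVec (h : EuclideanSpace ℝ (Fin d) → ℝ) (ε : ℝ) (c : Config d)
    (φ : c.ι → ℝ) : φ ⬝ᵥ (kernelMatFun h ε c *ᵥ φ)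
      = ∑ k, ∑ l, φ k * φ l * h (c.pos ε k - c.pos ε l) := by
  simp only [dotProduct, mulVec, kernelMatFun, Matrix.of_apply, Finset.mul_sum]
  exact Finset.sum_congr rfl fun k _ => Finset.sum_congr rfl fun l _ => by ring

lemma IsCoerciveWith.kernelMatFun_of_re_le {G H : EuclideanSpace ℝ (Fin d) → ℂ}
    (hG : Integrable G) (hH : Integrable H) (hGH : ∀ f, (G f).re ≤ (H f).re) {m ε : ℝ}
    {c : Config d} (h : IsCoerciveWith m (kernelMatFun (fun t => (invFourier G t).re) ε c)) :
    IsCoerciveWith m (kernelMatFun (fun t => (invFourier H t).re) ε c) := fun φ => by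
  refine (h φ).trans ?_
  rw [dotProduct_kernelMatFun_mulVec, dotProduct_kernelMatFun_mulVec]
  exact sum_mul_re_invFourier_sub_mono hG hH hGH φ (c.pos ε)

lemma Config.Valid.one_le_norm_site_sub {c : Config d} (hc : c.Valid) {k l : c.ι} (hkl : k ≠ l) :
    1 ≤ ‖c.site k - c.site l‖ := by
  obtain ⟨j, hj⟩ := Function.ne_iff.1 (sub_ne_zero.2 (hc.injective_site.ne hkl))
  refine le_trans ?_ (norm_le_pi_norm _ j)
  rw [Int.norm_eq_abs]
  exact_mod_cast Int.one_le_abs hj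

lemma Config.Valid.abs_dilation_le {c : Config d} (hc : c.Valid)
    {h : EuclideanSpace ℝ (Fin d) → ℝ} {C : ℝ} (hC : ∀ t, ‖t‖ ^ (d + 1) * |h t| ≤ C) {ε : ℝ}
    (hε : ε ∈ Set.Ico (0 : ℝ) (1 / 2)) {r : ℝ} (hr : 1 ≤ r) {k l : c.ι} (hkl : k ≠ l) :
    |h (r • (c.pos ε k - c.pos ε l))|
      ≤ 2 * C / (1 - 2 * ε) ^ (d + 1) / r * (1 + ‖c.site k - c.site l‖ ^ (d + 1))⁻¹ := by
  have hε' : 0 < 1 - 2 * ε := by linarith [hε.2]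
  have hr0 : 0 < r := by linarith
  set s := ‖c.site k - c.site l‖
  set t := r • (c.pos ε k - c.pos ε l)
  have hs : 1 ≤ s ^ (d + 1) := one_le_pow₀ (hc.one_le_norm_site_sub hkl)
  have ht : r * ((1 - 2 * ε) * s) ≤ ‖t‖ := by
    rw [norm_smul, Real.norm_of_nonneg hr0.le]
    exact mul_le_mul_of_nonneg_left (hc.norm_pos_sub_pos_ge hε k l) hr0.le
  have hpow : r * ((1 - 2 * ε) ^ (d + 1) * ((1 + s ^ (d + 1)) / 2)) ≤ ‖t‖ ^ (d + 1) :=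
    calc r * ((1 - 2 * ε) ^ (d + 1) * ((1 + s ^ (d + 1)) / 2))
        ≤ r ^ (d + 1) * ((1 - 2 * ε) ^ (d + 1) * s ^ (d + 1)) := by
          gcongr
          · exact le_self_pow₀ hr (Nat.succ_ne_zero d)
          · linarith
      _ = (r * ((1 - 2 * ε) * s)) ^ (d + 1) := by rw [mul_pow, mul_pow]
      _ ≤ ‖t‖ ^ (d + 1) := pow_le_pow_left₀ (by positivity) ht _
  have hprod : r * ((1 - 2 * ε) ^ (d + 1) * ((1 + s ^ (d + 1)) / 2)) * |h t| ≤ C :=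
    (mul_le_mul_of_nonneg_right hpow (abs_nonneg _)).trans (hC t)
  have : 0 < (1 - 2 * ε) ^ (d + 1) := by positivity
  rw [div_div, ← div_eq_mul_inv, div_div, le_div_iff₀ (by positivity)]
  linarith

/-- After a large dilation, the off-diagonal part is dominated by the diagonal `h 0`. -/
lemma exists_isCoerciveWith_dilation {h : EuclideanSpace ℝ (Fin d) → ℝ} (h0 : 0 < h 0) {C : ℝ}
    (hC0 : 0 < C) (hC : ∀ t, ‖t‖ ^ (d + 1) * |h t| ≤ C) {ε : ℝ}
    (hε : ε ∈ Set.Ico (0 : ℝ) (1 / 2)) :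
    ∃ r > (0 : ℝ), ∀ c : Config d, c.Valid →
      IsCoerciveWith (h 0 / 2) (kernelMatFun (fun t => h (r • t)) ε c) := by
  have hε' : 0 < 1 - 2 * ε := by linarith [hε.2]
  set W : ℝ := ∑' s : Fin d → ℤ, (1 + ‖s‖ ^ (d + 1))⁻¹
  have : 0 ≤ W := tsum_nonneg fun s => by positivity
  set B : ℝ := 2 * C / (1 - 2 * ε) ^ (d + 1)
  have : 0 < B := by positivity
  set r : ℝ := 1 + 2 * (B * W) / h 0 with hr
  have hr1 : 1 ≤ r := le_add_of_nonneg_right (by positivity)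
  have hBW : B / r * W ≤ h 0 / 2 := by
    rw [div_mul_eq_mul_div, div_le_div_iff₀ (by positivity) two_pos, hr]
    field_simp
    linarith
  refine ⟨r, by positivity, fun c hc => ?_⟩
  rw [← sub_half]
  refine isCoerciveWith_of_norm_sub_smul_one_le (half_pos h0) (le_trans ?_ hBW)
  refine hc.norm_le_mul_tsum (by positivity) fun k l => ?_
  rcases eq_or_ne k l with rfl | hkl
  · simp only [kernelMatFun, Matrix.sub_apply, of_apply, Matrix.smul_apply, one_apply_eq, sub_self,
      smul_zero, smul_eq_mul, mul_one, abs_zero]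
    positivity
  · simpa [kernelMatFun, hkl] using hc.abs_dilation_le hC hε hr1 hkl

lemma exists_compactlySupported_isCoerciveWith (d : ℕ) {ε : ℝ}
    (hε : ε ∈ Set.Ico (0 : ℝ) (1 / 2)) :
    ∃ G : EuclideanSpace ℝ (Fin d) → ℂ, Continuous G ∧ HasCompactSupport G ∧
      (∀ f, (G f).re ≤ 1) ∧ ∃ m > 0, ∀ c : Config d, c.Valid →
        IsCoerciveWith m (kernelMatFun (fun t => (invFourier G t).re) ε c) := by
  let b : ContDiffBump (0 : EuclideanSpace ℝ (Fin d)) := ⟨1, 2, one_pos, one_lt_two⟩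
  set g : EuclideanSpace ℝ (Fin d) → ℂ := fun f => ((b f : ℝ) : ℂ) with hg
  have hsmooth : ContDiff ℝ (⊤ : ℕ∞) g := Complex.ofRealCLM.contDiff.comp b.contDiff
  have hcompact : HasCompactSupport g := b.hasCompactSupport.comp_left Complex.ofReal_zero
  obtain ⟨C, hC0, hC⟩ := exists_norm_pow_mul_norm_invFourier_le hcompact hsmooth (d + 1)
  have h0 : 0 < (invFourier g 0).re := by
    have hintegrable : invFourier g 0 = ((∫ f, b f : ℝ) : ℂ) := by
      rw [invFourier, ← integral_complex_ofReal]
      simp [hg]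
    rw [hintegrable, Complex.ofReal_re]
    exact b.integral_pos
  obtain ⟨r, hr0, hr⟩ := exists_isCoerciveWith_dilation (h := fun t => (invFourier g t).re) h0 hC0
    (fun t => le_trans (by gcongr; exact Complex.abs_re_le_norm _) (hC t)) hε
  have hdilate : ∀ t, (invFourier (fun f => g (r⁻¹ • f)) t).re
      = r ^ d * (invFourier g (r • t)).re := fun t => by
    rw [invFourier_comp_inv_smul g hr0, finrank_euclideanSpace_fin, Complex.real_smul,
      Complex.re_ofReal_mul]
  refine ⟨fun f => g (r⁻¹ • f), hsmooth.continuous.comp (continuous_const_smul _),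
    hcompact.comp_smul (inv_ne_zero hr0.ne'), fun f => by simpa [hg] using b.le_one,
    r ^ d * ((invFourier g 0).re / 2), by positivity, fun c hc φ => ?_⟩
  have hscale : kernelMatFun (fun t => (invFourier (fun f => g (r⁻¹ • f)) t).re) ε c
      = r ^ d • kernelMatFun (fun t => (invFourier g (r • t)).re) ε c := by
    ext k l
    simp [kernelMatFun, hdilate]
  rw [hscale, smul_mulVec, dotProduct_smul, smul_eq_mul, mul_assoc]
  exact mul_le_mul_of_nonneg_left (hr c hc φ) (by positivity)

/-- On the compact support of an auxiliary density with coercive matrices, the given density is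
bounded below by a positive constant. -/
lemma exists_isCoerciveWith_kernelMatFun {H : EuclideanSpace ℝ (Fin d) → ℂ}
    (hintegrable : Integrable H) (hcont : Continuous fun f => (H f).re)
    (hpos : ∀ f, 0 < (H f).re) {ε : ℝ}
    (hε : ε ∈ Set.Ico (0 : ℝ) (1 / 2)) : ∃ m > 0, ∀ c : Config d, c.Valid →
      IsCoerciveWith m (kernelMatFun (fun t => (invFourier H t).re) ε c) := by
  obtain ⟨G, hG, hGc, hG1, m, hm, hGm⟩ := exists_compactlySupported_isCoerciveWith d hε
  obtain ⟨a, ha0, ha⟩ : ∃ a > 0, ∀ f ∈ tsupport G, a ≤ (H f).re := by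
    rcases (tsupport G).eq_empty_or_nonempty with hempty | hne
    · exact ⟨1, one_pos, by simp [hempty]⟩
    · obtain ⟨f₀, -, hf₀⟩ := hGc.isCompact.exists_isMinOn hne hcont.continuousOn
      exact ⟨(H f₀).re, hpos f₀, fun f hf => hf₀ hf⟩
  have hle : ∀ f, ((a : ℂ) * G f).re ≤ (H f).re := fun f => by
    rw [Complex.re_ofReal_mul]
    by_cases hf : f ∈ tsupport G
    · exact (mul_le_of_le_one_right ha0.le (hG1 f)).trans (ha f hf)
    · simp only [image_eq_zero_of_notMem_tsupport hf, Complex.zero_re, mul_zero, (hpos f).le]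
  refine ⟨a * m, by positivity, fun c hc => IsCoerciveWith.kernelMatFun_of_re_le
    ((hG.integrable_of_hasCompactSupport hGc).const_mul (a : ℂ)) hintegrable hle fun φ => ?_⟩
  have hscale : kernelMatFun (fun t => (invFourier (fun f => (a : ℂ) * G f) t).re) ε c
      = a • kernelMatFun (fun t => (invFourier G t).re) ε c := by
    ext k l
    simp [kernelMatFun, invFourier, mul_assoc, integral_const_mul]
  rw [hscale, smul_mulVec, dotProduct_smul, smul_eq_mul, mul_assoc]
  exact mul_le_mul_of_nonneg_left (hGm c hc φ) ha0.le

end SpectralDensity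

section LawOfLargeNumbers

lemma eventually_succ_sq_le_mul_sq {a : ℝ} (ha : 1 < a) :
    ∀ᶠ n : ℕ in atTop, (((n + 1) ^ 2 : ℕ) : ℝ) ≤ a * (n ^ 2 : ℕ) := by
  have hlim : Tendsto (fun n : ℕ => (1 + 1 / (n : ℝ)) ^ 2) atTop (𝓝 1) := by
    simpa using ((tendsto_one_div_atTop_nhds_zero_nat (𝕜 := ℝ)).const_add 1).pow 2
  filter_upwards [hlim.eventually_le_const ha, eventually_gt_atTop 0] with n hn hn0
  have : (0 : ℝ) < n := by exact_mod_cast hn0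
  calc (((n + 1) ^ 2 : ℕ) : ℝ) = (1 + 1 / (n : ℝ)) ^ 2 * (n ^ 2 : ℕ) := by
        push_cast
        field_simp
    _ ≤ a * (n ^ 2 : ℕ) := by gcongr

/-- The partial sums of `a + B` are nondecreasing, so that their growth is governed by that of a
subsequence with ratios close to `1`. -/
lemma tendsto_average_zero_of_tendsto_sq {a : ℕ → ℝ} {B : ℝ} (hB : ∀ k, |a k| ≤ B)
    (h : Tendsto (fun m : ℕ => (∑ k ∈ Finset.range (m ^ 2), a k) / (m ^ 2 : ℕ)) atTop (𝓝 0)) :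
    Tendsto (fun n : ℕ => (∑ k ∈ Finset.range n, a k) / n) atTop (𝓝 0) := by
  set u : ℕ → ℝ := fun n => ∑ k ∈ Finset.range n, (a k + B) with hu
  have hmono : Monotone u := monotone_nat_of_le_succ fun n => by
    rw [hu]
    simp only [Finset.sum_range_succ]
    linarith [neg_le_of_abs_le (hB n)]
  have hdiv : ∀ n : ℕ, n ≠ 0 → u n / n = (∑ k ∈ Finset.range n, a k) / n + B := fun n hn => by
    have hn' : (n : ℝ) ≠ 0 := by exact_mod_cast hn
    simp only [hu, Finset.sum_add_distrib, Finset.sum_const, Finset.card_range, nsmul_eq_mul]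
    field_simp
  have hsq : Tendsto (fun m : ℕ => u (m ^ 2) / (m ^ 2 : ℕ)) atTop (𝓝 B) := by
    have hlim := h.add_const B
    rw [zero_add] at hlim
    exact hlim.congr' <| (eventually_ne_atTop 0).mono fun m hm => (hdiv _ (pow_ne_zero 2 hm)).symm
  have hlim := (tendsto_div_of_monotone_of_exists_subseq_tendsto_div u B hmono fun a ha =>
    ⟨fun m => m ^ 2, eventually_succ_sq_le_mul_sq ha, tendsto_pow_atTop two_ne_zero,
      hsq⟩).sub_const B
  rw [sub_self] at hlim
  exact hlim.congr' <| (eventually_ne_atTop 0).mono fun n hn => by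
    rw [hdiv n hn, add_sub_cancel_right]

variable {Ω : Type*} [MeasurableSpace Ω] {μ : Measure Ω}

lemma ae_tendsto_zero_of_summable_integral {f : ℕ → Ω → ℝ} (hintegrable : ∀ n, Integrable (f n) μ)
    (h0 : ∀ n ω, 0 ≤ f n ω) (hs : Summable fun n => ∫ ω, f n ω ∂μ) :
    ∀ᵐ ω ∂μ, Tendsto (fun n => f n ω) atTop (𝓝 0) := by
  have hmeas : ∀ n, AEMeasurable (fun ω => ENNReal.ofReal (f n ω)) μ :=
    fun n => (hintegrable n).aemeasurable.ennreal_ofReal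
  have hfin : ∫⁻ ω, ∑' n, ENNReal.ofReal (f n ω) ∂μ ≠ ⊤ := by
    simp only [lintegral_tsum hmeas,
      ← ofReal_integral_eq_lintegral_ofReal (hintegrable _) (Eventually.of_forall (h0 _))]
    exact hs.tsum_ofReal_ne_top
  filter_upwards [ae_lt_top' (AEMeasurable.tsum hmeas) hfin] with ω hω
  have hlim := (ENNReal.tendsto_toReal ENNReal.zero_ne_top).comp
    (ENNReal.tendsto_atTop_zero_of_tsum_ne_top hω.ne)
  simpa [Function.comp_def, ENNReal.toReal_ofReal (h0 _ ω)] using hlim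

lemma ae_tendsto_average_zero_of_integral_sq_le [IsFiniteMeasure μ] {η : ℕ → Ω → ℝ} {B C : ℝ}
    (hm : ∀ k, Measurable (η k)) (hB : ∀ k, ∀ᵐ ω ∂μ, |η k ω| ≤ B)
    (hC : ∀ n : ℕ, ∫ ω, (∑ k ∈ Finset.range n, η k ω) ^ 2 ∂μ ≤ C * n) :
    ∀ᵐ ω ∂μ, Tendsto (fun n : ℕ => (∑ k ∈ Finset.range n, η k ω) / n) atTop (𝓝 0) := by
  have hB' := ae_all_iff.2 hB
  set f : ℕ → Ω → ℝ := fun m ω => ((∑ k ∈ Finset.range (m ^ 2), η k ω) / (m ^ 2 : ℕ)) ^ 2 with hf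
  have hintegrable : ∀ m, Integrable (f m) μ := fun m => by
    refine Integrable.of_bound (C := ((m ^ 2 : ℕ) * B / (m ^ 2 : ℕ)) ^ 2) (Measurable.pow_const
      ((Finset.measurable_fun_sum _ fun k _ => hm k).div_const _) 2).aestronglyMeasurable ?_
    filter_upwards [hB'] with ω hω
    have hsum : |∑ k ∈ Finset.range (m ^ 2), η k ω| ≤ (m ^ 2 : ℕ) * B :=
      (Finset.abs_sum_le_sum_abs _ _).trans
        ((Finset.sum_le_sum fun k _ => hω k).trans (by simp))
    rw [Real.norm_of_nonneg (sq_nonneg _), div_pow, div_pow, ← sq_abs (∑ k ∈ _, η k ω)]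
    gcongr
  have hsummable : Summable fun m => ∫ ω, f m ω ∂μ := by
    refine Summable.of_nonneg_of_le (fun m => integral_nonneg fun ω => sq_nonneg _) (fun m => ?_)
      ((Real.summable_one_div_nat_pow.2 one_lt_two).mul_left C)
    simp only [hf, div_pow, integral_div]
    rcases Nat.eq_zero_or_pos m with rfl | hm0
    · simp
    · rw [div_le_iff₀ (by positivity)]
      refine (hC (m ^ 2)).trans_eq ?_
      push_cast
      field_simp
  filter_upwards [ae_tendsto_zero_of_summable_integral hintegrable (fun m ω => sq_nonneg _)
    hsummable, hB'] with ω hω hb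
  refine tendsto_average_zero_of_tendsto_sq hb ((tendsto_zero_iff_abs_tendsto_zero _).2 ?_)
  have hsqrt := (Real.continuous_sqrt.tendsto 0).comp hω
  rw [Real.sqrt_zero] at hsqrt
  exact hsqrt.congr fun m => Real.sqrt_sq_eq_abs _

lemma ae_tendsto_average_zero_of_integral_mul_eq_zero [IsProbabilityMeasure μ] {η : ℕ → Ω → ℝ}
    {B : ℝ} {D : ℕ} (hm : ∀ k, Measurable (η k)) (hB : ∀ k, ∀ᵐ ω ∂μ, |η k ω| ≤ B)
    (N : ℕ → Finset ℕ) (hN : ∀ k, (N k).card ≤ D)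
    (h0 : ∀ k, ∀ l ∉ N k, ∫ ω, η k ω * η l ω ∂μ = 0) :
    ∀ᵐ ω ∂μ, Tendsto (fun n : ℕ => (∑ k ∈ Finset.range n, η k ω) / n) atTop (𝓝 0) := by
  refine ae_tendsto_average_zero_of_integral_sq_le (C := D * (B * B)) hm hB fun n => ?_
  have hprod : ∀ k l, ∀ᵐ ω ∂μ, ‖η k ω * η l ω‖ ≤ B * B := fun k l => by
    filter_upwards [hB k, hB l] with ω hk hl
    exact norm_mul_le_of_le hk hl
  have hintegrable : ∀ k l, Integrable (fun ω => η k ω * η l ω) μ := fun k l =>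
    Integrable.of_bound ((hm k).mul (hm l)).aestronglyMeasurable _ (hprod k l)
  have hle : ∀ k l, ∫ ω, η k ω * η l ω ∂μ ≤ if l ∈ N k then B * B else 0 := fun k l => by
    split_ifs with hl
    · simpa using (le_abs_self _).trans (norm_integral_le_of_norm_le_const (hprod k l))
    · exact (h0 k l hl).le
  simp only [sq, Finset.sum_mul_sum]
  rw [integral_finsetSum _ fun k _ => integrable_finsetSum _ fun l _ => hintegrable k l]
  simp only [integral_finsetSum _ fun l _ => hintegrable _ l]
  calc ∑ k ∈ Finset.range n, ∑ l ∈ Finset.range n, ∫ ω, η k ω * η l ω ∂μ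
      ≤ ∑ k ∈ Finset.range n, ((Finset.range n ∩ N k).card : ℝ) * (B * B) := by
        refine Finset.sum_le_sum fun k _ => (Finset.sum_le_sum fun l _ => hle k l).trans_eq ?_
        rw [Finset.sum_ite_mem, Finset.sum_const, nsmul_eq_mul]
    _ ≤ ∑ _ ∈ Finset.range n, (D : ℝ) * (B * B) := by
        gcongr
        · exact mul_self_nonneg B
        · exact (Finset.card_le_card Finset.inter_subset_right).trans (hN k)
    _ = D * (B * B) * n := by
        rw [Finset.sum_const, Finset.card_range, nsmul_eq_mul]
        ring

end LawOfLargeNumbers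

section GridBoundary

variable {d : ℕ} {v : ℕ → Fin d → ℕ}

/-- The `k`-th point of the grid, with integer coordinates. -/
def intGrid (v : ℕ → Fin d → ℕ) (k : ℕ) : Fin d → ℤ := fun j => (v k j : ℤ)

lemma IsGridEnumeration.exists_lt_pow_eq (hv : IsGridEnumeration v) {N : ℕ} (hN : 1 ≤ N)
    {u : Fin d → ℕ} (hu : ∀ j, 1 ≤ u j ∧ u j ≤ N) : ∃ i < N ^ d, v i = u :=
  (hv N hN).symm.subset hu

lemma IsGridEnumeration.injective (hd : 0 < d) (hv : IsGridEnumeration v) :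
    Function.Injective v := by
  intro k l hkl
  set N := k + l + 1
  have hlt : ∀ i ≤ k + l, i < N ^ d := fun i hi =>
    lt_of_lt_of_le (by lia) (Nat.le_self_pow hd.ne' N)
  have himage : (Finset.range (N ^ d)).image v = Fintype.piFinset fun _ => Finset.Icc 1 N := by
    apply Finset.coe_injective
    rw [Finset.coe_image, Finset.coe_range, Fintype.coe_piFinset]
    refine (hv N (by lia)).trans ?_
    ext u
    simp [Pi.le_def, forall_and]
  have hcard : ((Finset.range (N ^ d)).image v).card = (Finset.range (N ^ d)).card := by
    rw [himage]
    simp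
  exact Finset.injOn_of_card_image_eq hcard (by simpa using hlt k (by lia))
    (by simpa using hlt l (by lia)) hkl

lemma IsGridEnumeration.injective_intGrid (hd : 0 < d) (hv : IsGridEnumeration v) :
    Function.Injective (intGrid v) := fun _ _ hkl =>
  hv.injective hd (funext fun j => Int.ofNat_inj.1 (congrFun hkl j))

/-- All the sites at distance at most `r` of the `k`-th one are among the first `n` ones. -/
def IsBulk (v : ℕ → Fin d → ℕ) (r n k : ℕ) : Prop :=
  ∀ s : box d r, ∃ i < n, intGrid v i = intGrid v k + s

open Classical in
/-- The number of sites, among the first `n` ones, that are at distance at most `r` of a site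
which is not among them. -/
def boundaryCard (v : ℕ → Fin d → ℕ) (r n : ℕ) : ℕ :=
  ((Finset.range n).filter fun k => ¬ IsBulk v r n k).card

lemma IsGridEnumeration.exists_isBulk (hv : IsGridEnumeration v) {r n N : ℕ} (hN : 1 ≤ N)
    (hn : N ^ d ≤ n) {u : Fin d → ℕ} (hu : ∀ j, r + 1 ≤ u j ∧ u j ≤ N - r) :
    ∃ k < n, IsBulk v r n k ∧ v k = u := by
  obtain ⟨k, hk, hku⟩ := hv.exists_lt_pow_eq hN (u := u) fun j => by have := hu j; lia
  refine ⟨k, hk.trans_le hn, fun s => ?_, hku⟩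
  have hs : ∀ j, -(r : ℤ) ≤ s.1 j ∧ s.1 j ≤ r := fun j =>
    Finset.mem_Icc.1 (Fintype.mem_piFinset.1 s.2 j)
  obtain ⟨i, hi, hiu⟩ := hv.exists_lt_pow_eq hN (u := fun j => ((u j : ℤ) + s.1 j).toNat)
    fun j => by have := hu j; have := hs j; lia
  refine ⟨i, hi.trans_le hn, funext fun j => ?_⟩
  have := hu j
  have := hs j
  simp only [intGrid, hiu, hku, Pi.add_apply]
  lia

lemma boundaryCard_add_pow_le (hv : IsGridEnumeration v) {r n N : ℕ} (hN : 1 ≤ N)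
    (hn : N ^ d ≤ n) : boundaryCard v r n + (N - 2 * r) ^ d ≤ n := by
  classical
  have hbulk : (N - 2 * r) ^ d ≤ ((Finset.range n).filter fun k => IsBulk v r n k).card :=
    calc (N - 2 * r) ^ d
        = (Fintype.piFinset fun _ : Fin d => Finset.Icc (r + 1) (N - r)).card := by
          rw [Fintype.card_piFinset_const, Nat.card_Icc]
          congr 1
          lia
      _ ≤ (((Finset.range n).filter fun k => IsBulk v r n k).image v).card := by
          refine Finset.card_le_card fun u hu => ?_
          obtain ⟨k, hk, hbulk, rfl⟩ := hv.exists_isBulk hN hn (r := r) fun j =>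
            Finset.mem_Icc.1 (Fintype.mem_piFinset.1 hu j)
          exact Finset.mem_image_of_mem v (Finset.mem_filter.2 ⟨Finset.mem_range.2 hk, hbulk⟩)
      _ ≤ _ := Finset.card_image_le
  have hsplit := Finset.card_filter_add_card_filter_not (s := Finset.range n)
    (fun k => IsBulk v r n k)
  rw [Finset.card_range] at hsplit
  rw [boundaryCard]
  lia

lemma tendsto_boundaryCard_div (hd : 0 < d) (hv : IsGridEnumeration v) (r : ℕ) :
    Tendsto (fun n : ℕ => (boundaryCard v r n : ℝ) / n) atTop (𝓝 0) := by
  set N := Nat.nthRoot d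
  have hN : Tendsto N atTop atTop := tendsto_atTop.2 fun M => by
    filter_upwards [eventually_ge_atTop (M ^ d)] with n hn
    exact (Nat.le_nthRoot_iff hd.ne').2 hn
  have hlim : Tendsto (fun n => 1 - (1 - (2 * r + 1 : ℝ) * (1 / ((N n : ℝ) + 1))) ^ d) atTop
      (𝓝 0) := by
    simpa [Function.comp_def] using ((((tendsto_one_div_add_atTop_nhds_zero_nat (𝕜 := ℝ)).comp
      hN).const_mul (2 * r + 1 : ℝ)).const_sub 1).pow d |>.const_sub 1
  refine squeeze_zero' (Eventually.of_forall fun n => by positivity) ?_ hlim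
  filter_upwards [hN.eventually_ge_atTop (2 * r + 1), eventually_gt_atTop 0] with n hn hn0
  have hle := boundaryCard_add_pow_le hv (r := r) (by lia : 1 ≤ N n)
    (Nat.pow_nthRoot_le (.inl hd.ne'))
  have hboundary : (boundaryCard v r n : ℝ) ≤ n - ((N n : ℝ) - 2 * r) ^ d := by
    have hcast : ((N n - 2 * r : ℕ) : ℝ) = N n - 2 * r := by
      rw [Nat.cast_sub (by lia), Nat.cast_mul, Nat.cast_ofNat]
    rw [← hcast, le_sub_iff_add_le]
    exact_mod_cast hle
  have hnonneg : (0 : ℝ) ≤ N n - 2 * r := by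
    rw [sub_nonneg]
    exact_mod_cast (by lia : 2 * r ≤ N n)
  have hside : (1 - (2 * r + 1 : ℝ) * (1 / ((N n : ℝ) + 1))) = (N n - 2 * r) / (N n + 1) := by
    field_simp
    ring
  have hn_le : (n : ℝ) ≤ ((N n : ℝ) + 1) ^ d := by
    exact_mod_cast (Nat.lt_pow_nthRoot_add_one hd.ne' n).le
  have hn_pos : (0 : ℝ) < n := by exact_mod_cast hn0
  rw [hside, div_pow, div_le_iff₀ hn_pos, sub_mul, one_mul, div_mul_eq_mul_div]
  refine hboundary.trans (sub_le_sub_left ?_ _)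
  rw [div_le_iff₀ (by positivity)]
  gcongr

end GridBoundary

section CentralCoefficient

variable {d : ℕ} {F : MatFun d} {C : ℝ} {r : ℕ} {L : Measure (EuclideanSpace ℝ (Fin d))}

/-- The cube `[-1, 1]^d`. -/
def unitCube (d : ℕ) : Set (EuclideanSpace ℝ (Fin d)) := {t | ∀ j, t j ∈ Set.Icc (-1 : ℝ) 1}

/-- The configuration of all the sites of a box. -/
def boxConfig (r : ℕ) (x : box d r → EuclideanSpace ℝ (Fin d)) : Config d where
  ι := box d r
  site := Subtype.val
  pt := x

lemma valid_boxConfig {x : box d r → EuclideanSpace ℝ (Fin d)} (hx : ∀ s, x s ∈ unitCube d) :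
    (boxConfig r x).Valid := ⟨Subtype.val_injective, hx⟩

/-- The center of a box, as one of its sites. -/
def boxCenter (d r : ℕ) : box d r := ⟨0, mem_box.2 (by simp)⟩

/-- The central diagonal coefficient of the matrix attached to a box. -/
def centralCoeff (F : MatFun d) (r : ℕ) (x : box d r → EuclideanSpace ℝ (Fin d)) : ℝ :=
  F (boxConfig r x) (boxCenter d r) (boxCenter d r)

/-- The expected central diagonal coefficient of the matrix attached to a box. -/
def meanCentralCoeff (F : MatFun d) (L : Measure (EuclideanSpace ℝ (Fin d))) (r : ℕ) : ℝ :=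
  ∫ x, centralCoeff F r x ∂(Measure.pi fun _ : box d r => L)

lemma MatFun.IsLocal.measurable_centralCoeff (hF : F.IsLocal) (r : ℕ) :
    Measurable (centralCoeff F r) := hF.measurable _ _ _ _

lemma abs_centralCoeff_le (hC : F.IsBoundedBy C) {x : box d r → EuclideanSpace ℝ (Fin d)}
    (hx : ∀ s, x s ∈ unitCube d) : |centralCoeff F r x| ≤ C :=
  (abs_apply_le_norm _ _ _).trans (hC _ (valid_boxConfig hx))

lemma abs_meanCentralCoeff_le [IsProbabilityMeasure L] (hC : F.IsBoundedBy C)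
    (hL : ∀ᵐ t ∂L, t ∈ unitCube d) (r : ℕ) : |meanCentralCoeff F L r| ≤ C := by
  have hae : ∀ᵐ x ∂(Measure.pi fun _ : box d r => L), ∀ s, x s ∈ unitCube d :=
    ae_all_iff.2 fun s => Measure.tendsto_eval_ae_ae.eventually hL
  have hbound : ∀ᵐ x ∂(Measure.pi fun _ : box d r => L), ‖centralCoeff F r x‖ ≤ C :=
    hae.mono fun x hx => abs_centralCoeff_le hC hx
  simpa [meanCentralCoeff] using norm_integral_le_of_norm_le_const hbound

lemma MatFun.IsColumnLocal.exists_abs_apply_sub_centralCoeff_le (hF : F.IsColumnLocal) {δ : ℝ}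
    (hδ : 0 < δ) : ∃ r₀ : ℕ, ∀ r ≥ r₀, ∀ c : Config d, c.Valid → ∀ (u : c.ι) (e : box d r → c.ι),
      (∀ s, c.site (e s) = c.site u + s) →
        |F c u u - centralCoeff F r fun s => c.pt (e s)| ≤ δ := by
  obtain ⟨r₀, hr₀⟩ := hF δ hδ
  refine ⟨r₀, fun r hr c hc u e he => ?_⟩
  set b := boxConfig r fun s => c.pt (e s)
  have hsub : ∀ s s' : box d r, c.site (e s) - c.site (e s') = (s : Fin d → ℤ) - s' :=
    fun s s' => by rw [he, he, add_sub_add_left_eq_sub]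
  have hemb : Config.IsEmb (c := b) (c' := c) e :=
    ⟨fun s s' h => Subtype.ext (add_left_cancel ((he s).symm.trans ((congrArg _ h).trans (he s')))),
      hsub, fun _ => rfl⟩
  have hcenter : e (boxCenter d r) = u :=
    hc.injective_site ((he _).trans (add_zero _))
  have hcover : Config.CoversBall (c := b) (c' := c) e (boxCenter d r) r := fun k hk => by
    rw [hcenter] at hk
    exact ⟨(⟨_, mem_box.2 hk⟩ : box d r), hc.injective_site ((he _).trans (add_sub_cancel _ _))⟩
  have hdefect : |F c (e (boxCenter d r)) (e (boxCenter d r)) -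
      centralCoeff F r fun s => c.pt (e s)| ≤ δ :=
    (congrArg abs (MatFun.defect_apply_of_mem_range hemb _ _)).symm.trans_le
      ((abs_apply_le_colNorm _ (e (boxCenter d r)) _).trans
        (hr₀ b c e (valid_boxConfig fun _ => hc.pt_mem _) hc hemb _ (hcover.mono hr)))
  rwa [hcenter] at hdefect

lemma meanCentralCoeff_eq_integral_infinitePi [IsProbabilityMeasure L] (hF : F.IsLocal) (r : ℕ) :
    meanCentralCoeff F L r = ∫ x, centralCoeff F r ((box d r).restrict x)
      ∂Measure.infinitePi fun _ : Fin d → ℤ => L := by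
  rw [meanCentralCoeff, ← Measure.infinitePi_map_restrict (μ := fun _ : Fin d → ℤ => L),
    integral_map (Finset.measurable_restrict _).aemeasurable
      (hF.measurable_centralCoeff r).aestronglyMeasurable]

lemma MatFun.IsLocal.exists_tendsto_meanCentralCoeff [IsProbabilityMeasure L] (hF : F.IsLocal)
    (hL : ∀ᵐ t ∂L, t ∈ unitCube d) : ∃ s, Tendsto (meanCentralCoeff F L) atTop (𝓝 s) := by
  refine cauchySeq_tendsto_of_complete (Metric.cauchySeq_iff'.2 fun δ hδ => ?_)
  obtain ⟨r, hr⟩ := hF.column.exists_abs_apply_sub_centralCoeff_le (half_pos hδ)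
  obtain ⟨C, -, hC⟩ := hF.exists_isBoundedBy
  refine ⟨r, fun r' hr' => ?_⟩
  set ν := Measure.infinitePi fun _ : Fin d → ℤ => L
  have hae : ∀ᵐ x ∂ν, ∀ s, x s ∈ unitCube d := ae_all_iff.2 fun s =>
    (measurePreserving_eval_infinitePi (fun _ : Fin d → ℤ => L) s).quasiMeasurePreserving.ae hL
  have hintegrable : ∀ q, Integrable (fun x => centralCoeff F q ((box d q).restrict x)) ν :=
    fun q => Integrable.of_bound ((hF.measurable_centralCoeff q).comp
      (Finset.measurable_restrict _)).aestronglyMeasurable C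
        (hae.mono fun x hx => abs_centralCoeff_le hC fun s => hx s)
  have hclose : ∀ᵐ x ∂ν, ‖centralCoeff F r' ((box d r').restrict x) -
      centralCoeff F r ((box d r).restrict x)‖ ≤ δ / 2 := hae.mono fun x hx =>
    hr r le_rfl (boxConfig r' ((box d r').restrict x)) (valid_boxConfig fun s => hx s)
      (boxCenter d r') (fun s => (⟨s, mem_box.2 ((mem_box.1 s.2).trans (by exact_mod_cast hr'))⟩ :
        box d r')) fun s => (zero_add _).symm
  have hintegral := norm_integral_le_of_norm_le_const hclose
  rw [integral_sub (hintegrable _) (hintegrable _), ← meanCentralCoeff_eq_integral_infinitePi hF,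
    ← meanCentralCoeff_eq_integral_infinitePi hF, probReal_univ, mul_one] at hintegral
  exact hintegral.trans_lt (half_lt_self hδ)

end CentralCoefficient

section TraceConvergence

variable {d : ℕ} {v : ℕ → Fin d → ℕ} {r : ℕ}

/-- The configuration of the first `n` sites of the grid. -/
def gridConfig (v : ℕ → Fin d → ℕ) (n : ℕ) (x : Fin n → EuclideanSpace ℝ (Fin d)) : Config d where
  ι := Fin n
  site := fun k => intGrid v k
  pt := x

/-- The matrix that `F` attaches to the first `n` sites of the grid, with `Fin n` as index type. -/
def MatFun.onGrid (F : MatFun d) (v : ℕ → Fin d → ℕ) (n : ℕ)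
    (x : Fin n → EuclideanSpace ℝ (Fin d)) : Matrix (Fin n) (Fin n) ℝ :=
  F (gridConfig v n x)

lemma valid_gridConfig (hv : Function.Injective (intGrid v)) {n : ℕ}
    {x : Fin n → EuclideanSpace ℝ (Fin d)} (hx : ∀ k, x k ∈ unitCube d) :
    (gridConfig v n x).Valid :=
  ⟨fun _ _ h => Fin.ext (hv h), hx⟩

/-- All the sites at distance at most `r` of the `k`-th one belong to the grid. -/
def IsInner (v : ℕ → Fin d → ℕ) (r k : ℕ) : Prop :=
  ∀ s : box d r, ∃ i, intGrid v i = intGrid v k + s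

lemma IsBulk.isInner {n k : ℕ} (h : IsBulk v r n k) : IsInner v r k :=
  fun s => (h s).imp fun _ => And.right

/-- The index of the site obtained by translating the `k`-th one by `s`; it has an arbitrary value
if that site is not in the grid. -/
def window (v : ℕ → Fin d → ℕ) (r k : ℕ) (s : box d r) : ℕ :=
  Function.invFun (intGrid v) (intGrid v k + s)

lemma IsInner.intGrid_window {k : ℕ} (h : IsInner v r k) (s : box d r) :
    intGrid v (window v r k s) = intGrid v k + s := Function.invFun_eq (h s)

lemma IsInner.injective_window {k : ℕ} (h : IsInner v r k) :
    Function.Injective (window v r k) := fun s t hst =>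
  Subtype.ext (add_left_cancel ((h.intGrid_window s).symm.trans
    ((congrArg (intGrid v) hst).trans (h.intGrid_window t))))

lemma IsInner.disjoint_range_window {k l : ℕ} (hk : IsInner v r k) (hl : IsInner v r l)
    (h : intGrid v l - intGrid v k ∉ box d (2 * r)) :
    Disjoint (Set.range (window v r k)) (Set.range (window v r l)) := by
  rw [Set.disjoint_left]
  rintro _ ⟨s, rfl⟩ ⟨t, hst⟩
  have hsites := hl.intGrid_window t
  rw [hst, hk.intGrid_window] at hsites
  refine h (mem_box.2 ?_)
  rw [sub_eq_sub_iff_add_eq_add.2 (by rw [← hsites, add_comm] :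
    intGrid v l + (t : Fin d → ℤ) = (s : Fin d → ℤ) + intGrid v k)]
  refine (norm_sub_le _ _).trans ((add_le_add (mem_box.1 s.2) (mem_box.1 t.2)).trans_eq ?_)
  push_cast
  ring

lemma window_sub_intGrid (hv : Function.Injective (intGrid v)) {k l : ℕ}
    (h : intGrid v l - intGrid v k ∈ box d r) : window v r k ⟨_, h⟩ = l := by
  rw [window, add_sub_cancel]
  exact Function.leftInverse_invFun hv l

variable {F : MatFun d} {C : ℝ} {ΩX : Type*} {X : ℕ → ΩX → EuclideanSpace ℝ (Fin d)}
  {L : Measure (EuclideanSpace ℝ (Fin d))}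

/-- The central coefficient of the box of the perturbations around the `k`-th site. -/
def windowCoeff (F : MatFun d) (v : ℕ → Fin d → ℕ) (X : ℕ → ΩX → EuclideanSpace ℝ (Fin d))
    (r k : ℕ) (ω : ΩX) : ℝ :=
  centralCoeff F r fun s => X (window v r k s) ω

open Classical in
/-- The centered version of `windowCoeff`, set to zero near the boundary of the grid, where there
is no full window. -/
def centeredWindowCoeff (F : MatFun d) (L : Measure (EuclideanSpace ℝ (Fin d)))
    (v : ℕ → Fin d → ℕ) (X : ℕ → ΩX → EuclideanSpace ℝ (Fin d)) (r k : ℕ) (ω : ΩX) : ℝ :=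
  if IsInner v r k then windowCoeff F v X r k ω - meanCentralCoeff F L r else 0

lemma abs_windowCoeff_le (hC : F.IsBoundedBy C) {ω : ΩX} (hω : ∀ k, X k ω ∈ unitCube d)
    (r k : ℕ) : |windowCoeff F v X r k ω| ≤ C :=
  abs_centralCoeff_le hC fun _ => hω _

lemma abs_centeredWindowCoeff_le [IsProbabilityMeasure L] (hC : F.IsBoundedBy C) (hC0 : 0 ≤ C)
    (hL : ∀ᵐ t ∂L, t ∈ unitCube d) {ω : ΩX} (hω : ∀ k, X k ω ∈ unitCube d) (r k : ℕ) :
    |centeredWindowCoeff F L v X r k ω| ≤ 2 * C := by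
  rw [centeredWindowCoeff]
  split_ifs
  · rw [two_mul]
    exact (abs_sub _ _).trans
      (add_le_add (abs_windowCoeff_le hC hω r k) (abs_meanCentralCoeff_le hC hL r))
  · rw [abs_zero]
    positivity

lemma MatFun.IsColumnLocal.exists_abs_apply_sub_windowCoeff_le (hF : F.IsColumnLocal)
    (hv : Function.Injective (intGrid v)) {δ : ℝ} (hδ : 0 < δ) :
    ∃ r₀ : ℕ, ∀ r ≥ r₀, ∀ ω : ΩX, (∀ k, X k ω ∈ unitCube d) → ∀ (n : ℕ) (k : Fin n),
      IsBulk v r n k →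
        |F (gridConfig v n (firstPerturbations X n ω)) k k - windowCoeff F v X r k ω| ≤ δ := by
  obtain ⟨r₀, hr₀⟩ := hF.exists_abs_apply_sub_centralCoeff_le hδ
  refine ⟨r₀, fun r hr ω hω n k hk => ?_⟩
  have hwindow := hk.isInner.intGrid_window
  have hlt : ∀ s, window v r k s < n := fun s => by
    obtain ⟨i, hi, his⟩ := hk s
    rwa [hv ((hwindow s).trans his.symm)]
  exact hr₀ r hr (gridConfig v n (firstPerturbations X n ω)) (valid_gridConfig hv fun k => hω k)
    k (fun s => (⟨window v r k s, hlt s⟩ : Fin n)) hwindow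

lemma abs_trace_sub_le [IsProbabilityMeasure L] (hC : F.IsBoundedBy C) (hC0 : 0 ≤ C)
    (hv : Function.Injective (intGrid v)) (hL : ∀ᵐ t ∂L, t ∈ unitCube d) {δ : ℝ} {ω : ΩX}
    (hω : ∀ k, X k ω ∈ unitCube d) {n : ℕ} (hδ : 0 ≤ δ) (hbulk : ∀ k : Fin n, IsBulk v r n k →
      |F (gridConfig v n (firstPerturbations X n ω)) k k - windowCoeff F v X r k ω| ≤ δ) :
    |(F.onGrid v n (firstPerturbations X n ω)).trace - n * meanCentralCoeff F L r
        - ∑ k ∈ Finset.range n, centeredWindowCoeff F L v X r k ω|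
      ≤ n * δ + 4 * C * boundaryCard v r n := by
  classical
  set G : Matrix (Fin n) (Fin n) ℝ := F (gridConfig v n (firstPerturbations X n ω))
  have hterm : ∀ k : Fin n,
      |G k k - meanCentralCoeff F L r - centeredWindowCoeff F L v X r k ω|
        ≤ δ + 4 * C * if IsBulk v r n k then 0 else 1 := fun k => by
    by_cases hk : IsBulk v r n k
    · rw [if_pos hk, mul_zero, add_zero, centeredWindowCoeff, if_pos hk.isInner, sub_sub,
        add_sub_cancel]
      exact hbulk k hk
    · have hGk : |G k k| ≤ C :=
        (abs_apply_le_norm G k k).trans (hC _ (valid_gridConfig hv fun k => hω k))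
      rw [if_neg hk]
      linarith [abs_sub (G k k - meanCentralCoeff F L r) (centeredWindowCoeff F L v X r k ω),
        abs_sub (G k k) (meanCentralCoeff F L r), abs_meanCentralCoeff_le hC hL r,
        abs_centeredWindowCoeff_le (v := v) hC hC0 hL hω r k]
  calc |G.trace - n * meanCentralCoeff F L r
        - ∑ k ∈ Finset.range n, centeredWindowCoeff F L v X r k ω|
      = |∑ k : Fin n, (G k k - meanCentralCoeff F L r - centeredWindowCoeff F L v X r k ω)| := by
        simp [Finset.sum_sub_distrib, Finset.sum_range, Matrix.trace]
    _ ≤ ∑ k : Fin n, (δ + 4 * C * if IsBulk v r n k then 0 else 1) :=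
        (Finset.abs_sum_le_sum_abs _ _).trans (Finset.sum_le_sum fun k _ => hterm k)
    _ = n * δ + 4 * C * boundaryCard v r n := by
        rw [Fin.sum_univ_eq_sum_range fun k => δ + 4 * C * if IsBulk v r n k then (0 : ℝ) else 1,
          Finset.sum_add_distrib, ← Finset.mul_sum, boundaryCard, Finset.card_filter]
        simp [ite_not]

variable [MeasurableSpace ΩX] {PX : Measure ΩX}

lemma ae_forall_mem_unitCube (hL : ∀ᵐ t ∂L, t ∈ unitCube d) (hXm : ∀ k, Measurable (X k))
    (hXL : ∀ k, PX.map (X k) = L) : ∀ᵐ ω ∂PX, ∀ k, X k ω ∈ unitCube d :=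
  ae_all_iff.2 fun k => ae_of_ae_map (hXm k).aemeasurable ((hXL k).symm ▸ hL)

lemma MatFun.IsLocal.measurable_windowCoeff (hF : F.IsLocal) (hXm : ∀ k, Measurable (X k))
    (r k : ℕ) : Measurable (windowCoeff F v X r k) :=
  (hF.measurable_centralCoeff r).comp (measurable_pi_lambda _ fun _ => hXm _)

lemma MatFun.IsLocal.integral_windowCoeff (hF : F.IsLocal) (hXm : ∀ k, Measurable (X k))
    (hXL : ∀ k, PX.map (X k) = L) (hind : iIndepFun X PX) {k : ℕ} (hk : IsInner v r k) :
    ∫ ω, windowCoeff F v X r k ω ∂PX = meanCentralCoeff F L r := by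
  have hlaw := iIndepFun.map_fun_eq_pi_map (fun s => (hXm (window v r k s)).aemeasurable)
    (hind.precomp hk.injective_window)
  simp only [hXL] at hlaw
  rw [meanCentralCoeff, ← hlaw, integral_map
    (measurable_pi_lambda _ fun s => hXm _).aemeasurable
    (hF.measurable_centralCoeff r).aestronglyMeasurable]
  rfl

lemma MatFun.IsLocal.indepFun_windowCoeff (hF : F.IsLocal) (hXm : ∀ k, Measurable (X k))
    (hind : iIndepFun X PX) {k l : ℕ}
    (h : Disjoint (Set.range (window v r k)) (Set.range (window v r l))) :
    IndepFun (windowCoeff F v X r k) (windowCoeff F v X r l) PX := by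
  have hfactor : ∀ k, Measurable fun y : Finset.univ.image (window v r k) →
      EuclideanSpace ℝ (Fin d) => centralCoeff F r fun s =>
        y ⟨window v r k s, Finset.mem_image_of_mem _ (Finset.mem_univ s)⟩ := fun k =>
    (hF.measurable_centralCoeff r).comp (measurable_pi_lambda _ fun s => measurable_pi_apply _)
  refine (hind.indepFun_finset (Finset.univ.image (window v r k))
    (Finset.univ.image (window v r l)) ?_ hXm).comp (hfactor k) (hfactor l)
  rw [← Finset.disjoint_coe]
  simpa using h

lemma MatFun.IsLocal.integral_centeredWindowCoeff_mul [IsProbabilityMeasure PX] (hF : F.IsLocal)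
    (hL : ∀ᵐ t ∂L, t ∈ unitCube d) (hXm : ∀ k, Measurable (X k)) (hXL : ∀ k, PX.map (X k) = L)
    (hind : iIndepFun X PX) {k l : ℕ} (h : intGrid v l - intGrid v k ∉ box d (2 * r)) :
    ∫ ω, centeredWindowCoeff F L v X r k ω * centeredWindowCoeff F L v X r l ω ∂PX = 0 := by
  by_cases hk : IsInner v r k
  swap
  · simp [centeredWindowCoeff, hk]
  by_cases hl : IsInner v r l
  swap
  · simp [centeredWindowCoeff, hl]
  obtain ⟨C, -, hC⟩ := hF.exists_isBoundedBy
  have hmeas := hF.measurable_windowCoeff (v := v) hXm r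
  have hindep := (hF.indepFun_windowCoeff hXm hind (hk.disjoint_range_window hl h)).comp
    (measurable_id.sub_const (meanCentralCoeff F L r))
    (measurable_id.sub_const (meanCentralCoeff F L r))
  have hcube := ae_forall_mem_unitCube hL hXm hXL
  have hintegrable : Integrable (windowCoeff F v X r k) PX :=
    Integrable.of_bound (hmeas k).aestronglyMeasurable C
      (hcube.mono fun ω hω => abs_windowCoeff_le hC hω r k)
  have hmean : ∫ ω, (windowCoeff F v X r k ω - meanCentralCoeff F L r) ∂PX = 0 := by
    rw [integral_sub hintegrable (integrable_const _), hF.integral_windowCoeff hXm hXL hind hk]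
    simp
  simp only [centeredWindowCoeff, if_pos hk, if_pos hl]
  refine (hindep.integral_fun_mul_eq_mul_integral ((hmeas k).sub_const _).aestronglyMeasurable
    ((hmeas l).sub_const _).aestronglyMeasurable).trans ?_
  simp only [Function.comp_def, id]
  rw [hmean, zero_mul]

lemma MatFun.IsLocal.ae_tendsto_average_centeredWindowCoeff [IsProbabilityMeasure PX]
    [IsProbabilityMeasure L] (hF : F.IsLocal) (hv : Function.Injective (intGrid v))
    (hL : ∀ᵐ t ∂L, t ∈ unitCube d) (hXm : ∀ k, Measurable (X k)) (hXL : ∀ k, PX.map (X k) = L)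
    (hind : iIndepFun X PX) (r : ℕ) :
    ∀ᵐ ω ∂PX, Tendsto (fun n : ℕ =>
      (∑ k ∈ Finset.range n, centeredWindowCoeff F L v X r k ω) / n) atTop (𝓝 0) := by
  obtain ⟨C, hC0, hC⟩ := hF.exists_isBoundedBy
  have hcube := ae_forall_mem_unitCube hL hXm hXL
  refine ae_tendsto_average_zero_of_integral_mul_eq_zero (fun k => ?_)
    (fun k => hcube.mono fun ω hω => abs_centeredWindowCoeff_le hC hC0.le hL hω r k)
    (fun k => Finset.univ.image (window v (2 * r) k)) (fun k => Finset.card_image_le)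
    fun k l hl => hF.integral_centeredWindowCoeff_mul hL hXm hXL hind fun h =>
      hl (Finset.mem_image.2 ⟨_, Finset.mem_univ _, window_sub_intGrid hv h⟩)
  unfold centeredWindowCoeff
  split_ifs
  · exact (hF.measurable_windowCoeff hXm r k).sub_const _
  · exact measurable_const

theorem MatFun.IsLocal.ae_tendsto_trace_div [IsProbabilityMeasure PX] [IsProbabilityMeasure L]
    (hF : F.IsLocal) (hd : 0 < d) (hv : IsGridEnumeration v) (hL : ∀ᵐ t ∂L, t ∈ unitCube d)
    (hXm : ∀ k, Measurable (X k)) (hXL : ∀ k, PX.map (X k) = L) (hind : iIndepFun X PX) {s : ℝ}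
    (hs : Tendsto (meanCentralCoeff F L) atTop (𝓝 s)) :
    ∀ᵐ ω ∂PX, Tendsto (fun n : ℕ => (F.onGrid v n (firstPerturbations X n ω)).trace / n)
      atTop (𝓝 s) := by
  have hinj := hv.injective_intGrid hd
  obtain ⟨C, hC0, hC⟩ := hF.exists_isBoundedBy
  have hcube := ae_forall_mem_unitCube hL hXm hXL
  filter_upwards [ae_all_iff.2 fun r =>
    hF.ae_tendsto_average_centeredWindowCoeff hinj hL hXm hXL hind r, hcube] with ω hcentered hω
  refine Metric.tendsto_nhds.2 fun δ hδ => ?_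
  obtain ⟨r₀, hr₀⟩ := hF.column.exists_abs_apply_sub_windowCoeff_le (X := X) hinj
    (show 0 < δ / 4 by positivity)
  obtain ⟨r, hmean, hr⟩ := ((Metric.tendsto_nhds.1 hs (δ / 4) (by positivity)).and
    (eventually_ge_atTop r₀)).exists
  have hboundary : ∀ᶠ n : ℕ in atTop, 4 * C * (boundaryCard v r n / n) < δ / 4 :=
    ((tendsto_boundaryCard_div hd hv r).const_mul (4 * C)).eventually_lt_const
      (by rw [mul_zero]; positivity)
  filter_upwards [hboundary, Metric.tendsto_nhds.1 (hcentered r) (δ / 4) (by positivity),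
    eventually_gt_atTop 0] with n hbdry haverage hn
  have hnpos : (0 : ℝ) < n := by exact_mod_cast hn
  have htrace := div_le_div_of_nonneg_right (abs_trace_sub_le hC hC0.le hinj hL hω
    (by positivity) (hr₀ r hr ω hω n)) hnpos.le
  rw [← abs_of_pos hnpos, ← abs_div, abs_of_pos hnpos, sub_div, sub_div, add_div,
    mul_div_cancel_left₀ _ hnpos.ne', mul_div_cancel_left₀ _ hnpos.ne', mul_div_assoc] at htrace
  rw [Real.dist_eq, abs_lt] at hmean haverage ⊢
  rw [abs_le] at htrace
  constructor <;> linarith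

end TraceConvergence

section MatrixCalculus

open Matrix
open scoped Matrix.Norms.L2Operator

lemma dotProduct_add_transpose_mulVec {ι : Type*} [Fintype ι] (M : Matrix ι ι ℝ) (y : ι → ℝ) :
    y ⬝ᵥ ((M + Mᵀ) *ᵥ y) = 2 * (y ⬝ᵥ (M *ᵥ y)) := by
  have htranspose : y ⬝ᵥ (Mᵀ *ᵥ y) = y ⬝ᵥ (M *ᵥ y) := by
    rw [mulVec_transpose, dotProduct_comm, ← dotProduct_mulVec]
  rw [add_mulVec, dotProduct_add, htranspose, two_mul]

lemma trace_add_transpose_mul {ι : Type*} [Fintype ι] (M N : Matrix ι ι ℝ) {R : Matrix ι ι ℝ}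
    (hR : Rᵀ = R) :
    ((M + Mᵀ) * R * (N + Nᵀ) * R).trace
      = 2 * ((M * R * Nᵀ * R).trace + (M * R * N * R).trace) := by
  have hswap (X Y : Matrix ι ι ℝ) : (Xᵀ * R * Y * R).trace = (X * R * Yᵀ * R).trace := by
    rw [← trace_transpose]
    simpa only [transpose_mul, hR, transpose_transpose, mul_assoc] using
      trace_mul_comm (R * Yᵀ * R) X
  have hexpand : (M + Mᵀ) * R * (N + Nᵀ) * R
      = M * R * N * R + M * R * Nᵀ * R + Mᵀ * R * N * R + Mᵀ * R * Nᵀ * R := by noncomm_ring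
  simp only [hexpand, trace_add, hswap, transpose_transpose]
  ring

lemma hasDerivWithinAt_matrix {ι : Type*} [Finite ι] {R : ℝ → Matrix ι ι ℝ} {R' : Matrix ι ι ℝ}
    {S : Set ℝ} {s : ℝ} (hR : ∀ k l, HasDerivWithinAt (fun t => R t k l) (R' k l) S s) :
    HasDerivWithinAt R R' S s := by
  classical
  cases nonempty_fintype ι
  have hsum := HasDerivWithinAt.fun_sum fun k (_ : k ∈ Finset.univ) =>
    HasDerivWithinAt.fun_sum fun l (_ : l ∈ Finset.univ) =>
      (hR k l).smul_const (single k l (1 : ℝ))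
  simpa [smul_single, ← matrix_eq_sum_single] using hsum

lemma hasDerivWithinAt_dotProduct_mulVec {ι : Type*} [Fintype ι] {R : ℝ → Matrix ι ι ℝ}
    {R' : Matrix ι ι ℝ} {S : Set ℝ} {s : ℝ} (hR : HasDerivWithinAt R R' S s) (y : ι → ℝ) :
    HasDerivWithinAt (fun t => y ⬝ᵥ (R t *ᵥ y)) (y ⬝ᵥ (R' *ᵥ y)) S s := by
  classical
  exact ((dotProductBilin ℝ ℝ y ∘ₗ (mulVecBilin ℝ ℝ).flip y).toContinuousLinearMap.hasFDerivAt
    |>.comp_hasDerivWithinAt s hR :)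

variable {ι : Type*} [DecidableEq ι]

/-- `diag(A)` for matrices indexed by an arbitrary finite type, of which the configurations of
points need more than `Fin n`. -/
def diagonalPart (A : Matrix ι ι ℝ) : Matrix ι ι ℝ := diagonal A.diag

lemma hasDerivWithinAt_diagonalPart [Finite ι] {R : ℝ → Matrix ι ι ℝ} {R' : Matrix ι ι ℝ}
    {S : Set ℝ} {s : ℝ} (hR : HasDerivWithinAt R R' S s) :
    HasDerivWithinAt (fun t => diagonalPart (R t)) (diagonalPart R') S s := by
  cases nonempty_fintype ι
  exact ((diagonalLinearMap ι ℝ ℝ ∘ₗ diagLinearMap ι ℝ ℝ).toContinuousLinearMap.hasFDerivAt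
    |>.comp_hasDerivWithinAt s hR :)

variable [Fintype ι]

/-- `gradOf R⁻¹ D` is the matrix of half the derivative of the cross validation criterion, when `D`
is the derivative of the covariance matrix `R`. -/
def gradOf (A D : Matrix ι ι ℝ) : Matrix ι ι ℝ :=
  A * (diagonalPart A)⁻¹ ^ 2 * (diagonalPart (A * D * A) * (diagonalPart A)⁻¹ - A * D) * A

/-- `hessOf R⁻¹ R' D D'` is the derivative of `gradOf R⁻¹ D`. In it, `-P`, `S`, `B'` and `C'` are
the derivatives of `A = R⁻¹`, of `Q = A * D * A`, of `B = diag(A)⁻¹` and of `B ^ 2`. -/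
def hessOf (A R' D D' : Matrix ι ι ℝ) : Matrix ι ι ℝ :=
  let B := (diagonalPart A)⁻¹
  let P := A * R' * A
  let Q := A * D * A
  let S := A * D' * A - P * D * A - A * D * P
  let B' := B * diagonalPart P * B
  let C' := B' * B + B * B'
  A * (C' * diagonalPart Q * B + B ^ 2 * diagonalPart S * B + B ^ 2 * diagonalPart Q * B') * A
    - P * (B ^ 2 * diagonalPart Q * B) * A - A * (B ^ 2 * diagonalPart Q * B) * P
    - A * C' * Q - A * B ^ 2 * S + P * B ^ 2 * Q

/-- `M_{CV,1}^{i,j}` for the covariance matrix `R` with derivatives `Di` and `Dj`. -/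
def covGradOf (R Di Dj : Matrix ι ι ℝ) : Matrix ι ι ℝ :=
  (2 : ℝ) • ((gradOf R⁻¹ Di + (gradOf R⁻¹ Di)ᵀ) * R * (gradOf R⁻¹ Dj + (gradOf R⁻¹ Dj)ᵀ) * R)

/-- `M_{CV,2}^{i,j}` for the inverse covariance matrix `A` and the derivatives `Di` and `Dj` of the
covariance matrix. -/
def meanHessOf (A Di Dj : Matrix ι ι ℝ) : Matrix ι ι ℝ :=
  (-8 : ℝ) • ((diagonalPart A)⁻¹ ^ 3 * diagonalPart (A * Di * A) * A * Dj * A)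
    + (2 : ℝ) • ((diagonalPart A)⁻¹ ^ 2 * A * Di * A * Dj * A)
    + (6 : ℝ) • ((diagonalPart A)⁻¹ ^ 4 * diagonalPart (A * Di * A) * diagonalPart (A * Dj * A) * A)

lemma inv_diagonalPart {A : Matrix ι ι ℝ} (hA : ∀ k, A k k ≠ 0) :
    (diagonalPart A)⁻¹ = diagonal fun k => (A k k)⁻¹ := by
  refine inv_eq_right_inv ?_
  rw [diagonalPart, diagonal_mul_diagonal, ← diagonal_one]
  congr 1 with k
  exact mul_inv_cancel₀ (hA k)

lemma isUnit_diagonalPart {A : Matrix ι ι ℝ} (hA : ∀ k, A k k ≠ 0) : IsUnit (diagonalPart A) := by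
  rw [diagonalPart, isUnit_diagonal, Pi.isUnit_iff]
  exact fun k => (hA k).isUnit

section Derivatives

variable {R D : ℝ → Matrix ι ι ℝ} {R' D' : Matrix ι ι ℝ} {S : Set ℝ} {s : ℝ}

lemma hasDerivWithinAt_inv (hR : HasDerivWithinAt R R' S s) (hu : IsUnit (R s)) :
    HasDerivWithinAt (fun t => (R t)⁻¹) (-((R s)⁻¹ * R' * (R s)⁻¹)) S s := by
  have := FiniteDimensional.complete ℝ (Matrix ι ι ℝ)
  obtain ⟨u, hu⟩ := hu
  have hinv := hasFDerivAt_ringInverse (𝕜 := ℝ) u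
  rw [hu] at hinv
  simp only [nonsing_inv_eq_ringInverse]
  refine (hinv.comp_hasDerivWithinAt s hR).congr_deriv ?_
  rw [← hu, Ring.inverse_unit]
  rfl

lemma hasDerivWithinAt_inv_diagonalPart_inv (hR : HasDerivWithinAt R R' S s) (hu : IsUnit (R s))
    (hd : ∀ k, (R s)⁻¹ k k ≠ 0) :
    HasDerivWithinAt (fun t => (diagonalPart (R t)⁻¹)⁻¹) ((diagonalPart (R s)⁻¹)⁻¹
      * diagonalPart ((R s)⁻¹ * R' * (R s)⁻¹) * (diagonalPart (R s)⁻¹)⁻¹) S s := by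
  have hneg (A : Matrix ι ι ℝ) : diagonalPart (-A) = -diagonalPart A := by simp [diagonalPart]
  have hdiag := hasDerivWithinAt_diagonalPart (hasDerivWithinAt_inv hR hu)
  refine (hasDerivWithinAt_inv hdiag (isUnit_diagonalPart hd)).congr_deriv ?_
  rw [hneg, mul_neg, neg_mul, neg_neg]

lemma hasDerivWithinAt_gradOf (hR : HasDerivWithinAt R R' S s) (hD : HasDerivWithinAt D D' S s)
    (hu : IsUnit (R s)) (hd : ∀ k, (R s)⁻¹ k k ≠ 0) :
    HasDerivWithinAt (fun t => gradOf (R t)⁻¹ (D t)) (hessOf (R s)⁻¹ R' (D s) D') S s := by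
  have hA := hasDerivWithinAt_inv hR hu
  have hB := hasDerivWithinAt_inv_diagonalPart_inv hR hu hd
  have hQ := (hA.mul hD).mul hA
  simp only [gradOf, sq]
  refine (((hA.mul (hB.mul hB)).mul (((hasDerivWithinAt_diagonalPart hQ).mul hB).sub
    (hA.mul hD))).mul hA).congr_deriv ?_
  have hS : (-((R s)⁻¹ * R' * (R s)⁻¹) * D s + (R s)⁻¹ * D') * (R s)⁻¹
      + (R s)⁻¹ * D s * -((R s)⁻¹ * R' * (R s)⁻¹)
      = (R s)⁻¹ * D' * (R s)⁻¹ - (R s)⁻¹ * R' * (R s)⁻¹ * D s * (R s)⁻¹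
        - (R s)⁻¹ * D s * ((R s)⁻¹ * R' * (R s)⁻¹) := by noncomm_ring
  simp only [Pi.mul_apply, Pi.sub_apply, hS, hessOf]
  noncomm_ring

lemma hasDerivWithinAt_criterion (hR : HasDerivWithinAt R R' S s) (hu : IsUnit (R s))
    (hd : ∀ k, (R s)⁻¹ k k ≠ 0) (hRs : (R s)ᵀ = R s) (hR's : R'ᵀ = R') :
    HasDerivWithinAt (fun t => (R t)⁻¹ * (diagonalPart (R t)⁻¹)⁻¹ ^ 2 * (R t)⁻¹)
      (gradOf (R s)⁻¹ R' + (gradOf (R s)⁻¹ R')ᵀ) S s := by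
  have hA := hasDerivWithinAt_inv hR hu
  have hB := hasDerivWithinAt_inv_diagonalPart_inv hR hu hd
  simp only [sq]
  refine ((hA.mul (hB.mul hB)).mul hA).congr_deriv ?_
  have hdiag (Z : Matrix ι ι ℝ) : (diagonalPart Z)ᵀ = diagonalPart Z := diagonal_transpose _
  simp only [Pi.mul_apply, gradOf, transpose_mul, transpose_sub, transpose_nonsing_inv, hRs,
    hR's, hdiag, sq]
  noncomm_ring

end Derivatives

section Traces

variable {R A Di Dj Dij : Matrix ι ι ℝ}

lemma trace_mul_diagonal_mul (X Y : Matrix ι ι ℝ) (w : ι → ℝ) :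
    (X * diagonal w * Y).trace = ∑ k, w k * (Y * X) k k := by
  rw [mul_assoc, trace_mul_comm, mul_assoc]
  simp [trace, diagonal_mul]

lemma hessOf_mul_of_mul_eq_one (hAR : A * R = 1) :
    hessOf A Di Dj Dij * R =
      let B := (diagonalPart A)⁻¹
      let P := A * Di * A
      let Q := A * Dj * A
      let S := A * Dij * A - P * Dj * A - A * Dj * P
      let B' := B * diagonalPart P * B
      let C' := B' * B + B * B'
      A * (C' * diagonalPart Q * B + B ^ 2 * diagonalPart S * B + B ^ 2 * diagonalPart Q * B')
        - P * (B ^ 2 * diagonalPart Q * B) - A * (B ^ 2 * diagonalPart Q * B) * (A * Di)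
        - A * C' * (A * Dj) - A * B ^ 2 * (A * Dij - P * Dj - A * Dj * (A * Di))
        + P * B ^ 2 * (A * Dj) := by
  have hcancel (X : Matrix ι ι ℝ) : X * (A * R) = X := by rw [hAR, mul_one]
  simp only [hessOf, add_mul, sub_mul, mul_sub, mul_assoc, hcancel]

lemma trace_hessOf_mul (hAR : A * R = 1) (hd : ∀ k, A k k ≠ 0) :
    (hessOf A Di Dj Dij * R).trace = ∑ k, ((A k k)⁻¹ ^ 2 * (A * Dj * A * Di * A) k k
      - (A k k)⁻¹ ^ 3 * (A * Di * A) k k * (A * Dj * A) k k) := by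
  rw [hessOf_mul_of_mul_eq_one hAR]
  simp only [inv_diagonalPart hd]
  simp only [diagonalPart, diagonal_pow, diagonal_mul_diagonal, diagonal_add, trace_add, trace_sub]
  have htrace (X : Matrix ι ι ℝ) (w : ι → ℝ) : (X * diagonal w).trace = ∑ k, w k * X k k := by
    simpa using trace_mul_diagonal_mul X 1 w
  simp only [htrace, trace_mul_diagonal_mul, ← Finset.sum_add_distrib, ← Finset.sum_sub_distrib]
  refine Finset.sum_congr rfl fun k _ => ?_
  simp only [Pi.pow_apply, diag_apply, sub_mul, Matrix.sub_apply, mul_assoc]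
  field_simp [hd k]
  ring

lemma trace_meanHessOf (hd : ∀ k, A k k ≠ 0) :
    (meanHessOf A Di Dj).trace = 2 * ∑ k, ((A k k)⁻¹ ^ 2 * (A * Di * A * Dj * A) k k
      - (A k k)⁻¹ ^ 3 * (A * Di * A) k k * (A * Dj * A) k k) := by
  have htrace (w : ι → ℝ) (X : Matrix ι ι ℝ) : (diagonal w * X).trace = ∑ k, w k * X k k := by
    simpa using trace_mul_diagonal_mul 1 X w
  simp only [meanHessOf, inv_diagonalPart hd]
  simp only [diagonalPart, diagonal_pow, diagonal_mul_diagonal, trace_add, trace_smul, mul_assoc,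
    htrace, smul_eq_mul, Finset.mul_sum, ← Finset.sum_add_distrib]
  refine Finset.sum_congr rfl fun k _ => ?_
  simp only [Pi.pow_apply, diag_apply]
  field_simp [hd k]
  ring

lemma two_mul_trace_hessOf_mul (hR : Rᵀ = R) (hi : Diᵀ = Di) (hj : Djᵀ = Dj) (hu : IsUnit R)
    (hd : ∀ k, R⁻¹ k k ≠ 0) :
    2 * (hessOf R⁻¹ Di Dj Dij * R).trace = (meanHessOf R⁻¹ Di Dj).trace := by
  have hsymm : R⁻¹ * Di * R⁻¹ * Dj * R⁻¹ = (R⁻¹ * Dj * R⁻¹ * Di * R⁻¹)ᵀ := by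
    simp only [transpose_mul, transpose_nonsing_inv, hR, hi, hj, mul_assoc]
  rw [trace_hessOf_mul (nonsing_inv_mul _ ((isUnit_iff_isUnit_det R).1 hu)) hd,
    trace_meanHessOf hd, hsymm]
  rfl

end Traces

end MatrixCalculus

section GaussianMoments

open Matrix

lemma iteratedDeriv_succ_id_mul_zero {g : ℝ → ℝ} (n : ℕ) (hg : ContDiff ℝ (n + 1 : ℕ) g) :
    iteratedDeriv (n + 1) (fun t => t * g t) 0 = (n + 1) * iteratedDeriv n g 0 := by
  rw [iteratedDeriv_fun_mul contDiffAt_fun_id hg.contDiffAt]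
  rw [Finset.sum_eq_single 1 (fun i _ hi => by simp [iteratedDeriv_fun_id_zero, hi]) (by simp)]
  simp

lemma integral_pow_add_two_gaussianReal (v : NNReal) (n : ℕ) :
    ∫ x, x ^ (n + 2) ∂(gaussianReal 0 v) = (n + 1) * v * ∫ x, x ^ n ∂(gaussianReal 0 v) := by
  have hmoment (m : ℕ) : ∫ x, x ^ m ∂(gaussianReal 0 v)
      = iteratedDeriv m (fun t : ℝ => Real.exp (v * t ^ 2 / 2)) 0 := by
    have h := iteratedDeriv_mgf_zero (X := id) (μ := gaussianReal 0 v)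
      (by simp [integrableExpSet_id_gaussianReal]) m
    simpa [mgf_id_gaussianReal] using h.symm
  have hderiv : deriv (fun t : ℝ => Real.exp (v * t ^ 2 / 2))
      = fun t => v * (t * Real.exp (v * t ^ 2 / 2)) := by
    ext t
    have h := ((((hasDerivAt_id t).pow 2).const_mul (v : ℝ)).div_const 2).exp.deriv
    simp only [Pi.pow_apply, id] at h
    rw [h]
    simp
    ring
  rw [hmoment, hmoment, iteratedDeriv_succ', hderiv, iteratedDeriv_const_mul_field,
    iteratedDeriv_succ_id_mul_zero n (by fun_prop)]
  ring

variable {Ω T : Type*} [MeasurableSpace Ω] {μ : Measure Ω}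

lemma integral_pow_four_of_hasGaussianLaw {Z : Ω → ℝ} (hZ : HasGaussianLaw Z μ)
    (h0 : μ[Z] = 0) : ∫ ω, Z ω ^ 4 ∂μ = 3 * Var[Z; μ] ^ 2 := by
  have hlaw := hZ.map_eq_gaussianReal
  rw [h0] at hlaw
  rw [← integral_map (f := fun x : ℝ => x ^ 4) hZ.aemeasurable (by fun_prop), hlaw,
    integral_pow_add_two_gaussianReal, integral_pow_add_two_gaussianReal,
    Real.coe_toNNReal _ (variance_nonneg _ _)]
  simp
  ring

lemma holderTriple_four_four_two : ENNReal.HolderTriple 4 4 2 := ⟨by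
  rw [show (4 : ENNReal) = 2 * 2 by norm_num, ENNReal.mul_inv (by simp) (by simp), ← mul_add,
    ENNReal.inv_two_add_inv_two, mul_one]⟩

/-- `Y` is a centered Gaussian process on `(Ω, μ)` with covariance function `κ`. A matrix serves as
covariance function when the index set is finite. -/
structure IsCenteredGaussianProcess (Y : T → Ω → ℝ) (κ : T → T → ℝ) (μ : Measure Ω) : Prop where
  isGaussianProcess : IsGaussianProcess Y μ
  integral_eq_zero : ∀ t, μ[Y t] = 0
  covariance_eq : ∀ s t, cov[Y s, Y t; μ] = κ s t

namespace IsCenteredGaussianProcess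

variable {Y : T → Ω → ℝ} {κ : T → T → ℝ}

lemma comp_right (hY : IsCenteredGaussianProcess Y κ μ) {S : Type*} (f : S → T) :
    IsCenteredGaussianProcess (fun s => Y (f s)) (fun s s' => κ (f s) (f s')) μ :=
  ⟨hY.isGaussianProcess.comp_right f, fun s => hY.integral_eq_zero (f s),
    fun s s' => hY.covariance_eq (f s) (f s')⟩

lemma memLp (hY : IsCenteredGaussianProcess Y κ μ) (t : T) {q : ENNReal} (hq : q ≠ ⊤) :
    MemLp (Y t) q μ :=
  (hY.isGaussianProcess.hasGaussianLaw_eval t).memLp hq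

lemma integral_mul (hY : IsCenteredGaussianProcess Y κ μ) (s t : T) :
    ∫ ω, Y s ω * Y t ω ∂μ = κ s t := by
  rw [← hY.covariance_eq, covariance]
  simp [hY.integral_eq_zero]

lemma symm (hY : IsCenteredGaussianProcess Y κ μ) (s t : T) : κ s t = κ t s := by
  rw [← hY.covariance_eq, ← hY.covariance_eq, covariance_comm]

lemma integral_linearCombination_pow_four {ι : Type*} [Fintype ι] {W : ι → Ω → ℝ} {κ : ι → ι → ℝ}
    (hW : IsCenteredGaussianProcess W κ μ) (a : ι → ℝ) :
    ∫ ω, (∑ i, a i * W i ω) ^ 4 ∂μ = 3 * (∑ i, ∑ j, a i * a j * κ i j) ^ 2 := by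
  have hlaw : HasGaussianLaw (fun ω => ∑ i, a i * W i ω) μ :=
    (hW.isGaussianProcess.smul a).hasGaussianLaw_fun_sum (I := Finset.univ)
  have := hlaw.isProbabilityMeasure
  have hmemLp (i : ι) : MemLp (fun ω => a i * W i ω) 2 μ :=
    (hW.memLp i ENNReal.ofNat_ne_top).const_mul _
  have hmean : ∫ ω, ∑ i, a i * W i ω ∂μ = 0 := by
    rw [integral_finsetSum _ fun i _ => (hmemLp i).integrable one_le_two]
    simp [integral_const_mul, hW.integral_eq_zero]
  rw [integral_pow_four_of_hasGaussianLaw hlaw hmean, ← covariance_self hlaw.aemeasurable,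
    covariance_fun_sum_fun_sum hmemLp hmemLp]
  simp only [covariance_const_mul_left, covariance_const_mul_right, hW.covariance_eq, mul_assoc,
    mul_left_comm]

lemma integrable_linearCombination_pow_four {ι : Type*} [Fintype ι] {W : ι → Ω → ℝ}
    {κ : ι → ι → ℝ} (hW : IsCenteredGaussianProcess W κ μ) (a : ι → ℝ) :
    Integrable (fun ω => (∑ i, a i * W i ω) ^ 4) μ := by
  have hmem : MemLp (fun ω => ∑ i, a i * W i ω) (4 : ℕ) μ :=
    memLp_finsetSum _ fun i _ => (hW.memLp i (by simp)).const_mul _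
  refine (hmem.integrable_norm_pow (by norm_num)).congr (.of_forall fun ω => ?_)
  exact Even.pow_abs (by decide) _

/-- Isserlis' formula, obtained from the fourth moments of linear combinations by polarization. -/
lemma integral_mul_four (hY : IsCenteredGaussianProcess Y κ μ) (t : Fin 4 → T) :
    ∫ ω, Y (t 0) ω * Y (t 1) ω * Y (t 2) ω * Y (t 3) ω ∂μ = κ (t 0) (t 1) * κ (t 2) (t 3)
      + κ (t 0) (t 2) * κ (t 1) (t 3) + κ (t 0) (t 3) * κ (t 1) (t 2) := by
  have hW := hY.comp_right t
  let sign : Fin 2 → ℝ := ![1, -1]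
  let coeff (q : Fin 2 × Fin 2 × Fin 2) : ℝ := sign q.1 * sign q.2.1 * sign q.2.2 / 192
  let a (q : Fin 2 × Fin 2 × Fin 2) : Fin 4 → ℝ := ![1, sign q.1, sign q.2.1, sign q.2.2]
  have polarization (w : Fin 4 → ℝ) :
      w 0 * w 1 * w 2 * w 3 = ∑ q, coeff q * (∑ i, a q i * w i) ^ 4 := by
    simp only [Fintype.sum_prod_type, Fin.sum_univ_two, Fin.sum_univ_four, a, coeff, sign,
      Matrix.cons_val]
    ring
  rw [integral_congr_ae (.of_forall fun ω => polarization fun i => Y (t i) ω)]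
  rw [integral_finsetSum _ fun q _ => (hW.integrable_linearCombination_pow_four (a q)).const_mul _]
  simp only [integral_const_mul, hW.integral_linearCombination_pow_four]
  simp only [Fintype.sum_prod_type, Fin.sum_univ_two, Fin.sum_univ_four, a, coeff, sign,
    Matrix.cons_val]
  rw [hY.symm (t 1) (t 0), hY.symm (t 2) (t 0), hY.symm (t 3) (t 0), hY.symm (t 2) (t 1),
    hY.symm (t 3) (t 1), hY.symm (t 3) (t 2)]
  ring

lemma memLp_mul (hY : IsCenteredGaussianProcess Y κ μ) (s t : T) :
    MemLp (fun ω => Y s ω * Y t ω) 2 μ :=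
  have := holderTriple_four_four_two
  (hY.memLp t (q := 4) ENNReal.ofNat_ne_top).mul' (hY.memLp s (q := 4) ENNReal.ofNat_ne_top)

lemma covariance_mul_mul (hY : IsCenteredGaussianProcess Y κ μ) (s t s' t' : T) :
    cov[fun ω => Y s ω * Y t ω, fun ω => Y s' ω * Y t' ω; μ]
      = κ s s' * κ t t' + κ s t' * κ t s' := by
  have := hY.isGaussianProcess.isProbabilityMeasure
  have hfour := hY.integral_mul_four ![s, t, s', t']
  simp only [Matrix.cons_val, mul_assoc] at hfour
  rw [covariance_eq_sub (hY.memLp_mul s t) (hY.memLp_mul s' t'), hY.integral_mul, hY.integral_mul]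
  simp only [Pi.mul_apply, mul_assoc, hfour]
  ring

end IsCenteredGaussianProcess

section QuadraticForms

variable {ι : Type*} [Fintype ι]

lemma dotProduct_mulVec_eq_sum (M : Matrix ι ι ℝ) (y : ι → ℝ) :
    y ⬝ᵥ (M *ᵥ y) = ∑ q : ι × ι, M q.1 q.2 * (y q.1 * y q.2) := by
  simp only [dotProduct, mulVec, Finset.mul_sum, Fintype.sum_prod_type, mul_left_comm]

lemma sum_mul_mul_eq_trace (M N : Matrix ι ι ℝ) {R : Matrix ι ι ℝ} (hR : Rᵀ = R) :
    ∑ q : ι × ι, ∑ r : ι × ι, N r.1 r.2 * (M q.1 q.2 * (R q.1 r.1 * R q.2 r.2))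
      = (M * R * Nᵀ * R).trace := by
  simp only [Fintype.sum_prod_type, trace, diag_apply, Matrix.mul_apply, transpose_apply,
    Finset.sum_mul]
  refine Finset.sum_congr rfl fun k _ => ?_
  rw [Finset.sum_comm]
  refine Finset.sum_congr rfl fun j _ => ?_
  rw [Finset.sum_comm]
  refine Finset.sum_congr rfl fun i _ => Finset.sum_congr rfl fun l _ => ?_
  rw [show R k j = R j k from congr_fun₂ hR j k]
  ring

variable {W : ι → Ω → ℝ} {R : Matrix ι ι ℝ}

lemma IsCenteredGaussianProcess.integral_dotProduct_mulVec (hW : IsCenteredGaussianProcess W R μ)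
    (M : Matrix ι ι ℝ) : ∫ ω, (W · ω) ⬝ᵥ (M *ᵥ (W · ω)) ∂μ = (M * R).trace := by
  have := hW.isGaussianProcess.isProbabilityMeasure
  simp only [dotProduct_mulVec_eq_sum]
  rw [integral_finsetSum _ fun q _ =>
    ((hW.memLp_mul q.1 q.2).integrable one_le_two).const_mul _]
  simp only [integral_const_mul, hW.integral_mul, Fintype.sum_prod_type, trace, diag_apply,
    Matrix.mul_apply, hW.symm]

lemma IsCenteredGaussianProcess.covariance_dotProduct_mulVec
    (hW : IsCenteredGaussianProcess W R μ) (M N : Matrix ι ι ℝ) :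
    cov[fun ω => (W · ω) ⬝ᵥ (M *ᵥ (W · ω)), fun ω => (W · ω) ⬝ᵥ (N *ᵥ (W · ω)); μ]
      = (M * R * Nᵀ * R).trace + (M * R * N * R).trace := by
  have := hW.isGaussianProcess.isProbabilityMeasure
  have hmemLp (M : Matrix ι ι ℝ) (q : ι × ι) :
      MemLp (fun ω => M q.1 q.2 * (W q.1 ω * W q.2 ω)) 2 μ :=
    (hW.memLp_mul q.1 q.2).const_mul _
  simp only [dotProduct_mulVec_eq_sum]
  rw [covariance_fun_sum_fun_sum (hmemLp M) (hmemLp N)]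
  simp only [covariance_const_mul_left, covariance_const_mul_right, hW.covariance_mul_mul]
  have hR : Rᵀ = R := Matrix.ext fun k l => hW.symm l k
  have hswap (q : ι × ι) :
      ∑ r : ι × ι, N r.1 r.2 * (M q.1 q.2 * (R q.1 r.2 * R q.2 r.1))
        = ∑ r : ι × ι, Nᵀ r.1 r.2 * (M q.1 q.2 * (R q.1 r.1 * R q.2 r.2)) :=
    ((Equiv.prodComm ι ι).sum_comp fun r => _).symm
  simp only [mul_add, Finset.sum_add_distrib, hswap, sum_mul_mul_eq_trace _ _ hR,
    transpose_transpose]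

end QuadraticForms

end GaussianMoments

section ConditionalMoments

open Matrix

variable {ΩX ΩY β : Type*} [MeasurableSpace ΩX] [MeasurableSpace ΩY] [mβ : MeasurableSpace β]
  {PX : Measure ΩX} {PY : Measure ΩY} [IsProbabilityMeasure PX] [IsProbabilityMeasure PY]
  {φ : ΩX → β}

lemma condExp_prod_ae_eq (hφ : Measurable φ) {W : β × ΩY → ℝ} (hWm : StronglyMeasurable W)
    (hW : Integrable (fun ω => W (φ ω.1, ω.2)) (PX.prod PY)) :
    (PX.prod PY)[fun ω => W (φ ω.1, ω.2) | mβ.comap fun ω => φ ω.1]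
      =ᵐ[PX.prod PY] fun ω => ∫ ω', W (φ ω.1, ω') ∂PY := by
  have hintegrable : Integrable (fun ω : ΩX × ΩY => ∫ ω', W (φ ω.1, ω') ∂PY) (PX.prod PY) :=
    hW.integral_prod_left.comp_fst PY
  symm
  refine ae_eq_condExp_of_forall_setIntegral_eq (hφ.comp measurable_fst).comap_le hW
    (fun s _ _ => hintegrable.integrableOn) ?_ ?_
  · rintro _ ⟨B, -, rfl⟩ -
    have hpreimage : φ ∘ (Prod.fst : ΩX × ΩY → ΩX) ⁻¹' B = (φ ⁻¹' B) ×ˢ Set.univ := by ext; simp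
    rw [hpreimage, setIntegral_prod _ hintegrable.integrableOn, setIntegral_prod _ hW.integrableOn]
    simp
  · exact (hWm.integral_prod_right'.comp_measurable
      (comap_measurable fun ω : ΩX × ΩY => φ ω.1)).aestronglyMeasurable

lemma condCov_congr {Ω : Type*} {m : MeasurableSpace Ω} {_ : MeasurableSpace Ω} {μ : Measure Ω}
    {U U' V V' : Ω → ℝ} (hU : U =ᵐ[μ] U') (hV : V =ᵐ[μ] V') :
    condCov m U V μ =ᵐ[μ] condCov m U' V' μ :=
  condExp_congr_ae ((hU.sub (condExp_congr_ae hU)).mul (hV.sub (condExp_congr_ae hV)))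

lemma condCov_const_mul {Ω : Type*} {m : MeasurableSpace Ω} {_ : MeasurableSpace Ω} {μ : Measure Ω}
    (c : ℝ) (U V : Ω → ℝ) : condCov m (c • U) (c • V) μ =ᵐ[μ] c ^ 2 • condCov m U V μ := by
  refine .trans (condExp_congr_ae ?_) (condExp_smul (c ^ 2) _ m)
  filter_upwards [condExp_smul c U m, condExp_smul c V m] with ω hU hV
  simp only [Pi.mul_apply, Pi.sub_apply, Pi.smul_apply, hU, hV, smul_eq_mul]
  ring

lemma condCov_prod_ae_eq (hφ : Measurable φ) {U V : β × ΩY → ℝ}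
    (hUm : StronglyMeasurable U) (hVm : StronglyMeasurable V)
    (hU : MemLp (fun ω => U (φ ω.1, ω.2)) 2 (PX.prod PY))
    (hV : MemLp (fun ω => V (φ ω.1, ω.2)) 2 (PX.prod PY)) :
    condCov (mβ.comap fun ω => φ ω.1) (fun ω => U (φ ω.1, ω.2)) (fun ω => V (φ ω.1, ω.2))
        (PX.prod PY) =ᵐ[PX.prod PY] fun ω =>
      cov[fun ω' => U (φ ω.1, ω'), fun ω' => V (φ ω.1, ω'); PY] := by
  have hU' := condExp_prod_ae_eq hφ hUm (hU.integrable one_le_two)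
  have hV' := condExp_prod_ae_eq hφ hVm (hV.integrable one_le_two)
  have hUc := (memLp_congr_ae hU').1 (hU.condExp one_le_two)
  have hVc := (memLp_congr_ae hV').1 (hV.condExp one_le_two)
  refine (condExp_congr_ae ((EventuallyEq.rfl.sub hU').mul (EventuallyEq.rfl.sub hV'))).trans ?_
  exact condExp_prod_ae_eq hφ
    (W := fun q => (U q - ∫ ω', U (q.1, ω') ∂PY) * (V q - ∫ ω', V (q.1, ω') ∂PY))
    ((hUm.sub (hUm.integral_prod_right'.comp_measurable measurable_fst)).mul
      (hVm.sub (hVm.integral_prod_right'.comp_measurable measurable_fst)))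
    ((hU.sub hUc).integrable_mul (hV.sub hVc))

section RandomQuadraticForms

variable {T ι : Type*} [MeasurableSpace T] [Fintype ι] {τ : β → ι → T} {Y : T → ΩY → ℝ}
  {κ : T → T → ℝ} {M N : β → Matrix ι ι ℝ}

/-- The quadratic form with matrix `M b` of the values of the process `Y` at the points `τ b`, both
of which depend on a parameter `b` that will be random and independent of `Y`. -/
def randomQuad (τ : β → ι → T) (Y : T → ΩY → ℝ) (M : β → Matrix ι ι ℝ) (q : β × ΩY) : ℝ :=
  (fun k => Y (τ q.1 k) q.2) ⬝ᵥ (M q.1 *ᵥ fun k => Y (τ q.1 k) q.2)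

/-- The random matrix `M` has measurable entries, which are bounded almost surely when its parameter
has the law `ρ`. -/
structure IsEssBounded (M : β → Matrix ι ι ℝ) (ρ : Measure β) : Prop where
  measurable : ∀ k l, Measurable fun b => M b k l
  exists_ae_le : ∃ C : ℝ, ∀ᵐ b ∂ρ, ∀ k l, |M b k l| ≤ C

lemma measurable_randomQuad (hτ : ∀ k, Measurable fun b => τ b k)
    (hYm : Measurable (Function.uncurry Y)) (hM : ∀ k l, Measurable fun b => M b k l) :
    Measurable (randomQuad τ Y M) := by
  have hobs (k : ι) : Measurable fun q : β × ΩY => Y (τ q.1 k) q.2 :=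
    hYm.comp (((hτ k).comp measurable_fst).prodMk measurable_snd)
  unfold randomQuad
  simp only [dotProduct_mulVec_eq_sum]
  exact Finset.measurable_fun_sum _ fun r _ =>
    ((hM r.1 r.2).comp measurable_fst).mul ((hobs r.1).mul (hobs r.2))

/-- All the values of a centered Gaussian process with constant variance have the same law, which
is hence also the law of its value at an independent random point. -/
lemma IsCenteredGaussianProcess.memLp_comp (hY : IsCenteredGaussianProcess Y κ PY)
    (hYm : Measurable (Function.uncurry Y)) {c : ℝ} (hκ : ∀ t, κ t t = c) {σ : ΩX → T}
    (hσ : Measurable σ) {q : ENNReal} (hq : q ≠ ⊤) :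
    MemLp (fun ω : ΩX × ΩY => Y (σ ω.1) ω.2) q (PX.prod PY) := by
  have hm : Measurable fun ω : ΩX × ΩY => Y (σ ω.1) ω.2 :=
    hYm.comp ((hσ.comp measurable_fst).prodMk measurable_snd)
  have hlaw (t : T) : PY.map (Y t) = gaussianReal 0 c.toNNReal := by
    rw [(hY.isGaussianProcess.hasGaussianLaw_eval t).map_eq_gaussianReal, hY.integral_eq_zero,
      ← covariance_self (hY.isGaussianProcess.aemeasurable t), hY.covariance_eq, hκ]
  have hmap : (PX.prod PY).map (fun ω => Y (σ ω.1) ω.2) = gaussianReal 0 c.toNNReal := by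
    ext B hB
    have hsection (ω : ΩX) :
        PY (Prod.mk ω ⁻¹' ((fun ω : ΩX × ΩY => Y (σ ω.1) ω.2) ⁻¹' B))
          = gaussianReal 0 c.toNNReal B := by
      rw [← hlaw (σ ω), Measure.map_apply hYm.of_uncurry_left hB]
      rfl
    rw [Measure.map_apply hm hB, Measure.prod_apply (hm hB)]
    simp [hsection]
  have h := memLp_id_gaussianReal' (μ := 0) (v := c.toNNReal) q hq
  rw [← hmap] at h
  exact (memLp_map_measure_iff aestronglyMeasurable_id hm.aemeasurable).1 h

variable (hφ : Measurable φ) (hτ : ∀ k, Measurable fun b => τ b k)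
  (hYm : Measurable (Function.uncurry Y)) (hY : IsCenteredGaussianProcess Y κ PY)
  {c : ℝ} (hκ : ∀ t, κ t t = c)

include hφ hτ hYm hY hκ

lemma memLp_randomQuad (hM : IsEssBounded M (PX.map φ)) :
    MemLp (fun ω => randomQuad τ Y M (φ ω.1, ω.2)) 2 (PX.prod PY) := by
  have := holderTriple_four_four_two
  obtain ⟨C, hC⟩ := hM.exists_ae_le
  have hobs (k : ι) : MemLp (fun ω : ΩX × ΩY => Y (τ (φ ω.1) k) ω.2) 4 (PX.prod PY) :=
    hY.memLp_comp hYm hκ ((hτ k).comp hφ) ENNReal.ofNat_ne_top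
  have hentry (k l : ι) : MemLp (fun ω : ΩX × ΩY => M (φ ω.1) k l) ⊤ (PX.prod PY) := by
    refine memLp_top_of_bound
      ((hM.measurable k l).comp (hφ.comp measurable_fst)).aestronglyMeasurable C ?_
    filter_upwards [Measure.quasiMeasurePreserving_fst.ae (ae_of_ae_map hφ.aemeasurable hC)]
      with ω hω using hω k l
  have hprod (k l : ι) : MemLp (fun ω : ΩX × ΩY => Y (τ (φ ω.1) k) ω.2 * Y (τ (φ ω.1) l) ω.2) 2
      (PX.prod PY) := (hobs l).mul' (hobs k)
  unfold randomQuad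
  simp only [dotProduct_mulVec_eq_sum]
  exact memLp_finsetSum _ fun r _ => (hprod r.1 r.2).mul' (hentry r.1 r.2)

lemma condExp_randomQuad (hM : IsEssBounded M (PX.map φ)) :
    (PX.prod PY)[fun ω => randomQuad τ Y M (φ ω.1, ω.2) | mβ.comap fun ω => φ ω.1]
      =ᵐ[PX.prod PY] fun ω =>
        (M (φ ω.1) * Matrix.of fun k l => κ (τ (φ ω.1) k) (τ (φ ω.1) l)).trace := by
  refine (condExp_prod_ae_eq hφ (measurable_randomQuad hτ hYm hM.measurable).stronglyMeasurable
    ((memLp_randomQuad hφ hτ hYm hY hκ hM).integrable one_le_two)).trans (.of_forall fun ω => ?_)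
  exact (hY.comp_right (τ (φ ω.1))).integral_dotProduct_mulVec (M (φ ω.1))

lemma condCov_randomQuad (hM : IsEssBounded M (PX.map φ)) (hN : IsEssBounded N (PX.map φ)) :
    condCov (mβ.comap fun ω => φ ω.1) (fun ω => randomQuad τ Y M (φ ω.1, ω.2))
        (fun ω => randomQuad τ Y N (φ ω.1, ω.2)) (PX.prod PY)
      =ᵐ[PX.prod PY] fun ω =>
        let R := Matrix.of fun k l => κ (τ (φ ω.1) k) (τ (φ ω.1) l)
        (M (φ ω.1) * R * (N (φ ω.1))ᵀ * R).trace + (M (φ ω.1) * R * N (φ ω.1) * R).trace := by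
  refine (condCov_prod_ae_eq hφ (measurable_randomQuad hτ hYm hM.measurable).stronglyMeasurable
    (measurable_randomQuad hτ hYm hN.measurable).stronglyMeasurable
    (memLp_randomQuad hφ hτ hYm hY hκ hM) (memLp_randomQuad hφ hτ hYm hY hκ hN)).trans
    (.of_forall fun ω => ?_)
  exact (hY.comp_right (τ (φ ω.1))).covariance_dotProduct_mulVec (M (φ ω.1)) (N (φ ω.1))

end RandomQuadraticForms

end ConditionalMoments

section RegularFamilies

open Matrix
open scoped Matrix.Norms.L2Operator

lemma measurable_derivWithin {β : Type*} [MeasurableSpace β] {F : β → ℝ → ℝ} {S : Set ℝ} {s : ℝ}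
    (hs : s ∈ S) (hF : ∀ r ∈ S, Measurable fun b => F b r)
    (hdiff : ∀ b, DifferentiableWithinAt ℝ (F b) S s) :
    Measurable fun b => derivWithin (F b) S s := by
  by_cases hne : AccPt s (𝓟 S)
  swap
  · simp only [derivWithin_zero_of_not_accPt hne, measurable_const]
  have : (𝓝[S \ {s}] s).NeBot := accPt_principal_iff_nhdsWithin.1 hne
  obtain ⟨u, hu⟩ := exists_seq_tendsto (𝓝[S \ {s}] s)
  obtain ⟨N, hN⟩ := eventually_atTop.1 (hu.eventually self_mem_nhdsWithin)
  refine measurable_of_tendsto_metrizable (f := fun n b => slope (F b) s (u (n + N)))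
    (fun n => ?_) (tendsto_pi_nhds.2 fun b => ?_)
  · simp only [slope_def_field]
    exact ((hF _ (hN _ (Nat.le_add_left N n)).1).sub (hF s hs)).div_const _
  · exact (hasDerivWithinAt_iff_tendsto_slope.1 (hdiff b).hasDerivWithinAt).comp
      (hu.comp (tendsto_add_atTop_nat N))

variable {d p : ℕ} {a b : ℝ} {K : (Fin p → ℝ) → EuclideanSpace ℝ (Fin d) → ℝ} {θ : Fin p → ℝ}
  {ε : ℝ}

lemma update_mem_paramSet (hθ : θ ∈ paramSet a b) (i : Fin p) {s : ℝ} (hs : s ∈ Set.Icc a b) :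
    Function.update θ i s ∈ paramSet a b := fun j => by
  rcases eq_or_ne j i with rfl | hj
  · simpa using hs
  · simpa [hj] using hθ j

lemma partialDeriv_congr {F G : (Fin p → ℝ) → ℝ} (h : ∀ ϑ ∈ paramSet a b, F ϑ = G ϑ) (i : Fin p)
    (hθ : θ ∈ paramSet a b) : partialDeriv a b i F θ = partialDeriv a b i G θ :=
  derivWithin_congr (fun _ hs => h _ (update_mem_paramSet hθ i hs))
    (h _ (update_mem_paramSet hθ i (hθ i)))

lemma IsStationaryCovariance.even {k : EuclideanSpace ℝ (Fin d) → ℝ}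
    (hk : IsStationaryCovariance k) (t : EuclideanSpace ℝ (Fin d)) : k (-t) = k t := by
  simpa using (hk 2 ![t, 0]).1.apply 0 1

variable (a b K) in
/-- The matrices of the partial derivatives `∂/∂θ_{i₁} … ∂/∂θ_{i_q} K_θ`, for `I = [i₁, …, i_q]`,
between the points of a configuration. -/
def derivMatFun (I : List (Fin p)) (θ : Fin p → ℝ) (ε : ℝ) : MatFun d :=
  kernelMatFun (fun t => iterPartialDeriv a b I (fun ϑ => K ϑ t) θ) ε

namespace IsRegularFamily

variable (hK : IsRegularFamily a b K)
include hK

lemma eq_re_invFourier (hθ : θ ∈ paramSet a b) :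
    K θ = fun t => (invFourier (fourierHat (K θ)) t).re :=
  funext fun t => congrArg Complex.re (hK.fourier_inversion θ hθ t)

lemma continuous (hθ : θ ∈ paramSet a b) : Continuous (K θ) := by
  rw [hK.eq_re_invFourier hθ]
  exact Complex.continuous_re.comp (continuous_invFourier (hK.fourier_integrable θ hθ))

lemma exists_isCoerciveWith (hθ : θ ∈ paramSet a b) (hε : ε ∈ Set.Ico (0 : ℝ) (1 / 2)) :
    ∃ m > 0, ∀ c : Config d, c.Valid → IsCoerciveWith m (derivMatFun a b K [] θ ε c) := by
  have hcont : Continuous fun f => (fourierHat (K θ) f).re :=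
    hK.fourier_continuous.comp_continuous (f := fun f => (θ, f)) (by fun_prop)
      fun f => ⟨hθ, trivial⟩
  have hcoer := exists_isCoerciveWith_kernelMatFun (hK.fourier_integrable θ hθ) hcont
    (hK.fourier_pos θ hθ) hε
  rwa [← hK.eq_re_invFourier hθ] at hcoer

lemma even_iterPartialDeriv (I : List (Fin p)) (t : EuclideanSpace ℝ (Fin d)) :
    ∀ θ ∈ paramSet a b, iterPartialDeriv a b I (fun ϑ => K ϑ (-t)) θ
      = iterPartialDeriv a b I (fun ϑ => K ϑ t) θ := by
  induction I with
  | nil => exact fun θ hθ => (hK.stationary θ hθ).even t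
  | cons i I ih => exact fun θ hθ => partialDeriv_congr ih i hθ

lemma measurable_iterPartialDeriv (I : List (Fin p)) (hI : I.length ≤ 3) :
    ∀ θ ∈ paramSet a b, Measurable fun t => iterPartialDeriv a b I (fun ϑ => K ϑ t) θ := by
  induction I with
  | nil => exact fun θ hθ => (hK.continuous hθ).measurable
  | cons i I ih =>
    have hI' : I.length < 3 := Nat.lt_of_succ_le hI
    exact fun θ hθ => measurable_derivWithin (hθ i)
      (fun s hs => ih hI'.le _ (update_mem_paramSet hθ i hs)) (hK.differentiable I hI' i θ hθ)

lemma transpose_derivMatFun (I : List (Fin p)) (hθ : θ ∈ paramSet a b) :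
    (derivMatFun a b K I θ ε).transpose = derivMatFun a b K I θ ε := by
  rw [derivMatFun, transpose_kernelMatFun]
  congr 1 with t
  exact hK.even_iterPartialDeriv I t θ hθ

lemma isLocal_derivMatFun {I : List (Fin p)} (hI : I.length ≤ 3) (hθ : θ ∈ paramSet a b)
    (hε : ε ∈ Set.Ico (0 : ℝ) (1 / 2)) : (derivMatFun a b K I θ ε).IsLocal := by
  obtain ⟨C, hC⟩ := hK.decay I hI
  exact HasDecay.isLocal ⟨C, hC θ hθ⟩ (hK.measurable_iterPartialDeriv I hI θ hθ) hε

lemma isLocal_inv_derivMatFun_nil (hθ : θ ∈ paramSet a b) (hε : ε ∈ Set.Ico (0 : ℝ) (1 / 2)) :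
    (derivMatFun a b K [] θ ε)⁻¹.IsLocal := by
  obtain ⟨m, hm, hcoer⟩ := hK.exists_isCoerciveWith hθ hε
  exact (hK.isLocal_derivMatFun (I := []) (Nat.zero_le 3) hθ hε).inv hm hcoer

lemma exists_le_inv_derivMatFun_nil_apply_self (hθ : θ ∈ paramSet a b)
    (hε : ε ∈ Set.Ico (0 : ℝ) (1 / 2)) :
    ∃ m > 0, ∀ c : Config d, c.Valid → ∀ k, m ≤ (derivMatFun a b K [] θ ε c)⁻¹ k k := by
  obtain ⟨m, hm, hcoer⟩ := hK.exists_isCoerciveWith hθ hε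
  obtain ⟨C, hC0, hC⟩ := (hK.isLocal_derivMatFun (I := []) (Nat.zero_le 3) hθ hε).exists_isBoundedBy
  exact ⟨m / C ^ 2, by positivity, fun c hc k =>
    ((hcoer c hc).inv hm hC0 (hC c hc)).le_apply_self k⟩

lemma isLocal_inv_diagPart_inv_derivMatFun_nil (hθ : θ ∈ paramSet a b)
    (hε : ε ∈ Set.Ico (0 : ℝ) (1 / 2)) : ((derivMatFun a b K [] θ ε)⁻¹.diagPart)⁻¹.IsLocal := by
  obtain ⟨m, hm, hdiag⟩ := hK.exists_le_inv_derivMatFun_nil_apply_self hθ hε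
  exact (hK.isLocal_inv_derivMatFun_nil hθ hε).diagPart.inv hm fun c hc =>
    isCoerciveWith_diagonal (hdiag c hc)

end IsRegularFamily

end RegularFamilies

section LocalCriterion

lemma measurable_firstPerturbations {d : ℕ} {Ω : Type*} [MeasurableSpace Ω]
    {X : ℕ → Ω → EuclideanSpace ℝ (Fin d)} (hXm : ∀ k, Measurable (X k)) (n : ℕ) :
    Measurable (firstPerturbations X n) :=
  measurable_pi_lambda _ fun k => hXm k

namespace MatFun

variable {d : ℕ} {R A R' D D' Di Dj : MatFun d}

lemma isLocal_gradOf (hA : A.IsLocal) (hB : A.diagPart⁻¹.IsLocal) (hD : D.IsLocal) :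
    IsLocal fun c => gradOf (A c) (D c) :=
  ((hA.mul (hB.pow 2)).mul ((((hA.mul hD).mul hA).diagPart.mul hB).sub (hA.mul hD))).mul hA

lemma isLocal_hessOf (hA : A.IsLocal) (hB : A.diagPart⁻¹.IsLocal) (hR' : R'.IsLocal)
    (hD : D.IsLocal) (hD' : D'.IsLocal) :
    IsLocal fun c => hessOf (A c) (R' c) (D c) (D' c) :=
  have hB₂ := hB.pow 2
  have hP := (hA.mul hR').mul hA
  have hQ := (hA.mul hD).mul hA
  have hS := (((hA.mul hD').mul hA).sub ((hP.mul hD).mul hA)).sub ((hA.mul hD).mul hP)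
  have hB' := (hB.mul hP.diagPart).mul hB
  have hC' := (hB'.mul hB).add (hB.mul hB')
  have hBQ := hB₂.mul hQ.diagPart
  (((((((hA.mul ((((hC'.mul hQ.diagPart).mul hB).add ((hB₂.mul hS.diagPart).mul hB)).add
    (hBQ.mul hB'))).mul hA).sub ((hP.mul (hBQ.mul hB)).mul hA)).sub
    ((hA.mul (hBQ.mul hB)).mul hP)).sub ((hA.mul hC').mul hQ)).sub
    ((hA.mul hB₂).mul hS)).add ((hP.mul hB₂).mul hQ) :)

lemma isLocal_covGradOf (hR : R.IsLocal) (hA : R⁻¹.IsLocal) (hB : R⁻¹.diagPart⁻¹.IsLocal)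
    (hi : Di.IsLocal) (hj : Dj.IsLocal) : IsLocal fun c => covGradOf (R c) (Di c) (Dj c) :=
  have hGi := isLocal_gradOf hA hB hi
  have hGj := isLocal_gradOf hA hB hj
  ((((hGi.add hGi.transpose).mul hR).mul (hGj.add hGj.transpose)).mul hR).const_smul 2

lemma isLocal_meanHessOf (hA : A.IsLocal) (hB : A.diagPart⁻¹.IsLocal) (hi : Di.IsLocal)
    (hj : Dj.IsLocal) : IsLocal fun c => meanHessOf (A c) (Di c) (Dj c) :=
  have hQi := (hA.mul hi).mul hA
  have hQj := (hA.mul hj).mul hA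
  ((((((((hB.pow 3).mul hQi.diagPart).mul hA).mul hj).mul hA).const_smul (-8)).add
    (((((((hB.pow 2).mul hA).mul hi).mul hA).mul hj).mul hA).const_smul 2)).add
    (((((hB.pow 4).mul hQi.diagPart).mul hQj.diagPart).mul hA).const_smul 6) :)

variable {F : MatFun d} {v : ℕ → Fin d → ℕ} {L : Measure (EuclideanSpace ℝ (Fin d))}
  {Ω : Type*} [MeasurableSpace Ω] {P : Measure Ω} {X : ℕ → Ω → EuclideanSpace ℝ (Fin d)}

lemma IsLocal.isEssBounded (hF : F.IsLocal) (hv : Function.Injective (intGrid v))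
    (hL : ∀ᵐ t ∂L, t ∈ unitCube d) (hXm : ∀ k, Measurable (X k)) (hXL : ∀ k, P.map (X k) = L)
    (n : ℕ) :
    IsEssBounded (F.onGrid v n) (P.map (firstPerturbations X n)) where
  measurable := hF.measurable (Fin n) fun k => intGrid v k
  exists_ae_le := by
    obtain ⟨C, -, hC⟩ := hF.exists_isBoundedBy
    have hlaw : ∀ᵐ x ∂P.map (firstPerturbations X n), ∀ k, x k ∈ unitCube d := by
      refine ae_all_iff.2 fun k => ?_
      refine ae_of_ae_map (μ := P.map (firstPerturbations X n))
        (measurable_pi_apply k).aemeasurable ?_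
      rw [Measure.map_map (measurable_pi_apply k)
        (measurable_firstPerturbations hXm n)]
      exact (hXL k).symm ▸ hL
    refine ⟨C, hlaw.mono fun x hx k l => ?_⟩
    exact (abs_apply_le_norm _ k l).trans (hC _ (valid_gridConfig hv hx))

end MatFun

end LocalCriterion

section CriterionDerivatives

open Matrix
open scoped Matrix.Norms.L2Operator

variable {d p : ℕ} (a b : ℝ) (K : (Fin p → ℝ) → EuclideanSpace ℝ (Fin d) → ℝ)

/-- The matrix `M^i_θ`, at all the configurations. -/
def gradMatFun (i : Fin p) (θ : Fin p → ℝ) (ε : ℝ) : MatFun d := fun c =>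
  gradOf (derivMatFun a b K [] θ ε c)⁻¹ (derivMatFun a b K [i] θ ε c)

/-- The partial derivative `∂M^j_θ/∂θ_i`, at all the configurations. -/
def hessMatFun (i j : Fin p) (θ : Fin p → ℝ) (ε : ℝ) : MatFun d := fun c =>
  hessOf (derivMatFun a b K [] θ ε c)⁻¹ (derivMatFun a b K [i] θ ε c) (derivMatFun a b K [j] θ ε c)
    (derivMatFun a b K [i, j] θ ε c)

/-- The matrix `M_{CV,1}^{i,j}` at the parameter `θ`, at all the configurations. -/
def covGradMatFun (i j : Fin p) (θ : Fin p → ℝ) (ε : ℝ) : MatFun d := fun c =>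
  covGradOf (derivMatFun a b K [] θ ε c) (derivMatFun a b K [i] θ ε c) (derivMatFun a b K [j] θ ε c)

/-- The matrix `M_{CV,2}^{i,j}` at the parameter `θ`, at all the configurations. -/
def meanHessMatFun (i j : Fin p) (θ : Fin p → ℝ) (ε : ℝ) : MatFun d := fun c =>
  meanHessOf (derivMatFun a b K [] θ ε c)⁻¹ (derivMatFun a b K [i] θ ε c)
    (derivMatFun a b K [j] θ ε c)

namespace IsRegularFamily

variable {a b K} {θ : Fin p → ℝ} {ε : ℝ}

section Locality

variable (hK : IsRegularFamily a b K) (hθ : θ ∈ paramSet a b) (hε : ε ∈ Set.Ico (0 : ℝ) (1 / 2))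
include hK hθ hε

lemma isLocal_gradMatFun (i : Fin p) : (gradMatFun a b K i θ ε).IsLocal :=
  MatFun.isLocal_gradOf (hK.isLocal_inv_derivMatFun_nil hθ hε)
    (hK.isLocal_inv_diagPart_inv_derivMatFun_nil hθ hε)
    (hK.isLocal_derivMatFun (by simp) hθ hε)

lemma isLocal_hessMatFun (i j : Fin p) : (hessMatFun a b K i j θ ε).IsLocal :=
  MatFun.isLocal_hessOf (hK.isLocal_inv_derivMatFun_nil hθ hε)
    (hK.isLocal_inv_diagPart_inv_derivMatFun_nil hθ hε)
    (hK.isLocal_derivMatFun (by simp) hθ hε) (hK.isLocal_derivMatFun (by simp) hθ hε)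
    (hK.isLocal_derivMatFun (by simp) hθ hε)

lemma isLocal_covGradMatFun (i j : Fin p) : (covGradMatFun a b K i j θ ε).IsLocal :=
  MatFun.isLocal_covGradOf (hK.isLocal_derivMatFun (by simp) hθ hε)
    (hK.isLocal_inv_derivMatFun_nil hθ hε) (hK.isLocal_inv_diagPart_inv_derivMatFun_nil hθ hε)
    (hK.isLocal_derivMatFun (by simp) hθ hε) (hK.isLocal_derivMatFun (by simp) hθ hε)

lemma isLocal_meanHessMatFun (i j : Fin p) : (meanHessMatFun a b K i j θ ε).IsLocal :=
  MatFun.isLocal_meanHessOf (hK.isLocal_inv_derivMatFun_nil hθ hε)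
    (hK.isLocal_inv_diagPart_inv_derivMatFun_nil hθ hε)
    (hK.isLocal_derivMatFun (by simp) hθ hε) (hK.isLocal_derivMatFun (by simp) hθ hε)

end Locality

variable {c : Config d} (hK : IsRegularFamily a b K)
include hK

lemma hasDerivWithinAt_derivMatFun {I : List (Fin p)} (hI : I.length < 3) (i : Fin p)
    (hθ : θ ∈ paramSet a b) :
    HasDerivWithinAt (fun s => derivMatFun a b K I (Function.update θ i s) ε c)
      (derivMatFun a b K (i :: I) θ ε c) (Set.Icc a b) (θ i) :=
  hasDerivWithinAt_matrix fun _ _ => (hK.differentiable I hI i θ hθ _).hasDerivWithinAt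

variable (hε : ε ∈ Set.Ico (0 : ℝ) (1 / 2)) (hc : c.Valid) (hθ : θ ∈ paramSet a b)
include hε hc hθ

lemma isUnit_derivMatFun_nil : IsUnit (derivMatFun a b K [] θ ε c) := by
  obtain ⟨m, hm, hcoer⟩ := hK.exists_isCoerciveWith hθ hε
  exact (hcoer c hc).isUnit hm

lemma inv_derivMatFun_nil_apply_self_ne_zero (k : c.ι) :
    (derivMatFun a b K [] θ ε c)⁻¹ k k ≠ 0 := by
  obtain ⟨m, hm, hdiag⟩ := hK.exists_le_inv_derivMatFun_nil_apply_self hθ hε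
  exact (hm.trans_le (hdiag c hc k)).ne'

lemma hasDerivWithinAt_gradMatFun (i j : Fin p) :
    HasDerivWithinAt (fun s => gradMatFun a b K j (Function.update θ i s) ε c)
      (hessMatFun a b K i j θ ε c) (Set.Icc a b) (θ i) := by
  have hR := hK.hasDerivWithinAt_derivMatFun (I := []) (ε := ε) (c := c) (by simp) i hθ
  have hD := hK.hasDerivWithinAt_derivMatFun (I := [j]) (ε := ε) (c := c) (by simp) i hθ
  have hderiv := hasDerivWithinAt_gradOf hR hD
  rw [Function.update_eq_self] at hderiv
  exact hderiv (hK.isUnit_derivMatFun_nil hε hc hθ)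
    (hK.inv_derivMatFun_nil_apply_self_ne_zero hε hc hθ)

lemma hasDerivWithinAt_dotProduct_criterion (y : c.ι → ℝ) (i : Fin p) :
    HasDerivWithinAt (fun s =>
        let A := (derivMatFun a b K [] (Function.update θ i s) ε c)⁻¹
        y ⬝ᵥ ((A * (diagonalPart A)⁻¹ ^ 2 * A) *ᵥ y))
      (2 * (y ⬝ᵥ (gradMatFun a b K i θ ε c *ᵥ y))) (Set.Icc a b) (θ i) := by
  rw [← dotProduct_add_transpose_mulVec]
  have hderiv := hasDerivWithinAt_criterion
    (hK.hasDerivWithinAt_derivMatFun (I := []) (ε := ε) (c := c) (by simp) i hθ)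
  rw [Function.update_eq_self] at hderiv
  exact hasDerivWithinAt_dotProduct_mulVec (hderiv (hK.isUnit_derivMatFun_nil hε hc hθ)
    (hK.inv_derivMatFun_nil_apply_self_ne_zero hε hc hθ)
    (congrFun (hK.transpose_derivMatFun [] hθ) c)
    (congrFun (hK.transpose_derivMatFun [i] hθ) c)) y

lemma two_mul_trace_hessMatFun_mul (i j : Fin p) :
    2 * (hessMatFun a b K i j θ ε c * derivMatFun a b K [] θ ε c).trace
      = (meanHessMatFun a b K i j θ ε c).trace :=
  two_mul_trace_hessOf_mul (congrFun (hK.transpose_derivMatFun [] hθ) c)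
    (congrFun (hK.transpose_derivMatFun [i] hθ) c) (congrFun (hK.transpose_derivMatFun [j] hθ) c)
    (hK.isUnit_derivMatFun_nil hε hc hθ) (hK.inv_derivMatFun_nil_apply_self_ne_zero hε hc hθ)

end IsRegularFamily

end CriterionDerivatives

section GridModel

open Matrix

variable {d p n : ℕ} {a b : ℝ} {K : (Fin p → ℝ) → EuclideanSpace ℝ (Fin d) → ℝ}

lemma pos_gridConfig (v : ℕ → Fin d → ℕ) (ε : ℝ) (x : Fin n → EuclideanSpace ℝ (Fin d))
    (k : Fin n) : (gridConfig v n x).pos ε k = gridPoint (v k) + ε • x k := by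
  have hsite : intPoint (intGrid v k) = gridPoint (v k) := by
    ext j
    simp only [intPoint, intGrid, gridPoint, Int.cast_natCast]
  exact congrArg (· + ε • x k) hsite

lemma gridPoint_sub_gridPoint (v : ℕ → Fin d → ℕ) (ε : ℝ) (x : Fin n → EuclideanSpace ℝ (Fin d))
    (k l : Fin n) : gridPoint (v k) - gridPoint (v l) + ε • (x k - x l)
      = (gridConfig v n x).pos ε k - (gridConfig v n x).pos ε l := by
  rw [pos_gridConfig v ε x k, pos_gridConfig v ε x l, add_sub_add_comm, smul_sub]

section Identification

variable (v : ℕ → Fin d → ℕ) (ε : ℝ) (x : Fin n → EuclideanSpace ℝ (Fin d)) (θ : Fin p → ℝ)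

lemma covMat_eq_derivMatFun :
    covMat K v ε x θ = (derivMatFun a b K [] θ ε).onGrid v n x := by
  ext k l
  rw [covMat, of_apply, gridPoint_sub_gridPoint]
  rfl

lemma dCovMat_eq_derivMatFun (i : Fin p) :
    dCovMat a b K v ε x i θ = (derivMatFun a b K [i] θ ε).onGrid v n x := by
  ext k l
  simp only [dCovMat, covMat, of_apply, gridPoint_sub_gridPoint]
  rfl

lemma gradMat_eq_gradMatFun (i : Fin p) :
    gradMat a b K v ε x i θ = (gradMatFun a b K i θ ε).onGrid v n x := by
  simp only [gradMat, covMat_eq_derivMatFun (a := a) (b := b), dCovMat_eq_derivMatFun]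
  rfl

lemma mCV1_eq_covGradMatFun (i j : Fin p) :
    mCV1 a b K v ε x θ i j = (covGradMatFun a b K i j θ ε).onGrid v n x := by
  simp only [mCV1, gradMat_eq_gradMatFun, covMat_eq_derivMatFun (a := a) (b := b)]
  rfl

lemma mCV2_eq_meanHessMatFun (i j : Fin p) :
    mCV2 a b K v ε x θ i j = (meanHessMatFun a b K i j θ ε).onGrid v n x := by
  simp only [mCV2, covMat_eq_derivMatFun (a := a) (b := b), dCovMat_eq_derivMatFun]
  rfl

lemma cv_eq_criterion (y : Fin n → ℝ) :
    cv K v ε x y θ = 1 / (n : ℝ) *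
      let A := ((derivMatFun a b K [] θ ε).onGrid v n x)⁻¹
      y ⬝ᵥ ((A * (diagonalPart A)⁻¹ ^ 2 * A) *ᵥ y) := by
  rw [cv, covMat_eq_derivMatFun (a := a) (b := b)]
  rfl

end Identification

variable {v : ℕ → Fin d → ℕ} {ε : ℝ} {x : Fin n → EuclideanSpace ℝ (Fin d)} {θ : Fin p → ℝ}
  (hK : IsRegularFamily a b K) (hε : ε ∈ Set.Ico (0 : ℝ) (1 / 2))
  (hv : Function.Injective (intGrid v)) (hx : ∀ k, x k ∈ unitCube d) (hθ : θ ∈ paramSet a b)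
include hK hε hv hx hθ

lemma isUnit_covMat : IsUnit (covMat K v ε x θ) := by
  rw [covMat_eq_derivMatFun (a := a) (b := b)]
  exact hK.isUnit_derivMatFun_nil hε (valid_gridConfig hv hx) hθ

lemma isUnit_diagPart_inv_covMat : IsUnit (diagPart (covMat K v ε x θ)⁻¹) := by
  rw [covMat_eq_derivMatFun (a := a) (b := b)]
  exact isUnit_diagonalPart
    (hK.inv_derivMatFun_nil_apply_self_ne_zero hε (valid_gridConfig hv hx) hθ)

lemma hasDerivWithinAt_cv (y : Fin n → ℝ) (i : Fin p) :
    HasDerivWithinAt (fun s => cv K v ε x y (Function.update θ i s))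
      (1 / (n : ℝ) * (2 * (y ⬝ᵥ (gradMat a b K v ε x i θ *ᵥ y)))) (Set.Icc a b) (θ i) := by
  simp only [cv_eq_criterion (a := a) (b := b), gradMat_eq_gradMatFun]
  exact (hK.hasDerivWithinAt_dotProduct_criterion hε (valid_gridConfig hv hx) hθ y i).const_mul _

variable (hab : a < b)
include hab

lemma partialDeriv_cv (y : Fin n → ℝ) (i : Fin p) :
    partialDeriv a b i (cv K v ε x y) θ
      = 1 / (n : ℝ) * (2 * (y ⬝ᵥ (gradMat a b K v ε x i θ *ᵥ y))) :=
  (hasDerivWithinAt_cv hK hε hv hx hθ y i).derivWithin (uniqueDiffOn_Icc hab _ (hθ i))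

lemma hasDerivWithinAt_partialDeriv_cv (y : Fin n → ℝ) (i j : Fin p) :
    HasDerivWithinAt (fun s => partialDeriv a b j (cv K v ε x y) (Function.update θ i s))
      (1 / (n : ℝ) * (2 * (y ⬝ᵥ ((hessMatFun a b K i j θ ε).onGrid v n x *ᵥ y))))
      (Set.Icc a b) (θ i) := by
  have hgrad : ∀ s ∈ Set.Icc a b, partialDeriv a b j (cv K v ε x y) (Function.update θ i s)
      = 1 / (n : ℝ) * (2 * (y ⬝ᵥ
          ((gradMatFun a b K j (Function.update θ i s) ε).onGrid v n x *ᵥ y))) := fun s hs => by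
    rw [partialDeriv_cv hK hε hv hx (update_mem_paramSet hθ i hs) hab, gradMat_eq_gradMatFun]
  refine HasDerivWithinAt.congr ?_ hgrad (hgrad _ (hθ i))
  exact ((hasDerivWithinAt_dotProduct_mulVec (hK.hasDerivWithinAt_gradMatFun hε
    (valid_gridConfig hv hx) hθ i j) y).const_mul 2).const_mul _

lemma iterPartialDeriv_cv (y : Fin n → ℝ) (i j : Fin p) :
    iterPartialDeriv a b [i, j] (cv K v ε x y) θ
      = 1 / (n : ℝ) * (2 * (y ⬝ᵥ ((hessMatFun a b K i j θ ε).onGrid v n x *ᵥ y))) :=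
  (hasDerivWithinAt_partialDeriv_cv hK hε hv hx hθ hab y i j).derivWithin
    (uniqueDiffOn_Icc hab _ (hθ i))

end GridModel

section CriterionMoments

open Matrix

variable {d p : ℕ} {a b : ℝ} {K : (Fin p → ℝ) → EuclideanSpace ℝ (Fin d) → ℝ}
  {θ : Fin p → ℝ} {ε : ℝ} {v : ℕ → Fin d → ℕ} {L : Measure (EuclideanSpace ℝ (Fin d))}
  {ΩX ΩY : Type*} [MeasurableSpace ΩX] [MeasurableSpace ΩY] {PX : Measure ΩX} {PY : Measure ΩY}
  {X : ℕ → ΩX → EuclideanSpace ℝ (Fin d)} {Y : EuclideanSpace ℝ (Fin d) → ΩY → ℝ}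

/-- The points of the grid moved by the perturbations `ε x_k`. -/
def perturbedGrid (v : ℕ → Fin d → ℕ) (ε : ℝ) (n : ℕ) (x : Fin n → EuclideanSpace ℝ (Fin d))
    (k : Fin n) : EuclideanSpace ℝ (Fin d) :=
  gridPoint (v k) + ε • x k

lemma measurable_perturbedGrid (v : ℕ → Fin d → ℕ) (ε : ℝ) (n : ℕ) (k : Fin n) :
    Measurable fun x => perturbedGrid v ε n x k :=
  ((measurable_pi_apply k).const_smul ε).const_add _

lemma covMat_eq_of_perturbedGrid (θ : Fin p → ℝ) (v : ℕ → Fin d → ℕ) (ε : ℝ) {n : ℕ}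
    (x : Fin n → EuclideanSpace ℝ (Fin d)) :
    covMat K v ε x θ
      = Matrix.of fun k l => K θ (perturbedGrid v ε n x k - perturbedGrid v ε n x l) := by
  ext k l
  simp only [covMat, perturbedGrid, of_apply, add_sub_add_comm, smul_sub]

/-- The quadratic form of the observations with the matrix that `F` attaches to the first `n`
perturbed points. -/
def observationQuad (v : ℕ → Fin d → ℕ) (ε : ℝ) (X : ℕ → ΩX → EuclideanSpace ℝ (Fin d))
    (Y : EuclideanSpace ℝ (Fin d) → ΩY → ℝ) (F : MatFun d) (n : ℕ) (ω : ΩX × ΩY) : ℝ :=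
  randomQuad (perturbedGrid v ε n) Y (F.onGrid v n)
    (firstPerturbations X n ω.1, ω.2)

variable (hK : IsRegularFamily a b K) (hε : ε ∈ Set.Ico (0 : ℝ) (1 / 2)) (hθ : θ ∈ paramSet a b)
  (hv : Function.Injective (intGrid v)) (hL : ∀ᵐ t ∂L, t ∈ unitCube d)
  (hXm : ∀ k, Measurable (X k)) (hXL : ∀ k, PX.map (X k) = L) (n : ℕ)

section Differentiation

variable (hab : a < b)
include hK hε hθ hv hL hXm hXL hab

lemma sqrt_mul_partialDeriv_randomCV_ae_eq (i : Fin p) :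
    (fun ω => √(n : ℝ) * partialDeriv a b i (randomCV K v ε X Y n ω) θ) =ᵐ[PX.prod PY]
      (√(n : ℝ) * (1 / n * 2)) • observationQuad v ε X Y (gradMatFun a b K i θ ε) n := by
  filter_upwards [Measure.quasiMeasurePreserving_fst.ae (ae_forall_mem_unitCube hL hXm hXL)]
    with ω hω
  rw [randomCV, partialDeriv_cv hK hε hv (x := firstPerturbations X n ω.1) (fun k => hω k) hθ hab,
    gradMat_eq_gradMatFun, Pi.smul_apply, smul_eq_mul, mul_assoc, mul_assoc]
  rfl

lemma iterPartialDeriv_randomCV_ae_eq (i j : Fin p) :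
    (fun ω => iterPartialDeriv a b [i, j] (randomCV K v ε X Y n ω) θ) =ᵐ[PX.prod PY]
      ((1 / n * 2 : ℝ)) • observationQuad v ε X Y (hessMatFun a b K i j θ ε) n := by
  filter_upwards [Measure.quasiMeasurePreserving_fst.ae (ae_forall_mem_unitCube hL hXm hXL)]
    with ω hω
  rw [randomCV, iterPartialDeriv_cv hK hε hv (x := firstPerturbations X n ω.1) (fun k => hω k) hθ
    hab, Pi.smul_apply, smul_eq_mul, mul_assoc]
  rfl

end Differentiation

variable [IsProbabilityMeasure PX] [IsProbabilityMeasure PY]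
  (hYm : Measurable (Function.uncurry Y))
  (hY : IsCenteredGaussianProcess Y (fun s t => K θ (s - t)) PY)

section QuadraticForms

variable {F G : MatFun d} (hF : F.IsLocal) (hG : G.IsLocal)
include hv hL hXm hXL hYm hY hF

lemma memLp_observationQuad : MemLp (observationQuad v ε X Y F n) 2 (PX.prod PY) :=
  memLp_randomQuad (measurable_firstPerturbations hXm n) (measurable_perturbedGrid v ε n) hYm hY
    (fun t => congrArg (K θ) (sub_self t)) (hF.isEssBounded hv hL hXm hXL n)

lemma condExp_observationQuad :
    (PX.prod PY)[observationQuad v ε X Y F n | perturbationSigma ΩY X n] =ᵐ[PX.prod PY]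
      fun ω => (F.onGrid v n (firstPerturbations X n ω.1) *
        covMat K v ε (firstPerturbations X n ω.1) θ).trace := by
  have hquad := condExp_randomQuad (measurable_firstPerturbations hXm n)
    (measurable_perturbedGrid v ε n) hYm hY (fun t => congrArg (K θ) (sub_self t))
    (hF.isEssBounded hv hL hXm hXL n)
  simp only [covMat_eq_of_perturbedGrid]
  exact hquad

include hG

lemma condCov_observationQuad :
    condCov (perturbationSigma ΩY X n) (observationQuad v ε X Y F n)
        (observationQuad v ε X Y G n) (PX.prod PY) =ᵐ[PX.prod PY]
      fun ω =>
        let R := covMat K v ε (firstPerturbations X n ω.1) θ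
        let M := F.onGrid v n (firstPerturbations X n ω.1)
        let N := G.onGrid v n (firstPerturbations X n ω.1)
        (M * R * Nᵀ * R).trace + (M * R * N * R).trace := by
  have hquad := condCov_randomQuad (measurable_firstPerturbations hXm n)
    (measurable_perturbedGrid v ε n) hYm hY (fun t => congrArg (K θ) (sub_self t))
    (hF.isEssBounded hv hL hXm hXL n) (hG.isEssBounded hv hL hXm hXL n)
  simp only [covMat_eq_of_perturbedGrid]
  exact hquad

end QuadraticForms

variable (hab : a < b)
include hK hε hθ hv hL hXm hXL hYm hY hab

lemma memLp_sqrt_mul_partialDeriv_randomCV (i : Fin p) :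
    MemLp (fun ω => √(n : ℝ) * partialDeriv a b i (randomCV K v ε X Y n ω) θ) 2 (PX.prod PY) :=
  (memLp_congr_ae (sqrt_mul_partialDeriv_randomCV_ae_eq hK hε hθ hv hL hXm hXL n hab i)).2
    ((memLp_observationQuad hv hL hXm hXL n hYm hY (hK.isLocal_gradMatFun hθ hε i)).const_smul _)

lemma condCov_sqrt_mul_partialDeriv_randomCV (i j : Fin p) :
    condCov (perturbationSigma ΩY X n)
        (fun ω => √(n : ℝ) * partialDeriv a b i (randomCV K v ε X Y n ω) θ)
        (fun ω => √(n : ℝ) * partialDeriv a b j (randomCV K v ε X Y n ω) θ) (PX.prod PY)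
      =ᵐ[PX.prod PY] fun ω =>
        1 / (n : ℝ) * (mCV1 a b K v ε (firstPerturbations X n ω.1) θ i j).trace := by
  have hcongr := condCov_congr (m := perturbationSigma ΩY X n)
    (sqrt_mul_partialDeriv_randomCV_ae_eq (PY := PY) (Y := Y) hK hε hθ hv hL hXm hXL n hab i)
    (sqrt_mul_partialDeriv_randomCV_ae_eq (PY := PY) (Y := Y) hK hε hθ hv hL hXm hXL n hab j)
  have hquad := condCov_observationQuad (ε := ε) hv hL hXm hXL n hYm hY
    (hK.isLocal_gradMatFun hθ hε i) (hK.isLocal_gradMatFun hθ hε j)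
  filter_upwards [hcongr.trans (condCov_const_mul _ _ _), hquad] with ω hω hquadω
  have hsq : (√(n : ℝ) * (1 / n * 2)) ^ 2 = 4 * (1 / n) := by
    rw [mul_pow, Real.sq_sqrt n.cast_nonneg]
    rcases n.eq_zero_or_pos with rfl | hn
    · simp
    · field_simp
      norm_num
  have hR : (covMat K v ε (firstPerturbations X n ω.1) θ)ᵀ
      = covMat K v ε (firstPerturbations X n ω.1) θ := by
    rw [covMat_eq_derivMatFun (a := a) (b := b)]
    exact congrFun (hK.transpose_derivMatFun [] hθ) _
  rw [hω, Pi.smul_apply, hquadω, hsq, smul_eq_mul, mCV1, trace_smul, trace_add_transpose_mul _ _ hR,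
    smul_eq_mul, gradMat_eq_gradMatFun, gradMat_eq_gradMatFun]
  ring

lemma integrable_iterPartialDeriv_randomCV (i j : Fin p) :
    Integrable (fun ω => iterPartialDeriv a b [i, j] (randomCV K v ε X Y n ω) θ) (PX.prod PY) :=
  (integrable_congr (iterPartialDeriv_randomCV_ae_eq hK hε hθ hv hL hXm hXL n hab i j)).2
    (((memLp_observationQuad hv hL hXm hXL n hYm hY
      (hK.isLocal_hessMatFun hθ hε i j)).integrable one_le_two).smul _)

lemma condExp_iterPartialDeriv_randomCV (i j : Fin p) :
    (PX.prod PY)[fun ω => iterPartialDeriv a b [i, j] (randomCV K v ε X Y n ω) θ |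
        perturbationSigma ΩY X n] =ᵐ[PX.prod PY] fun ω =>
      1 / (n : ℝ) * (mCV2 a b K v ε (firstPerturbations X n ω.1) θ i j).trace := by
  have hcongr := condExp_congr_ae (m := perturbationSigma ΩY X n)
    (iterPartialDeriv_randomCV_ae_eq (PY := PY) (Y := Y) hK hε hθ hv hL hXm hXL n hab i j)
  filter_upwards [hcongr.trans (condExp_smul _ _ _),
    condExp_observationQuad (ε := ε) hv hL hXm hXL n hYm hY (hK.isLocal_hessMatFun hθ hε i j),
    Measure.quasiMeasurePreserving_fst.ae (ae_forall_mem_unitCube hL hXm hXL)] with ω hω hquad hcube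
  have htrace := hK.two_mul_trace_hessMatFun_mul hε
    (valid_gridConfig hv (x := firstPerturbations X n ω.1) fun k => hcube k) hθ i j
  rw [hω, Pi.smul_apply, hquad, smul_eq_mul, mul_assoc, covMat_eq_derivMatFun (a := a) (b := b),
    mCV2_eq_meanHessMatFun]
  exact congrArg (1 / (n : ℝ) * ·) htrace

end CriterionMoments

section AsymptoticTraces

variable {d p : ℕ}

/-- The limit of the expected central diagonal coefficients, which is the almost sure limit of the
normalized traces when `F` is local; a junk value if they do not converge. -/
def asymptoticMeanTrace (F : MatFun d) (L : Measure (EuclideanSpace ℝ (Fin d))) : ℝ :=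
  limUnder atTop (meanCentralCoeff F L)

variable {ΩX : Type*} [MeasurableSpace ΩX] {PX : Measure ΩX} [IsProbabilityMeasure PX]
  {L : Measure (EuclideanSpace ℝ (Fin d))} [IsProbabilityMeasure L] {v : ℕ → Fin d → ℕ}
  {X : ℕ → ΩX → EuclideanSpace ℝ (Fin d)}
  (hd : 0 < d) (hv : IsGridEnumeration v) (hL : ∀ᵐ t ∂L, t ∈ unitCube d)
  (hXm : ∀ k, Measurable (X k)) (hXL : ∀ k, PX.map (X k) = L) (hind : iIndepFun X PX)
include hd hv hL hXm hXL hind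

lemma MatFun.IsLocal.ae_tendsto_one_div_mul_trace {F : MatFun d} (hF : F.IsLocal) :
    ∀ᵐ ω ∂PX, Tendsto
      (fun n : ℕ => 1 / (n : ℝ) * (F.onGrid v n (firstPerturbations X n ω)).trace) atTop
      (𝓝 (asymptoticMeanTrace F L)) := by
  simp only [one_div_mul_eq_div]
  exact hF.ae_tendsto_trace_div hd hv hL hXm hXL hind
    (tendsto_nhds_limUnder (hF.exists_tendsto_meanCentralCoeff hL))

variable {a b : ℝ} {K : (Fin p → ℝ) → EuclideanSpace ℝ (Fin d) → ℝ} {θ : Fin p → ℝ} {ε : ℝ}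
  (hK : IsRegularFamily a b K) (hε : ε ∈ Set.Ico (0 : ℝ) (1 / 2)) (hθ : θ ∈ paramSet a b)
include hK hε hθ

lemma ae_tendsto_trace_mCV1 (i j : Fin p) :
    ∀ᵐ ω ∂PX, Tendsto
      (fun n : ℕ => 1 / (n : ℝ) * (mCV1 a b K v ε (firstPerturbations X n ω) θ i j).trace) atTop
      (𝓝 (asymptoticMeanTrace (covGradMatFun a b K i j θ ε) L)) := by
  simp only [mCV1_eq_covGradMatFun]
  exact (hK.isLocal_covGradMatFun hθ hε i j).ae_tendsto_one_div_mul_trace hd hv hL hXm hXL hind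

lemma ae_tendsto_trace_mCV2 (i j : Fin p) :
    ∀ᵐ ω ∂PX, Tendsto
      (fun n : ℕ => 1 / (n : ℝ) * (mCV2 a b K v ε (firstPerturbations X n ω) θ i j).trace) atTop
      (𝓝 (asymptoticMeanTrace (meanHessMatFun a b K i j θ ε) L)) := by
  simp only [mCV2_eq_meanHessMatFun]
  exact (hK.isLocal_meanHessMatFun hθ hε i j).ae_tendsto_one_div_mul_trace hd hv hL hXm hXL hind

end AsymptoticTraces

end KrigingCV

end

open KrigingCV in
theorem mainTheorem5_general {d p : ℕ} (hd : 0 < d) {a b : ℝ} (hab : 0 < p → a < b)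
    {K : (Fin p → ℝ) → EuclideanSpace ℝ (Fin d) → ℝ} (hK : IsRegularFamily a b K)
    {θ₀ : Fin p → ℝ} (hθ₀ : θ₀ ∈ paramSet a b)
    (L : Measure (EuclideanSpace ℝ (Fin d))) [IsProbabilityMeasure L]
    (hL : ∀ᵐ t ∂L, t ∈ unitCube d) :
    ∃ S₁ S₂ : ℝ → Matrix (Fin p) (Fin p) ℝ,
      ∀ ε ∈ Set.Ico (0 : ℝ) (1 / 2), ∀ v : ℕ → Fin d → ℕ, IsGridEnumeration v →
        (∀ n : ℕ, 1 ≤ n → ∀ x : Fin n → EuclideanSpace ℝ (Fin d), (∀ k, x k ∈ unitCube d) →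
          ∀ θ ∈ paramSet a b,
            IsUnit (covMat K v ε x θ) ∧ IsUnit (diagPart (covMat K v ε x θ)⁻¹) ∧
            ∀ y : Fin n → ℝ,
              (∀ i : Fin p, HasDerivWithinAt (fun s => cv K v ε x y (Function.update θ i s))
                (1 / (n : ℝ) * (2 * (y ⬝ᵥ (gradMat a b K v ε x i θ).mulVec y)))
                (Set.Icc a b) (θ i)) ∧
              (∀ i j : Fin p, DifferentiableWithinAt ℝ
                (fun s => partialDeriv a b j (cv K v ε x y) (Function.update θ i s))
                (Set.Icc a b) (θ i))) ∧
        ∀ (ΩX : Type*) [MeasurableSpace ΩX] (PX : Measure ΩX) [IsProbabilityMeasure PX]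
          (X : ℕ → ΩX → EuclideanSpace ℝ (Fin d)),
          (∀ k, Measurable (X k)) → (∀ k, PX.map (X k) = L) → iIndepFun X PX →
          (∀ i j : Fin p,
            (∀ᵐ ω ∂PX, Tendsto
              (fun n : ℕ => 1 / (n : ℝ) *
                (mCV1 a b K v ε (firstPerturbations X n ω) θ₀ i j).trace)
              atTop (𝓝 (S₁ ε i j))) ∧
            (∀ᵐ ω ∂PX, Tendsto
              (fun n : ℕ => 1 / (n : ℝ) *
                (mCV2 a b K v ε (firstPerturbations X n ω) θ₀ i j).trace)
              atTop (𝓝 (S₂ ε i j)))) ∧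
          ∀ (ΩY : Type*) [MeasurableSpace ΩY] (PY : Measure ΩY) [IsProbabilityMeasure PY]
            (Y : EuclideanSpace ℝ (Fin d) → ΩY → ℝ),
            Measurable (Function.uncurry Y) → IsGaussianProcess Y PY →
            (∀ t, ∫ ω, Y t ω ∂PY = 0) → (∀ s t, cov[Y s, Y t; PY] = K θ₀ (s - t)) →
            ∀ n : ℕ, 1 ≤ n →
              (∀ i : Fin p, MemLp
                (fun ω => √(n : ℝ) * partialDeriv a b i (randomCV K v ε X Y n ω) θ₀) 2
                (PX.prod PY)) ∧
              (∀ i j : Fin p, condCov (perturbationSigma ΩY X n)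
                  (fun ω => √(n : ℝ) * partialDeriv a b i (randomCV K v ε X Y n ω) θ₀)
                  (fun ω => √(n : ℝ) * partialDeriv a b j (randomCV K v ε X Y n ω) θ₀)
                  (PX.prod PY)
                =ᵐ[PX.prod PY] fun ω => 1 / (n : ℝ) *
                  (mCV1 a b K v ε (firstPerturbations X n ω.1) θ₀ i j).trace) ∧
              (∀ i j : Fin p, Integrable
                (fun ω => iterPartialDeriv a b [i, j] (randomCV K v ε X Y n ω) θ₀)
                (PX.prod PY)) ∧
              (∀ i j : Fin p,
                (PX.prod PY)[fun ω => iterPartialDeriv a b [i, j] (randomCV K v ε X Y n ω) θ₀ |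
                  perturbationSigma ΩY X n]
                =ᵐ[PX.prod PY] fun ω => 1 / (n : ℝ) *
                  (mCV2 a b K v ε (firstPerturbations X n ω.1) θ₀ i j).trace) := by
  refine ⟨fun ε => .of fun i j => asymptoticMeanTrace (covGradMatFun a b K i j θ₀ ε) L,
    fun ε => .of fun i j => asymptoticMeanTrace (meanHessMatFun a b K i j θ₀ ε) L,
    fun ε hε v hv => ?_⟩
  have hinj := hv.injective_intGrid hd
  refine ⟨fun n _ x hx θ hθ => ⟨isUnit_covMat hK hε hinj hx hθ,
    isUnit_diagPart_inv_covMat hK hε hinj hx hθ, fun y =>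
      ⟨hasDerivWithinAt_cv hK hε hinj hx hθ y, fun i j =>
        (hasDerivWithinAt_partialDeriv_cv hK hε hinj hx hθ (hab i.pos) y i j)
          |>.differentiableWithinAt⟩⟩, fun ΩX _ PX _ X hXm hXL hind => ⟨fun i j =>
      ⟨ae_tendsto_trace_mCV1 hd hv hL hXm hXL hind hK hε hθ₀ i j,
        ae_tendsto_trace_mCV2 hd hv hL hXm hXL hind hK hε hθ₀ i j⟩,
      fun ΩY _ PY _ Y hYm hYgauss hYmean hYcov n _ => ?_⟩⟩
  have hY : IsCenteredGaussianProcess Y (fun s t => K θ₀ (s - t)) PY := ⟨hYgauss, hYmean, hYcov⟩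
  exact ⟨
    fun i => memLp_sqrt_mul_partialDeriv_randomCV hK hε hθ₀ hinj hL hXm hXL n hYm hY (hab i.pos) i,
    fun i => condCov_sqrt_mul_partialDeriv_randomCV hK hε hθ₀ hinj hL hXm hXL n hYm hY
      (hab i.pos) i,
    fun i => integrable_iterPartialDeriv_randomCV hK hε hθ₀ hinj hL hXm hXL n hYm hY (hab i.pos) i,
    fun i => condExp_iterPartialDeriv_randomCV hK hε hθ₀ hinj hL hXm hXL n hYm hY (hab i.pos) i⟩

theorem mainTheorem5 {d p : ℕ} (hd : 0 < d) (a b : ℝ)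
    (K : (Fin p → ℝ) → EuclideanSpace ℝ (Fin d) → ℝ)
    (hK : KrigingCV.IsRegularFamily a b K)
    (θ₀ : Fin p → ℝ) (hθ₀ : ∀ i, θ₀ i ∈ Set.Ioo a b)
    (L : Measure (EuclideanSpace ℝ (Fin d))) (hL : KrigingCV.IsPerturbationLaw L) :
    -- the limit matrices are functions of `ε` alone, chosen before everything below
    ∃ S₁ S₂ : ℝ → Matrix (Fin p) (Fin p) ℝ,
      ∀ ε ∈ Set.Ico (0 : ℝ) (1 / 2), ∀ v : ℕ → Fin d → ℕ, KrigingCV.IsGridEnumeration v →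
        -- the gradient (and existence of the second order partial derivatives) on all of `Θ`
        (∀ n : ℕ, 1 ≤ n → ∀ x : Fin n → EuclideanSpace ℝ (Fin d), (∀ k, x k ∈ L.support) →
          ∀ θ ∈ KrigingCV.paramSet a b,
            IsUnit (KrigingCV.covMat K v ε x θ) ∧
            IsUnit (KrigingCV.diagPart (KrigingCV.covMat K v ε x θ)⁻¹) ∧
            ∀ y : Fin n → ℝ,
              (∀ i : Fin p, HasDerivWithinAt
                (fun s => KrigingCV.cv K v ε x y (Function.update θ i s))
                ((1 / (n : ℝ)) *
                  (2 * (y ⬝ᵥ (KrigingCV.gradMat a b K v ε x i θ).mulVec y)))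
                (Set.Icc a b) (θ i)) ∧
              (∀ i j : Fin p, DifferentiableWithinAt ℝ
                (fun s => KrigingCV.partialDeriv a b j (KrigingCV.cv K v ε x y)
                  (Function.update θ i s))
                (Set.Icc a b) (θ i))) ∧
        ∀ (ΩX : Type*) [MeasurableSpace ΩX] (PX : Measure ΩX) [IsProbabilityMeasure PX]
          (X : ℕ → ΩX → EuclideanSpace ℝ (Fin d)),
          (∀ k, Measurable (X k)) → (∀ k, PX.map (X k) = L) → iIndepFun X PX →
          -- almost sure convergence of the normalized traces
          (∀ i j : Fin p,
            (∀ᵐ ω ∂PX, Tendsto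
              (fun n : ℕ => (1 / (n : ℝ)) *
                (KrigingCV.mCV1 a b K v ε (KrigingCV.firstPerturbations X n ω) θ₀ i j).trace)
              atTop (𝓝 (S₁ ε i j))) ∧
            (∀ᵐ ω ∂PX, Tendsto
              (fun n : ℕ => (1 / (n : ℝ)) *
                (KrigingCV.mCV2 a b K v ε (KrigingCV.firstPerturbations X n ω) θ₀ i j).trace)
              atTop (𝓝 (S₂ ε i j)))) ∧
          -- conditional moments, for a centered Gaussian process with covariance function `K θ₀`
          ∀ (ΩY : Type*) [MeasurableSpace ΩY] (PY : Measure ΩY) [IsProbabilityMeasure PY]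
            (Y : EuclideanSpace ℝ (Fin d) → ΩY → ℝ),
            Measurable (Function.uncurry Y) → IsGaussianProcess Y PY →
            (∀ t, ∫ ω, Y t ω ∂PY = 0) → (∀ s t, cov[Y s, Y t; PY] = K θ₀ (s - t)) →
            ∀ n : ℕ, 1 ≤ n →
              (∀ i : Fin p, MemLp
                (fun ω => √(n : ℝ) * KrigingCV.partialDeriv a b i
                  (KrigingCV.randomCV K v ε X Y n ω) θ₀) 2 (PX.prod PY)) ∧
              (∀ i j : Fin p,
                KrigingCV.condCov (KrigingCV.perturbationSigma ΩY X n)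
                  (fun ω => √(n : ℝ) * KrigingCV.partialDeriv a b i
                    (KrigingCV.randomCV K v ε X Y n ω) θ₀)
                  (fun ω => √(n : ℝ) * KrigingCV.partialDeriv a b j
                    (KrigingCV.randomCV K v ε X Y n ω) θ₀)
                  (PX.prod PY)
                =ᵐ[PX.prod PY] fun ω => (1 / (n : ℝ)) *
                  (KrigingCV.mCV1 a b K v ε
                    (KrigingCV.firstPerturbations X n ω.1) θ₀ i j).trace) ∧
              (∀ i j : Fin p, Integrable
                (fun ω => KrigingCV.iterPartialDeriv a b [i, j]
                  (KrigingCV.randomCV K v ε X Y n ω) θ₀) (PX.prod PY)) ∧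
              (∀ i j : Fin p,
                (PX.prod PY)[fun ω => KrigingCV.iterPartialDeriv a b [i, j]
                    (KrigingCV.randomCV K v ε X Y n ω) θ₀ |
                  KrigingCV.perturbationSigma ΩY X n]
                =ᵐ[PX.prod PY] fun ω => (1 / (n : ℝ)) *
                  (KrigingCV.mCV2 a b K v ε
                    (KrigingCV.firstPerturbations X n ω.1) θ₀ i j).trace) := by
  have := hL.prob
  obtain ⟨S₁, S₂, h⟩ := mainTheorem5_general hd
    (fun hp => (hθ₀ ⟨0, hp⟩).1.trans (hθ₀ ⟨0, hp⟩).2) hK (fun i => Set.Ioo_subset_Icc_self (hθ₀ i))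
    L (mem_of_superset Measure.support_mem_ae hL.support_subset)
  exact ⟨S₁, S₂, fun ε hε v hv => ⟨fun n hn x hx =>
    (h ε hε v hv).1 n hn x fun k => hL.support_subset _ (hx k), (h ε hε v hv).2⟩⟩
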